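/- **Setting.** Let $n\ge 1$ and let $X$ be a complex Banach space with bounded operators $L(X)$. A *hyperoperator* on $\mathbb R^n$ is a continuous linear multiplicative map $A:\mathcal D(\mathbb R^n)\to L(X)$ such that $\bigcup_\phi \operatorname{Im}A(\phi)$ is dense in $X$ and $\bigcap_\phi\operatorname{Ker}A(\phi)=\{0\}$. Its spectrum $\sigma(a)\subset\mathbb R^n\subset\mathbb C^n$ is the support of the distribution $A$. It is *temperate* if it extends to a continuous linear map $\mathcal S(\mathbb R^n)\to L(X)$, which is then unique and again denoted $A$. Such an $A$ satisfies $\|A(\phi)\|\le C\max_{k,l\le M}\sup_\xi |\xi|^k|D^l\phi(\xi)|$ for some $M$ and $C$. If a smooth function $f$ on $\mathbb R^n$ is a limit of Schwartz functions $\phi_j$ in these seminorms, for some such $M$, and $A(\phi_j)\to T$ in operator norm, we write $f(\xi)|_{\xi=a}=T$; this $T$ depends only on $f$ and $A$. On $\mathbb C^n\setminus\{0\}$ let $\omega_\zeta=b\wedge(\bar\partial b)^{n-1}$ with $b=\sum_j\bar\zeta_j\,d\zeta_j/(2\pi i|\zeta|^2)$ be the Bochner–Martinelli form. For $\xi\in\mathbb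 R^n$ and $m\in\mathbb N$ put $$\omega^m_{\zeta-\xi}=\Big(\frac{1+\zeta\cdot\xi}{1+|\xi|^2}\Big)^m\omega_{\zeta-\xi},\qquad \zeta\cdot\xi=\sum_j\zeta_j\xi_j,$$ a form in $\zeta$, and put $\omega^m_{\zeta-a}=\omega^m_{\zeta-\xi}|_{\xi=a}$ coefficientwise, for $\zeta\in\mathbb C^n\setminus\mathbb R^n$. Integrals over $\mathbb C^n$ refer to the orientation in which $dx_1\wedge dy_1\wedge\dots\wedge dx_n\wedge dy_n$ is positive. For $\phi\in\mathcal S(\mathbb R^n)$, an *almost holomorphic extension* of $\phi$ means here a $C^\infty$ function $\tilde\phi$ on $\mathbb C^n$ with $\tilde\phi=\phi$ on $\mathbb R^n$, $\tilde\phi=\mathcal O((1+|\zeta|)^{-M})$ for every $M\ge0$, and $\bar\partial\tilde\phi=\mathcal O(|\operatorname{Im}\zeta|^{M_1}(1+|\zeta|)^{-M_2})$ for all $M_1,M_2\ge0$. **Proposition 7.1.** Let $A$ be a temperate hyperoperator on $\mathbb R^n$. There is $m_0$, depending only on $A$, such that for every $m\ge m_0$ the following hold. 1. The $L(X)$-valued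 form $\omega^m_{\zeta-a}$ is well defined, $C^\infty$ in operator norm and $\bar\partial$-closed on $\mathbb C^n\setminus\mathbb R^n$. 2. It has a $C^\infty$, $\bar\partial$-closed extension to $\mathbb C^n\setminus\sigma(a)$. 3. Every $\phi\in\mathcal S(\mathbb R^n)$ has an almost holomorphic extension, and for each such extension $\tilde\phi$ $$A(\phi)=\int_{\mathbb C^n}\omega^m_{\zeta-a}\wedge\bar\partial\tilde\phi(\zeta),$$ where the integral converges absolutely. 4. The formula $\psi\mapsto\big(\int_{\mathbb C^n}\omega^m_{\zeta-\xi}\wedge\psi(\zeta)\big)\big|_{\xi=a}$ is well defined for all smooth compactly supported $1$-forms $\psi$ on $\mathbb C^n$, and the current $\omega^m_{\zeta-a}$ that it defines satisfies $\bar\partial\omega^m_{\zeta-a}=[a]$, that is, its value at $\bar\partial u$ is $A(u|_{\mathbb R^n})$ for every $u\in\mathcal D(\mathbb C^n)$. 5. If $F\subset\mathbb C^n$ is closed and there is a (real) differentiable $\bar\partial$-closed $L(X)$-valued form of degree $2n-1$ on $\mathbb C^n\setminus F$ that agrees with $\omega^m_{\zeta-a}$ on $\mathbb C^n\setminus(\mathbb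 R^n\cup F)$, then $\sigma(a)\subset F$. -/

import Mathlib

open MeasureTheory Set Filter Topology
open scoped Distributions SchwartzMap ContDiff ComplexConjugate

noncomputable section

namespace HyperOp

/-! ### Euclidean spaces -/

/-- Real Euclidean space `ℝⁿ`. -/
abbrev RSpace (n : ℕ) : Type := EuclideanSpace ℝ (Fin n)

/-- Complex Euclidean space `ℂⁿ`. -/
abbrev CSpace (n : ℕ) : Type := EuclideanSpace ℂ (Fin n)

/-- The inclusion `ℝⁿ ⊆ ℂⁿ`. -/
def toC {n : ℕ} (ξ : RSpace n) : CSpace n := WithLp.toLp 2 (fun j => (ξ j : ℂ))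

/-- `ℝⁿ` as a subset of `ℂⁿ`. -/
def realSet (n : ℕ) : Set (CSpace n) := range (toC (n := n))

/-- `Im ζ = (Im ζ₁, …, Im ζₙ)`. -/
def imPart {n : ℕ} (ζ : CSpace n) : RSpace n := WithLp.toLp 2 (fun j => (ζ j).im)

/-- The complex bilinear product `ζ · ξ = ∑ ζⱼ ξⱼ`. -/
def dotC {n : ℕ} (ζ : CSpace n) (ξ : RSpace n) : ℂ := ∑ j, ζ j * (ξ j : ℂ)

/-! ### Hyperoperators -/

/-- Test functions on `ℝⁿ`, complex valued. -/
abbrev Test (n : ℕ) : Type := 𝓓((⊤ : TopologicalSpace.Opens (RSpace n)), ℂ)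

/-- The pointwise product of two test functions. -/
def testMul {n : ℕ} (φ ψ : Test n) : Test n where
  toFun := fun ξ => φ ξ * ψ ξ
  contDiff' := φ.contDiff.mul ψ.contDiff
  hasCompactSupport' := φ.hasCompactSupport.mul_right
  tsupport_subset' := fun _ _ => trivial

variable {X : Type*} [NormedAddCommGroup X] [NormedSpace ℂ X]

/-- A hyperoperator on `ℝⁿ`: a continuous multiplicative linear map from test functions to bounded
operators, for which the union of the ranges is dense and the kernels intersect trivially. -/
structure Hyperoperator (n : ℕ) (X : Type*) [NormedAddCommGroup X] [NormedSpace ℂ X] where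
  /-- The operator-valued distribution. -/
  toCLM : Test n →L[ℂ] (X →L[ℂ] X)
  map_mul : ∀ φ ψ : Test n, toCLM (testMul φ ψ) = (toCLM φ).comp (toCLM ψ)
  dense_range : Dense (⋃ φ : Test n, range (toCLM φ))
  inter_ker : ∀ x : X, (∀ φ : Test n, toCLM φ x = 0) → x = 0

/-- The spectrum of a hyperoperator: its support as a distribution. -/
def Hyperoperator.spectrum {n : ℕ} (A : Hyperoperator n X) : Set (RSpace n) :=
  Distribution.dsupport (fun φ : Test n => A.toCLM φ)

/-- `B` is an extension of `A` to a continuous linear map on the Schwartz space. The hyperoperator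
`A` is temperate when such a `B` exists, and `B` is then unique. -/
def Hyperoperator.ExtendsTo {n : ℕ} (A : Hyperoperator n X)
    (B : 𝓢(RSpace n, ℂ) →L[ℂ] (X →L[ℂ] X)) : Prop :=
  ∀ φ : Test n, B (φ.hasCompactSupport.toSchwartzMap φ.contDiff) = A.toCLM φ

/-! ### Evaluation on smooth functions of finite decay -/

/-- `‖B φ‖` is bounded by a constant times the seminorms
`sup |ξ|ᵏ |Dˡ φ|` with `k, l ≤ M`. -/
def HasOrder {n : ℕ} (B : 𝓢(RSpace n, ℂ) →L[ℂ] (X →L[ℂ] X)) (M : ℕ) : Prop :=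
  ∃ C : ℝ, ∀ φ : 𝓢(RSpace n, ℂ),
    ‖B φ‖ ≤ C * (Finset.Iic (M, M)).sup (schwartzSeminormFamily ℂ (RSpace n) ℂ) φ

/-- The seminorms `sup |ξ|ᵏ |Dˡ (f - g)|` with `k, l ≤ M` are all at most `ε`. -/
def IsCloseTo {n : ℕ} (M : ℕ) (ε : ℝ) (f g : RSpace n → ℂ) : Prop :=
  ∀ k ≤ M, ∀ l ≤ M, ∀ ξ : RSpace n,
    ‖ξ‖ ^ k * ‖iteratedFDeriv ℝ l (fun x => f x - g x) ξ‖ ≤ ε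

/-- `T` is the value `f(ξ)|_{ξ = a}` of `B` at the smooth function `f`, in the sense of extension
by continuity: for some `M` such that `B` has order `M`, the function `f` is a limit, in the
corresponding seminorms, of Schwartz functions whose images under `B` converge to `T` in operator
norm. The operator `T` is determined by `B` and `f`. -/
def IsValueAt {n : ℕ} (B : 𝓢(RSpace n, ℂ) →L[ℂ] (X →L[ℂ] X)) (f : RSpace n → ℂ)
    (T : X →L[ℂ] X) : Prop :=
  ContDiff ℝ ∞ f ∧ ∃ M : ℕ, HasOrder B M ∧ ∃ u : ℕ → 𝓢(RSpace n, ℂ),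
    (∀ ε : ℝ, 0 < ε → ∀ᶠ j in atTop, IsCloseTo M ε f (u j)) ∧
      Tendsto (fun j => B (u j)) atTop (𝓝 T)

/-- The value of `B` at `f` is unique. -/
theorem IsValueAt.unique {n : ℕ} {B : 𝓢(RSpace n, ℂ) →L[ℂ] (X →L[ℂ] X)} {f : RSpace n → ℂ} {T T' : X →L[ℂ] X}
    (h : IsValueAt B f T) (h2 : IsValueAt B f T') : T = T' := by
  obtain ⟨hf, M, hM, u, hu, hT⟩ := h
  obtain ⟨-, M', hM', u', hu', hT'⟩ := h2
  have key : ∀ N, N ≤ M → N ≤ M' → HasOrder B N → T = T' := by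
    rintro N hN hN' ⟨C, hC⟩
    have hlim : Tendsto (fun j => B (u j) - B (u' j)) atTop (𝓝 (T - T')) := hT.sub hT'
    have h0 : Tendsto (fun j => B (u j) - B (u' j)) atTop (𝓝 0) := by
      rw [tendsto_zero_iff_norm_tendsto_zero]
      rw [Metric.tendsto_atTop]
      intro ε hε
      have hδ : 0 < ε / (4 * (|C| + 1)) := by positivity
      obtain ⟨J, hJ⟩ := eventually_atTop.1 ((hu _ hδ).and (hu' _ hδ))
      refine ⟨J, fun j hj => ?_⟩
      obtain ⟨h1, h2⟩ := hJ j hj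
      have hs : (Finset.Iic (N, N)).sup (schwartzSeminormFamily ℂ (RSpace n) ℂ) (u j - u' j)
          ≤ 2 * (ε / (4 * (|C| + 1))) := by
        refine Seminorm.finset_sup_apply_le (by positivity) ?_
        rintro ⟨k, l⟩ hkl
        have hk : k ≤ N ∧ l ≤ N := by simpa [Prod.le_def] using hkl
        refine SchwartzMap.seminorm_le_bound ℂ k l _ (by positivity) ?_
        intro ξ
        have e : (⇑(u j - u' j) : RSpace n → ℂ) = fun x => (f x - u' j x) - (f x - u j x) := by
          funext x; simp
        have a := h1 k (hk.1.trans hN) l (hk.2.trans hN) ξ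
        have b := h2 k (hk.1.trans hN') l (hk.2.trans hN') ξ
        have c1 : ContDiff ℝ l (fun x => f x - u j x) :=
          (hf.of_le (by exact_mod_cast le_top)).sub ((u j).smooth l)
        have c2 : ContDiff ℝ l (fun x => f x - u' j x) :=
          (hf.of_le (by exact_mod_cast le_top)).sub ((u' j).smooth l)
        rw [e]
        have := iteratedFDeriv_sub_apply (x := ξ) c2.contDiffAt c1.contDiffAt
        have e2 : (fun x => (f x - u' j x) - (f x - u j x)) = (fun x => f x - u' j x) - (fun x => f x - u j x) := rfl
        rw [e2, this]
        calc _ ≤ ‖ξ‖ ^ k * (_ + _) := by gcongr; exact norm_sub_le _ _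
          _ ≤ _ := by rw [mul_add]; linarith
      have := hC (u j - u' j)
      rw [map_sub] at this
      have h3 : C * (Finset.Iic (N, N)).sup (schwartzSeminormFamily ℂ (RSpace n) ℂ) (u j - u' j)
          ≤ (|C|+1) * (2 * (ε / (4 * (|C| + 1)))) := by
        refine mul_le_mul ((le_abs_self C).trans (by linarith)) hs (apply_nonneg _ _) (by positivity)
      have h4 : (|C|+1) * (2 * (ε / (4 * (|C| + 1)))) = ε / 2 := by field_simp; ring
      rw [dist_zero_right, norm_norm]
      linarith
    exact sub_eq_zero.1 (tendsto_nhds_unique hlim h0)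
  rcases le_total M M' with h | h
  · exact key M le_rfl h hM
  · exact key M' h le_rfl hM'

/-! ### Differential forms on `ℂⁿ` -/

/-- The exterior covectors of real degree `k` on `ℂⁿ` with values in `F`; a differential form is
a function from `ℂⁿ` to these. -/
abbrev Covec (n k : ℕ) (F : Type*) [NormedAddCommGroup F] [NormedSpace ℂ F] : Type _ :=
  CSpace n [⋀^Fin k]→L[ℝ] F

variable {F : Type*} [NormedAddCommGroup F] [NormedSpace ℂ F]

/-- The tensor product `(v₁, …, v_{k+l}) ↦ θ(v_{k+1}, …, v_{k+l}) η(v₁, …, v_k)`. -/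
def tensorForm {n k l : ℕ} (η : Covec n k F) (θ : Covec n l ℂ) :
    ContinuousMultilinearMap ℝ (fun _ : Fin (k + l) => CSpace n) F where
  toFun v := θ (fun j => v (Fin.natAdd k j)) • η (fun i => v (Fin.castAdd l i))
  map_update_add' := by
    intro inst v i x y
    have e : inst = instDecidableEqFin (k + l) := Subsingleton.elim _ _
    subst e
    induction i using Fin.addCases with
    | left i =>
      have h1 : ∀ z, (fun j : Fin l => Function.update v (Fin.castAdd l i) z (Fin.natAdd k j))
          = fun j => v (Fin.natAdd k j) := by
        intro z; funext j
        rw [Function.update_of_ne]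
        intro h; have := congrArg Fin.val h; simp at this; omega
      have h2 : ∀ z, (fun j : Fin k => Function.update v (Fin.castAdd l i) z (Fin.castAdd l j))
          = Function.update (fun j => v (Fin.castAdd l j)) i z := by
        intro z; funext j
        by_cases h : j = i
        · subst h; simp
        · rw [Function.update_of_ne h, Function.update_of_ne]
          intro h'; exact h (Fin.castAdd_injective _ _ h')
      simp only [h1, h2, ContinuousAlternatingMap.map_update_add, smul_add]
    | right i =>
      have h1 : ∀ z, (fun j : Fin k => Function.update v (Fin.natAdd k i) z (Fin.castAdd l j))
          = fun j => v (Fin.castAdd l j) := by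
        intro z; funext j
        rw [Function.update_of_ne]
        intro h; have := congrArg Fin.val h; simp at this; omega
      have h2 : ∀ z, (fun j : Fin l => Function.update v (Fin.natAdd k i) z (Fin.natAdd k j))
          = Function.update (fun j => v (Fin.natAdd k j)) i z := by
        intro z; funext j
        by_cases h : j = i
        · subst h; simp
        · rw [Function.update_of_ne h, Function.update_of_ne]
          intro h'; exact h (Fin.natAdd_injective _ _ h')
      simp only [h1, h2, ContinuousAlternatingMap.map_update_add, add_smul]
  map_update_smul' := by
    intro inst v i c x
    have e : inst = instDecidableEqFin (k + l) := Subsingleton.elim _ _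
    subst e
    induction i using Fin.addCases with
    | left i =>
      have h1 : ∀ z, (fun j : Fin l => Function.update v (Fin.castAdd l i) z (Fin.natAdd k j))
          = fun j => v (Fin.natAdd k j) := by
        intro z; funext j
        rw [Function.update_of_ne]
        intro h; have := congrArg Fin.val h; simp at this; omega
      have h2 : ∀ z, (fun j : Fin k => Function.update v (Fin.castAdd l i) z (Fin.castAdd l j))
          = Function.update (fun j => v (Fin.castAdd l j)) i z := by
        intro z; funext j
        by_cases h : j = i
        · subst h; simp
        · rw [Function.update_of_ne h, Function.update_of_ne]
          intro h'; exact h (Fin.castAdd_injective _ _ h')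
      simp only [h1, h2, ContinuousAlternatingMap.map_update_smul]
      rw [smul_comm]
    | right i =>
      have h1 : ∀ z, (fun j : Fin k => Function.update v (Fin.natAdd k i) z (Fin.castAdd l j))
          = fun j => v (Fin.castAdd l j) := by
        intro z; funext j
        rw [Function.update_of_ne]
        intro h; have := congrArg Fin.val h; simp at this; omega
      have h2 : ∀ z, (fun j : Fin l => Function.update v (Fin.natAdd k i) z (Fin.natAdd k j))
          = Function.update (fun j => v (Fin.natAdd k j)) i z := by
        intro z; funext j
        by_cases h : j = i
        · subst h; simp
        · rw [Function.update_of_ne h, Function.update_of_ne]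
          intro h'; exact h (Fin.natAdd_injective _ _ h')
      simp only [h1, h2, ContinuousAlternatingMap.map_update_smul, smul_assoc]
  cont := by
    refine Continuous.smul ?_ ?_
    · exact θ.cont.comp (by fun_prop)
    · exact η.cont.comp (by fun_prop)

/-- The exterior product
`(η ∧ θ)(v₁, …, v_{k+l}) =
  (k! l!)⁻¹ ∑_σ sgn σ · η(v_{σ 1}, …, v_{σ k}) θ(v_{σ (k+1)}, …, v_{σ (k+l)})`. -/
def wedge {n k l : ℕ} (η : Covec n k F) (θ : Covec n l ℂ) : Covec n (k + l) F :=
  ((k.factorial * l.factorial : ℕ) : ℝ)⁻¹ •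
    ContinuousMultilinearMap.alternatization (tensorForm η θ)

/-- The conjugate-linear part `v ↦ (L v + i L (i v)) / 2` of a real-linear map. -/
def conjPart {n : ℕ} {G : Type*} [NormedAddCommGroup G] [NormedSpace ℝ G] [Module ℂ G]
    [SMulCommClass ℝ ℂ G] [ContinuousConstSMul ℂ G]
    (L : CSpace n →L[ℝ] G) : CSpace n →L[ℝ] G :=
  (1 / 2 : ℂ) •
    (L + Complex.I • L.comp (Complex.I • ContinuousLinearMap.id ℝ (CSpace n)))

/-- The operator `∂̄` on differential forms of any degree, `∂̄η = ∑ⱼ dζ̄ⱼ ∧ ∂η/∂ζ̄ⱼ`, where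
`∂/∂ζ̄ⱼ` acts on coefficients: the alternation of the conjugate-linear part of the derivative. -/
def dbar {n k : ℕ} (η : CSpace n → Covec n k F) (ζ : CSpace n) : Covec n (k + 1) F :=
  ContinuousAlternatingMap.alternatizeUncurryFin (conjPart (fderiv ℝ η ζ))

/-- `∂̄u` for a function `u`, regarded as a form of degree zero. -/
def dbarFun {n : ℕ} (u : CSpace n → ℂ) : CSpace n → Covec n (0 + 1) ℂ :=
  dbar (fun ζ => ContinuousAlternatingMap.constOfIsEmpty ℝ (CSpace n) (Fin 0) (u ζ))

/-- `η` is differentiable and `∂̄`-closed at all points of `U`. -/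
def IsDbarClosedOn {n k : ℕ} (η : CSpace n → Covec n k F) (U : Set (CSpace n)) : Prop :=
  DifferentiableOn ℝ η U ∧ ∀ ζ ∈ U, dbar η ζ = 0

/-- The real frame `e₁, i e₁, e₂, i e₂, …` of `ℂⁿ`. -/
def frame (n N : ℕ) (k : Fin N) : CSpace n :=
  WithLp.toLp 2 (fun j =>
    if (j : ℕ) = (k : ℕ) / 2 then (if (k : ℕ) % 2 = 0 then 1 else Complex.I) else 0)

/-- The density with respect to Lebesgue measure of a form of top degree, for the standard
orientation of `ℂⁿ` in which `dx₁ ∧ dy₁ ∧ … ∧ dxₙ ∧ dyₙ` is positive. -/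
def density {n N : ℕ} (η : CSpace n → Covec n N F) (ζ : CSpace n) : F := η ζ (frame n N)

/-- The integral over `ℂⁿ` of a form of top degree. -/
def formIntegral {n N : ℕ} (η : CSpace n → Covec n N F) : F := ∫ ζ, density η ζ

/-! ### The Bochner–Martinelli form -/

/-- The `(1,0)`-form `b(ζ) = (2πi |ζ|²)⁻¹ ∑ ζ̄ⱼ dζⱼ`. -/
def bForm (n : ℕ) (ζ : CSpace n) : Covec n 1 ℂ :=
  ContinuousAlternatingMap.ofSubsingleton ℝ (CSpace n) ℂ (0 : Fin 1)
    ((2 * Real.pi * Complex.I * (‖ζ‖ : ℂ) ^ 2)⁻¹ • (innerSL ℂ ζ).restrictScalars ℝ)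

/-- The exterior powers `(∂̄b)ᵏ`. -/
def dbarPow (n : ℕ) : (k : ℕ) → CSpace n → Covec n (2 * k) ℂ
  | 0, _ => ContinuousAlternatingMap.constOfIsEmpty ℝ (CSpace n) (Fin 0) 1
  | k + 1, ζ => wedge (dbarPow n k ζ) (dbar (bForm n) ζ)

/-- The Bochner–Martinelli form `b ∧ (∂̄b)ⁿ⁻¹`. -/
def bmForm (n : ℕ) (ζ : CSpace n) : Covec n (1 + 2 * (n - 1)) ℂ :=
  wedge (bForm n ζ) (dbarPow n (n - 1) ζ)

/-- The form `((1 + ζ·ξ) / (1 + |ξ|²))ᵐ ω_{ζ-ξ}` in the variable `ζ`, with `ω` the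
Bochner–Martinelli form. -/
def omegaM {n : ℕ} (m : ℕ) (ξ : RSpace n) (ζ : CSpace n) : Covec n (1 + 2 * (n - 1)) ℂ :=
  ((1 + dotC ζ ξ) / (1 + (‖ξ‖ : ℂ) ^ 2)) ^ m • bmForm n (ζ - toC ξ)

/-- `Ω` is the operator-valued form obtained off `ℝⁿ` by evaluating the modified
Bochner–Martinelli form at `ξ = a`, coefficient by coefficient. -/
def IsOmegaAt {n : ℕ} (B : 𝓢(RSpace n, ℂ) →L[ℂ] (X →L[ℂ] X)) (m : ℕ)
    (Ω : CSpace n → Covec n (1 + 2 * (n - 1)) (X →L[ℂ] X)) : Prop :=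
  ∀ ζ ∉ realSet n, ∀ v : Fin (1 + 2 * (n - 1)) → CSpace n,
    IsValueAt B (fun ξ => omegaM m ξ ζ v) (Ω ζ v)

/-- `T` is the value at the one-form `ψ` of the operator-valued current given by
`ψ ↦ (∫ ω_{ζ-ξ}ᵐ ∧ ψ)|_{ξ = a}`, the scalar integrals being absolutely convergent. -/
def IsCurrentValue {n : ℕ} (B : 𝓢(RSpace n, ℂ) →L[ℂ] (X →L[ℂ] X)) (m : ℕ)
    (ψ : CSpace n → Covec n (0 + 1) ℂ) (T : X →L[ℂ] X) : Prop :=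
  (∀ ξ : RSpace n, Integrable (density (fun ζ => wedge (omegaM m ξ ζ) (ψ ζ)))) ∧
    IsValueAt B (fun ξ => formIntegral (fun ζ => wedge (omegaM m ξ ζ) (ψ ζ))) T

/-! ### Almost holomorphic extensions -/

/-- `u` is an almost holomorphic extension of the function `φ` on `ℝⁿ`: it is smooth, extends `φ`,
is rapidly decreasing at infinity, and `∂̄u = O(|Im ζ|^{M₁} (1 + |ζ|)^{-M₂})` for all `M₁`, `M₂`. -/
structure IsAlmostHolExt {n : ℕ} (φ : RSpace n → ℂ) (u : CSpace n → ℂ) : Prop where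
  smooth : ContDiff ℝ ∞ u
  extends_real : ∀ ξ, u (toC ξ) = φ ξ
  decay : ∀ M : ℕ, ∃ C : ℝ, ∀ ζ, (1 + ‖ζ‖) ^ M * ‖u ζ‖ ≤ C
  dbar_decay : ∀ M₁ M₂ : ℕ, ∃ C : ℝ, ∀ ζ, (1 + ‖ζ‖) ^ M₂ * ‖dbarFun u ζ‖ ≤ C * ‖imPart ζ‖ ^ M₁

end HyperOp

end

open HyperOp

/-! The factor `peak`, `(1 + ζ·ξ)/(1 + |ξ|²)`, is holomorphic in `ζ`, equals 1 at `ζ = ξ`, and is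
`O((1 + |ζ|)/(1 + |ξ|))` with all its derivatives. Multiplying the Bochner–Martinelli form by its
`m`-th power therefore keeps the form closed and reproducing, and makes the kernel decay in `ξ` like
`(1 + |ξ|)^{-m}`. If `B` has order `M`, then `m ≥ M + 1` is enough to evaluate the kernel at `ξ =
a`.

The functional-analytic device is the Banach space `jetSpace`: the closure, in a weighted sup norm,
of the derivatives of order at most `M` of Schwartz functions. `B` extends to it by density as
`extJet`, and functions of finite decay embed in it. Its elements are determined by their values at
points (`evalJet_injective`, `jet_ext`). Hence derivatives and integrals of jet-valued functions
commute with the bounded map `extJet`, while any identity between jets may be checked at each `ξ`,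
where it is a scalar statement. Smooth dependence on `ζ` is `contDiff_jetOf`.

On the scalar side, `bmForm_eq` puts the form as `∑ z̄ⱼ|z|^{-2n} Eⱼ` with constant forms `Eⱼ`, and
`wedge_bmBasis_dzbar` shows the `Eⱼ` to be dual to the `dz̄ₖ` up to one constant. So `∂̄` becomes
the divergence `∑ ∂gⱼ/∂z̄ⱼ`. The kernels `z̄ⱼ(|z|² + t²)^{-n}` have an approximate identity as
divergence, and this yields `bochnerMartinelli`.

The parts of the theorem follow from these. Near a non-real point `|ζ - ξ| ≥ |Im ζ|` is bounded
below, so the kernel can be replaced by a smooth one at a fixed scale `δ` (`cutKer`), which gives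
smoothness and closedness. Near a real point off the spectrum, a bump function times the kernel is a
test function that `A` kills; removing it leaves a kernel without singularity there
(`exists_opCutForm_eq`). The jets blow up at the real space only like `|Im ζ|^{-(2n-1+M)}`, against
which the flatness of `∂̄` of an almost holomorphic extension wins; evaluation at `ξ` then reduces
the representation to the scalar formula (`integral_representation`). For the current, integrating
the kernel against a test form produces a smooth function with decay `m` (`isSymbol_kerIntegral`).

For the obstruction, a test function supported near a point of `ℝⁿ` outside `F` has an almost
holomorphic extension supported off `F`. The representation and the divergence theorem then show
that `A` kills it (`eq_zero_of_closed_extension`). The extensions are averages of the function along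
the lines `Re ζ + s Im ζ` against a well-chosen kernel (`exists_avgKernel`,
`exists_isAlmostHolExt`). -/

noncomputable section
namespace HyperOp
set_option maxSynthPendingDepth 3

/-! ### Pointwise bounds for iterated derivatives -/

section Symbols

variable {P P' G G' G'' : Type*} [NormedAddCommGroup P] [NormedSpace ℝ P]
  [NormedAddCommGroup P'] [NormedSpace ℝ P']
  [NormedAddCommGroup G] [NormedSpace ℝ G] [NormedAddCommGroup G'] [NormedSpace ℝ G']
  [NormedAddCommGroup G''] [NormedSpace ℝ G'']

/-- `f` is smooth and its derivatives of order at most `N` are bounded by `w`. -/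
def DerivBound (N : ℕ) (w : P → ℝ) (f : P → G) : Prop :=
  ContDiff ℝ ∞ f ∧ ∀ x, ∀ i ≤ N, ‖iteratedFDeriv ℝ i f x‖ ≤ w x

namespace DerivBound

variable {N : ℕ} {w w₁ w₂ : P → ℝ} {f g : P → G}

theorem nonneg (h : DerivBound N w f) (x : P) : 0 ≤ w x :=
  (norm_nonneg _).trans (h.2 x 0 (Nat.zero_le _))

theorem mono (h : DerivBound N w₁ f) (hw : ∀ x, w₁ x ≤ w₂ x) : DerivBound N w₂ f :=
  ⟨h.1, fun x i hi => (h.2 x i hi).trans (hw x)⟩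

theorem norm_le (h : DerivBound N w f) (x : P) : ‖f x‖ ≤ w x := by
  simpa using h.2 x 0 (Nat.zero_le _)

theorem zero : DerivBound N (fun _ => 0) (fun _ : P => (0 : G)) := by
  refine ⟨contDiff_const, fun x i _ => ?_⟩
  rw [iteratedFDeriv_fun_zero]; simp

theorem const (c : G) : DerivBound N (fun _ => ‖c‖) (fun _ : P => c) := by
  refine ⟨contDiff_const, fun x i _ => ?_⟩
  rcases eq_or_ne i 0 with rfl | h
  · simp
  · rw [iteratedFDeriv_const_of_ne h]; simp

theorem add (hf : DerivBound N w₁ f) (hg : DerivBound N w₂ g) :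
    DerivBound N (fun x => w₁ x + w₂ x) (fun x => f x + g x) := by
  refine ⟨hf.1.add hg.1, fun x i hi => ?_⟩
  have := iteratedFDeriv_add_apply (x := x) (i := i)
    ((hf.1.of_le (by exact_mod_cast le_top)).contDiffAt)
    ((hg.1.of_le (by exact_mod_cast le_top)).contDiffAt)
  rw [show (fun x => f x + g x) = f + g from rfl, this]
  exact (norm_add_le _ _).trans (add_le_add (hf.2 x i hi) (hg.2 x i hi))

theorem sum {ι : Type*} (s : Finset ι) {w : ι → P → ℝ} {f : ι → P → G}
    (h : ∀ i ∈ s, DerivBound N (w i) (f i)) :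
    DerivBound N (fun x => ∑ i ∈ s, w i x) (fun x => ∑ i ∈ s, f i x) := by
  classical
  induction s using Finset.induction with
  | empty => simpa using zero
  | insert a s ha ih =>
    simp only [Finset.sum_insert ha]
    exact (h a (by simp)).add (ih fun i hi => h i (by simp [hi]))

theorem clm_comp (L : G →L[ℝ] G') (hf : DerivBound N w f) :
    DerivBound N (fun x => ‖L‖ * w x) (fun x => L (f x)) := by
  refine ⟨L.contDiff.comp hf.1, fun x i hi => ?_⟩
  refine (L.norm_iteratedFDeriv_comp_left (N := ∞) hf.1.contDiffAt
    (by exact_mod_cast le_top)).trans ?_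
  exact mul_le_mul_of_nonneg_left (hf.2 x i hi) (norm_nonneg _)

/-- The `i`-th derivative gains `‖L‖^i`; the maximum with 1 lets one factor serve all orders up to
`N`. -/
theorem comp_clm (hf : DerivBound N w f) (L : P' →L[ℝ] P) :
    DerivBound N (fun x => max 1 ‖L‖ ^ N * w (L x)) (fun x => f (L x)) := by
  refine ⟨hf.1.comp L.contDiff, fun x i hi => ?_⟩
  have := L.iteratedFDeriv_comp_right hf.1 x (i := i) (by exact_mod_cast le_top)
  rw [show (fun x => f (L x)) = f ∘ L from rfl, this]
  refine (ContinuousMultilinearMap.norm_compContinuousLinearMap_le _ _).trans ?_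
  rw [mul_comm, Finset.prod_const, Finset.card_univ, Fintype.card_fin]
  refine mul_le_mul ?_ (hf.2 _ i hi) (norm_nonneg _) (by positivity)
  exact (pow_le_pow_left₀ (norm_nonneg _) (le_max_right _ _) i).trans
    (pow_le_pow_right₀ (le_max_left _ _) hi)

theorem comp_add (hf : DerivBound N w f) (a : P) :
    DerivBound N (fun x => w (x + a)) (fun x => f (x + a)) := by
  refine ⟨hf.1.comp (contDiff_id.add contDiff_const), fun x i hi => ?_⟩
  rw [iteratedFDeriv_comp_add_right]
  exact hf.2 _ i hi

/-- Leibniz rule: since one weight bounds every order, the binomial coefficients simply add up to at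
most `2 ^ N`. -/
theorem bilin (B : G →L[ℝ] G' →L[ℝ] G'') {f : P → G} {g : P → G'} (hf : DerivBound N w₁ f)
    (hg : DerivBound N w₂ g) :
    DerivBound N (fun x => ‖B‖ * 2 ^ N * (w₁ x * w₂ x)) (fun x => B (f x) (g x)) := by
  refine ⟨B.isBoundedBilinearMap.contDiff.comp (hf.1.prodMk hg.1), fun x i hi => ?_⟩
  refine (B.norm_iteratedFDeriv_le_of_bilinear hf.1 hg.1 x (n := i)
    (by exact_mod_cast le_top)).trans ?_
  have h0 := hf.nonneg x
  have h1 := hg.nonneg x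
  change _ ≤ ‖B‖ * 2 ^ N * (w₁ x * w₂ x)
  rw [mul_assoc ‖B‖]
  refine mul_le_mul_of_nonneg_left ?_ (norm_nonneg _)
  calc _ ≤ ∑ k ∈ Finset.range (i + 1), (i.choose k : ℝ) * (w₁ x * w₂ x) := by
        refine Finset.sum_le_sum fun k hk => ?_
        rw [mul_assoc]
        gcongr
        · exact hf.2 x k (by have := Finset.mem_range.1 hk; omega)
        · exact hg.2 x _ (by omega)
    _ = 2 ^ i * (w₁ x * w₂ x) := by
        rw [← Finset.sum_mul]
        congr 1
        exact_mod_cast Nat.sum_range_choose i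
    _ ≤ _ := by gcongr; norm_num

theorem mul {f g : P → ℂ} (hf : DerivBound N w₁ f) (hg : DerivBound N w₂ g) :
    DerivBound N (fun x => 2 ^ N * (w₁ x * w₂ x)) (fun x => f x * g x) := by
  refine (hf.bilin (ContinuousLinearMap.mul ℝ ℂ) hg).mono fun x => ?_
  have h0 := hf.nonneg x
  have h1 := hg.nonneg x
  have := ContinuousLinearMap.opNorm_mul_le ℝ ℂ
  calc _ ≤ 1 * 2 ^ N * (w₁ x * w₂ x) := by gcongr
    _ = _ := by ring

/-- The induction step for raising the order of a bound: a derivative of order `i + 1` of `f` has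
the norm of one of order `i` of `fderiv ℝ f`. -/
theorem of_fderiv (hf : ContDiff ℝ ∞ f) (h0 : ∀ x, ‖f x‖ ≤ w x)
    (h : DerivBound N w (fderiv ℝ f)) : DerivBound (N + 1) w f := by
  refine ⟨hf, fun x i hi => ?_⟩
  cases i with
  | zero => simpa using h0 x
  | succ i =>
    rw [← norm_iteratedFDeriv_fderiv]
    exact h.2 x i (by omega)

theorem fderiv_apply (h : DerivBound (N + 1) w f) (v : P) :
    DerivBound N (fun x => ‖v‖ * w x) (fun x => fderiv ℝ f x v) := by
  have h1 : DerivBound N w (fderiv ℝ f) := by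
    refine ⟨h.1.fderiv_right (by simp), fun x i hi => ?_⟩
    rw [norm_iteratedFDeriv_fderiv]
    exact h.2 x _ (by omega)
  refine (h1.clm_comp (ContinuousLinearMap.apply ℝ G v)).mono fun x => ?_
  have := h.nonneg x
  gcongr
  refine ContinuousLinearMap.opNorm_le_bound _ (norm_nonneg _) fun L => ?_
  simpa [mul_comm] using L.le_opNorm v

end DerivBound

/-- `f` is smooth and each of its derivatives is bounded by a multiple of `w`. -/
def IsSymbol (w : P → ℝ) (f : P → G) : Prop :=
  ∀ N : ℕ, ∃ C : ℝ, 0 ≤ C ∧ DerivBound N (fun x => C * w x) f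

namespace IsSymbol

variable {w w₁ w₂ : P → ℝ} {f g : P → G}

theorem contDiff (h : IsSymbol w f) : ContDiff ℝ ∞ f := (h 0).choose_spec.2.1

theorem mono (h : IsSymbol w₁ f) {c : ℝ} (hc : 0 ≤ c) (hw : ∀ x, w₁ x ≤ c * w₂ x) :
    IsSymbol w₂ f := fun N => by
  obtain ⟨C, hC, h⟩ := h N
  refine ⟨C * c, by positivity, h.mono fun x => ?_⟩
  rw [mul_assoc]
  exact mul_le_mul_of_nonneg_left (hw x) hC

theorem const (c : G) : IsSymbol (fun _ => 1) (fun _ : P => c) := fun _ =>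
  ⟨‖c‖, norm_nonneg _, by simpa using DerivBound.const c⟩

theorem add (hf : IsSymbol w f) (hg : IsSymbol w g) : IsSymbol w (fun x => f x + g x) := fun N => by
  obtain ⟨C, hC, h⟩ := hf N
  obtain ⟨C', hC', h'⟩ := hg N
  exact ⟨C + C', by positivity, (h.add h').mono fun x => le_of_eq (by ring)⟩

theorem sum {ι : Type*} (s : Finset ι) {f : ι → P → G} (h : ∀ i ∈ s, IsSymbol w (f i)) :
    IsSymbol w (fun x => ∑ i ∈ s, f i x) := fun N => by
  have h' : ∀ i, ∃ C : ℝ, 0 ≤ C ∧ (i ∈ s → DerivBound N (fun x => C * w x) (f i)) := fun i => by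
    by_cases hi : i ∈ s
    · obtain ⟨C, hC, h⟩ := h i hi N
      exact ⟨C, hC, fun _ => h⟩
    · exact ⟨0, le_rfl, fun h => (hi h).elim⟩
  choose C hC h using h'
  refine ⟨∑ i ∈ s, C i, Finset.sum_nonneg fun i _ => hC i,
    (DerivBound.sum s fun i hi => h i hi).mono fun x => le_of_eq ?_⟩
  rw [Finset.sum_mul]

theorem clm_comp (L : G →L[ℝ] G') (hf : IsSymbol w f) : IsSymbol w (fun x => L (f x)) := fun N => by
  obtain ⟨C, hC, h⟩ := hf N
  exact ⟨‖L‖ * C, by positivity, (h.clm_comp L).mono fun x => le_of_eq (by ring)⟩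

theorem comp_clm (hf : IsSymbol w f) (L : P' →L[ℝ] P) :
    IsSymbol (fun x => w (L x)) (fun x => f (L x)) := fun N => by
  obtain ⟨C, hC, h⟩ := hf N
  exact ⟨max 1 ‖L‖ ^ N * C, by positivity, (h.comp_clm L).mono fun x => le_of_eq (by ring)⟩

theorem bilin (B : G →L[ℝ] G' →L[ℝ] G'') {f : P → G} {g : P → G'} (hf : IsSymbol w₁ f)
    (hg : IsSymbol w₂ g) : IsSymbol (fun x => w₁ x * w₂ x) (fun x => B (f x) (g x)) := fun N => by
  obtain ⟨C, hC, h⟩ := hf N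
  obtain ⟨C', hC', h'⟩ := hg N
  exact ⟨‖B‖ * 2 ^ N * (C * C'), by positivity, (h.bilin B h').mono fun x => le_of_eq (by ring)⟩

theorem mul {f g : P → ℂ} (hf : IsSymbol w₁ f) (hg : IsSymbol w₂ g) :
    IsSymbol (fun x => w₁ x * w₂ x) (fun x => f x * g x) :=
  hf.bilin (ContinuousLinearMap.mul ℝ ℂ) hg

theorem pow {f : P → ℂ} (hf : IsSymbol w f) (m : ℕ) :
    IsSymbol (fun x => w x ^ m) (fun x => f x ^ m) := by
  induction m with
  | zero => simpa using const (P := P) (1 : ℂ)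
  | succ m ih => simp only [pow_succ]; exact ih.mul hf

theorem of_clm (L : P →L[ℝ] G) : IsSymbol (fun x => 1 + ‖x‖) (fun x => L x) := fun N => by
  refine ⟨‖L‖, norm_nonneg _, ?_⟩
  cases N with
  | zero =>
    refine ⟨L.contDiff, fun x i hi => ?_⟩
    obtain rfl : i = 0 := by omega
    have := L.le_opNorm x
    simp only [norm_iteratedFDeriv_zero]
    nlinarith [norm_nonneg L]
  | succ N =>
    refine DerivBound.of_fderiv L.contDiff (fun x => ?_) ?_
    · have := L.le_opNorm x
      nlinarith [norm_nonneg L]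
    · have : fderiv ℝ (fun x => L x) = fun _ => L := by funext x; exact L.fderiv
      rw [this]
      refine (DerivBound.const L).mono fun x => ?_
      nlinarith [norm_nonneg L, norm_nonneg x]

/-- A smooth function of compact support has bounded derivatives. -/
theorem of_hasCompactSupport (hf : ContDiff ℝ ∞ f) (hc : HasCompactSupport f) :
    IsSymbol (fun _ => 1) f := fun N => by
  have : ∀ i : ℕ, ∃ C, ∀ x, ‖iteratedFDeriv ℝ i f x‖ ≤ C := fun i =>
    (hc.iteratedFDeriv (𝕜 := ℝ) i).exists_bound_of_continuous
      (hf.continuous_iteratedFDeriv (by exact_mod_cast le_top))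
  choose C hC using this
  have hC0 : ∀ i, 0 ≤ C i := fun i => (norm_nonneg _).trans (hC i 0)
  refine ⟨∑ i ∈ Finset.range (N + 1), C i, Finset.sum_nonneg fun i _ => hC0 i, hf, fun x i hi => ?_⟩
  change _ ≤ (∑ i ∈ Finset.range (N + 1), C i) * 1
  rw [mul_one]
  exact (hC i x).trans (Finset.single_le_sum (f := C) (fun i _ => hC0 i)
    (Finset.mem_range.2 (by omega)))

/-- The inverse of a function with bounded derivatives that is bounded away from zero. -/
theorem inv {f : P → ℝ} (hf : IsSymbol (fun _ => 1) f) {c : ℝ} (hc : 0 < c) (h : ∀ x, c ≤ f x) :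
    IsSymbol (fun _ => 1) (fun x => (f x)⁻¹) := by
  have hne : ∀ x, f x ≠ 0 := fun x => (hc.trans_le (h x)).ne'
  have hsm : ContDiff ℝ ∞ (fun x => (f x)⁻¹) := hf.contDiff.inv hne
  have hb : ∀ x, ‖(f x)⁻¹‖ ≤ c⁻¹ := fun x => by
    rw [norm_inv, Real.norm_of_nonneg (hc.le.trans (h x))]
    exact inv_anti₀ hc (h x)
  -- The derivative of the inverse is a product of two inverses and `f'`, so a bound of order `N` on
  -- the inverse produces one of order `N + 1`.
  have hd : fderiv ℝ (fun x => (f x)⁻¹) = fun x => -(((f x)⁻¹ * (f x)⁻¹) • fderiv ℝ f x) := by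
    funext x
    have h1 : HasFDerivAt f (fderiv ℝ f x) x :=
      (hf.contDiff.differentiable (by simp) x).hasFDerivAt
    have h2 : HasFDerivAt (fun x => (f x)⁻¹) _ x := (hasDerivAt_inv (hne x)).comp_hasFDerivAt x h1
    rw [h2.fderiv]
    ext v
    simp [pow_two]
  intro N
  induction N with
  | zero =>
    refine ⟨c⁻¹, by positivity, hsm, fun x i hi => ?_⟩
    obtain rfl : i = 0 := by omega
    simpa using hb x
  | succ N ih =>
    obtain ⟨C, hC, ih⟩ := ih
    obtain ⟨C', hC', h'⟩ := hf (N + 1)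
    have h'' : DerivBound N (fun _ => C' * 1) (fderiv ℝ f) := by
      refine ⟨h'.1.fderiv_right (by simp), fun x i hi => ?_⟩
      rw [norm_iteratedFDeriv_fderiv]
      exact h'.2 x _ (by omega)
    have k := ((ih.bilin (ContinuousLinearMap.mul ℝ ℝ) ih).bilin
      (-(ContinuousLinearMap.lsmul ℝ ℝ : ℝ →L[ℝ] (P →L[ℝ] ℝ) →L[ℝ] (P →L[ℝ] ℝ))) h'')
    obtain ⟨K, hK⟩ : ∃ K : ℝ, DerivBound N (fun _ => K) (fderiv ℝ (fun x => (f x)⁻¹)) := by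
      rw [hd]
      exact ⟨_, k⟩
    refine ⟨max K c⁻¹, le_max_of_le_right (by positivity), ?_⟩
    refine DerivBound.of_fderiv hsm (fun x => (hb x).trans (by simp)) (hK.mono fun x => by simp)

end IsSymbol

end Symbols

/-! ### The functions `(1 + |x|²)⁻¹` and `(1 + |x|²)⁻¹ x` -/

section Bracket

variable {H : Type*} [NormedAddCommGroup H] [InnerProductSpace ℝ H]

/-- The function `(1 + |x|²)⁻¹`. -/
def invSq {H : Type*} [NormedAddCommGroup H] (x : H) : ℝ := (1 + ‖x‖ ^ 2)⁻¹

theorem contDiff_invSq : ContDiff ℝ ∞ (invSq : H → ℝ) :=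
  (contDiff_const.add (contDiff_norm_sq ℝ)).inv fun x => by positivity

theorem invSq_pos {H : Type*} [NormedAddCommGroup H] (x : H) : 0 < invSq x := by unfold invSq; positivity

theorem one_add_norm_mul_invSq_le {H : Type*} [NormedAddCommGroup H] (x : H) : (1 + ‖x‖) * invSq x ≤ 2 := by
  unfold invSq
  rw [mul_inv_le_iff₀ (by positivity)]
  nlinarith [norm_nonneg x, sq_nonneg (‖x‖ - 1)]

theorem invSq_le {H : Type*} [NormedAddCommGroup H] (x : H) : invSq x ≤ 2 * (1 + ‖x‖)⁻¹ := by
  rw [← div_eq_mul_inv, le_div_iff₀ (by positivity), mul_comm]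
  exact one_add_norm_mul_invSq_le x

theorem norm_invSq_smul_le (x : H) : ‖invSq x • x‖ ≤ 2 * (1 + ‖x‖)⁻¹ := by
  rw [norm_smul, Real.norm_of_nonneg (invSq_pos x).le]
  unfold invSq
  rw [← div_eq_mul_inv, le_div_iff₀ (by positivity), mul_assoc, inv_mul_le_iff₀ (by positivity)]
  nlinarith [norm_nonneg x, sq_nonneg (‖x‖ - 1)]

theorem fderiv_invSq :
    fderiv ℝ (invSq : H → ℝ) = fun x => (-2 : ℝ) • invSq x • innerSL ℝ (invSq x • x) := by
  funext x
  have h1 : HasFDerivAt (fun x : H => 1 + ‖x‖ ^ 2) (2 • innerSL ℝ x) x :=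
    ((hasStrictFDerivAt_norm_sq x).hasFDerivAt).const_add 1
  have h2 : (1 + ‖x‖ ^ 2 : ℝ) ≠ 0 := by positivity
  have h3 := (hasDerivAt_inv h2).comp_hasFDerivAt x h1
  have h4 : (invSq : H → ℝ) = (fun y => y⁻¹) ∘ (fun x : H => 1 + ‖x‖ ^ 2) := rfl
  rw [h4, h3.fderiv]
  ext v
  simp
  field_simp

theorem fderiv_invSq_smul :
    fderiv ℝ (fun x : H => invSq x • x) = fun x => invSq x • ContinuousLinearMap.id ℝ H +
      (-2 : ℝ) • (innerSL ℝ (invSq x • x)).smulRight (invSq x • x) := by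
  funext x
  have h1 : HasFDerivAt (invSq : H → ℝ) (fderiv ℝ invSq x) x :=
    (contDiff_invSq.differentiable (by simp) x).hasFDerivAt
  have h2 := h1.smul (hasFDerivAt_id x)
  have h3 : HasFDerivAt (fun x : H => invSq x • x) _ x := h2
  rw [h3.fderiv, fderiv_invSq]
  ext v
  simp [smul_smul]
  ring_nf

/-- Simultaneous induction: the derivative of either function is a combination of products of the
two, and a product of two weights is at most one weight. The better decay of `invSq` itself is not
needed. -/
theorem isSymbol_invSq_aux (N : ℕ) : ∃ C : ℝ, 0 ≤ C ∧
    DerivBound N (fun x => C * (1 + ‖x‖)⁻¹) (invSq : H → ℝ) ∧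
    DerivBound N (fun x => C * (1 + ‖x‖)⁻¹) (fun x : H => invSq x • x) := by
  have hs : ContDiff ℝ ∞ (fun x : H => invSq x • x) := contDiff_invSq.smul contDiff_id
  have hb : ∀ x : H, ‖invSq x‖ ≤ 2 * (1 + ‖x‖)⁻¹ := fun x => by
    rw [Real.norm_of_nonneg (invSq_pos x).le]; exact invSq_le x
  have hw : ∀ x : H, (1 + ‖x‖)⁻¹ ≤ 1 := fun x =>
    inv_le_one_of_one_le₀ (by linarith [norm_nonneg x])
  induction N with
  | zero =>
    refine ⟨2, by norm_num, ⟨contDiff_invSq, fun x i hi => ?_⟩, hs, fun x i hi => ?_⟩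
    · obtain rfl : i = 0 := by omega
      simpa using hb x
    · obtain rfl : i = 0 := by omega
      simpa using norm_invSq_smul_le x
  | succ N ih =>
    obtain ⟨C, hC, h1, h2⟩ := ih
    have key : ∀ a : ℝ, 0 ≤ a → ∀ x : H,
        a * (C * (1 + ‖x‖)⁻¹ * (C * (1 + ‖x‖)⁻¹)) ≤ (a * C * C) * (1 + ‖x‖)⁻¹ := by
      intro a ha x
      have := hw x
      have h0 : 0 ≤ (1 + ‖x‖)⁻¹ := by positivity
      have : (1 + ‖x‖)⁻¹ * (1 + ‖x‖)⁻¹ ≤ (1 + ‖x‖)⁻¹ := by nlinarith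
      calc _ = a * C * C * ((1 + ‖x‖)⁻¹ * (1 + ‖x‖)⁻¹) := by ring
        _ ≤ _ := by gcongr
    obtain ⟨K, hK, k1⟩ : ∃ K : ℝ, 0 ≤ K ∧
        DerivBound N (fun x => K * (1 + ‖x‖)⁻¹) (fderiv ℝ (invSq : H → ℝ)) := by
      rw [fderiv_invSq]
      let T : ℝ →L[ℝ] H →L[ℝ] (H →L[ℝ] ℝ) :=
        (-2 : ℝ) • ((ContinuousLinearMap.compL ℝ H (H →L[ℝ] ℝ) (H →L[ℝ] ℝ)).flip
          (innerSL ℝ : H →L[ℝ] (H →L[ℝ] ℝ))).comp (ContinuousLinearMap.lsmul ℝ ℝ)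
      exact ⟨‖T‖ * 2 ^ N * C * C, by positivity,
        (h1.bilin T h2).mono fun x => key _ (by positivity) x⟩
    let T : H →L[ℝ] H →L[ℝ] (H →L[ℝ] H) :=
      (-2 : ℝ) • (ContinuousLinearMap.smulRightL ℝ H H).comp (innerSL ℝ : H →L[ℝ] (H →L[ℝ] ℝ))
    obtain ⟨K', hK', k2⟩ : ∃ K : ℝ, 0 ≤ K ∧
        DerivBound N (fun x => K * (1 + ‖x‖)⁻¹) (fderiv ℝ (fun x : H => invSq x • x)) := by
      rw [fderiv_invSq_smul]
      have a1 := h1.clm_comp (ContinuousLinearMap.toSpanSingleton ℝ (ContinuousLinearMap.id ℝ H))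
      have a2 := h2.bilin T h2
      refine ⟨‖ContinuousLinearMap.toSpanSingleton ℝ (ContinuousLinearMap.id ℝ H)‖ * C +
        ‖T‖ * 2 ^ N * C * C, by positivity,
        (a1.add (a2.mono fun x => key _ (by positivity) x)).mono fun x => le_of_eq ?_⟩
      ring
    refine ⟨max 2 (max K K'), by positivity,
      DerivBound.of_fderiv contDiff_invSq (fun x => (hb x).trans ?_) (k1.mono fun x => ?_),
      DerivBound.of_fderiv hs (fun x => (norm_invSq_smul_le x).trans ?_) (k2.mono fun x => ?_)⟩
    all_goals gcongr
    all_goals simp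

theorem isSymbol_invSq : IsSymbol (fun x => (1 + ‖x‖)⁻¹) (invSq : H → ℝ) := fun N => by
  obtain ⟨C, hC, h, -⟩ := isSymbol_invSq_aux (H := H) N
  exact ⟨C, hC, h⟩

theorem isSymbol_invSq_smul : IsSymbol (fun x => (1 + ‖x‖)⁻¹) (fun x : H => invSq x • x) :=
  fun N => by
  obtain ⟨C, hC, -, h⟩ := isSymbol_invSq_aux (H := H) N
  exact ⟨C, hC, h⟩

end Bracket

/-! ### A Banach space of functions of finite decay -/

section JetSpace

variable {n : ℕ}

/-- The functions whose derivatives of order at most `M` are `O(|ξ|^{-M-1})`. -/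
def Decays (M : ℕ) (f : RSpace n → ℂ) : Prop :=
  ∃ C : ℝ, DerivBound M (fun ξ => C * ((1 + ‖ξ‖) ^ (M + 1))⁻¹) f

theorem Decays.contDiff {M : ℕ} {f : RSpace n → ℂ} (h : Decays M f) : ContDiff ℝ ∞ f :=
  h.choose_spec.1

/-- This is where the threshold on `m` originates: `m ≥ M + 1` powers of decay beat the weight `(1 +
|ξ|)^M` with one power to spare. -/
theorem IsSymbol.decays {m M : ℕ} {f : RSpace n → ℂ} (hM : M + 1 ≤ m)
    (h : IsSymbol (fun ξ => (1 + ‖ξ‖)⁻¹ ^ m) f) : Decays M f := by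
  obtain ⟨C, hC, h⟩ := h M
  refine ⟨C, h.mono fun ξ => ?_⟩
  simp only [inv_pow]
  have : 1 ≤ 1 + ‖ξ‖ := by linarith [norm_nonneg ξ]
  gcongr

/-- The functions `f` with `Decays M f` as a vector space. -/
def decaySubmodule (n M : ℕ) : Submodule ℂ (RSpace n → ℂ) where
  carrier := {f | Decays M f}
  add_mem' := by
    rintro f g ⟨C, hf⟩ ⟨C', hg⟩
    exact ⟨C + C', (hf.add hg).mono fun x => le_of_eq (by ring)⟩
  zero_mem' := ⟨0, DerivBound.zero.mono fun x => by simp⟩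
  smul_mem' := by
    rintro c f ⟨C, hf⟩
    refine ⟨‖ContinuousLinearMap.mul ℝ ℂ c‖ * C,
      (hf.clm_comp (ContinuousLinearMap.mul ℝ ℂ c)).mono fun x => le_of_eq (by ring)⟩

/-- Bounded families of jets of order at most `M`. -/
abbrev Jets (n M : ℕ) : Type :=
  lp (fun i : Fin (M + 1) × RSpace n => (RSpace n) [×(i.1 : ℕ)]→L[ℝ] ℂ) ⊤

/-- The weighted derivatives of `f`. -/
def jetFun (M : ℕ) (f : RSpace n → ℂ) (i : Fin (M + 1) × RSpace n) :
    (RSpace n) [×(i.1 : ℕ)]→L[ℝ] ℂ :=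
  ((1 + ‖i.2‖) ^ M : ℝ) • iteratedFDeriv ℝ i.1 f i.2

theorem norm_jetFun_le {M : ℕ} {f : RSpace n → ℂ} {K : ℝ}
    (h : ∀ ξ, ∀ i ≤ M, (1 + ‖ξ‖) ^ M * ‖iteratedFDeriv ℝ i f ξ‖ ≤ K)
    (i : Fin (M + 1) × RSpace n) : ‖jetFun M f i‖ ≤ K := by
  rw [jetFun, norm_smul, Real.norm_of_nonneg (by positivity)]
  exact h _ _ (by omega)

theorem Decays.bound {M : ℕ} {f : RSpace n → ℂ} (h : Decays M f) : ∃ K : ℝ, 0 ≤ K ∧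
    ∀ ξ, ∀ i ≤ M, (1 + ‖ξ‖) ^ (M + 1) * ‖iteratedFDeriv ℝ i f ξ‖ ≤ K := by
  obtain ⟨C, h⟩ := h
  refine ⟨C, ?_, fun ξ i hi => ?_⟩
  · simpa using h.nonneg 0
  · have : _ ≤ C * ((1 + ‖ξ‖) ^ (M + 1))⁻¹ := h.2 ξ i hi
    rwa [← div_eq_mul_inv, le_div_iff₀' (by positivity)] at this

theorem Decays.memℓp {M : ℕ} {f : RSpace n → ℂ} (h : Decays M f) : Memℓp (jetFun M f) ⊤ := by
  obtain ⟨K, hK, h⟩ := h.bound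
  refine memℓp_infty ⟨K, ?_⟩
  rintro _ ⟨i, rfl⟩
  refine norm_jetFun_le (fun ξ i hi => le_trans ?_ (h ξ i hi)) i
  have : 1 ≤ 1 + ‖ξ‖ := by linarith [norm_nonneg ξ]
  gcongr
  omega

/-- The map which takes a decaying function to its family of weighted derivatives. -/
def jetLM (n M : ℕ) : decaySubmodule n M →ₗ[ℂ] Jets n M where
  toFun f := ⟨jetFun M f, Decays.memℓp f.2⟩
  map_add' f g := by
    refine lp.ext (funext fun i => ?_)
    have := iteratedFDeriv_add_apply (x := i.2) (i := i.1)
      ((f.2.contDiff.of_le (by exact_mod_cast le_top)).contDiffAt)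
      ((g.2.contDiff.of_le (by exact_mod_cast le_top)).contDiffAt)
    rw [lp.coeFn_add, Pi.add_apply]
    change _ • iteratedFDeriv ℝ i.1 ((f : RSpace n → ℂ) + (g : RSpace n → ℂ)) i.2 = _
    rw [this, smul_add]
    rfl
  map_smul' c f := by
    refine lp.ext (funext fun i => ?_)
    have := iteratedFDeriv_const_smul_apply (a := c) (x := i.2) (i := i.1)
      ((f.2.contDiff.of_le (by exact_mod_cast le_top)).contDiffAt)
    rw [lp.coeFn_smul, Pi.smul_apply]
    change _ • iteratedFDeriv ℝ i.1 (c • (f : RSpace n → ℂ)) i.2 = _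
    rw [this, smul_comm]
    rfl

theorem jetLM_apply {M : ℕ} (f : decaySubmodule n M) (i : Fin (M + 1) × RSpace n) :
    jetLM n M f i = jetFun M f i := rfl

theorem norm_jetLM_le {M : ℕ} {f : decaySubmodule n M} {K : ℝ} (hK : 0 ≤ K)
    (h : ∀ ξ, ∀ i ≤ M, (1 + ‖ξ‖) ^ M * ‖iteratedFDeriv ℝ i (f : RSpace n → ℂ) ξ‖ ≤ K) :
    ‖jetLM n M f‖ ≤ K :=
  lp.norm_le_of_forall_le hK fun i => norm_jetFun_le h i

theorem schwartz_decays (M : ℕ) (φ : 𝓢(RSpace n, ℂ)) : Decays M φ := by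
  refine ⟨2 ^ (M + 1) * (Finset.Iic (M + 1, M)).sup (schwartzSeminormFamily ℂ (RSpace n) ℂ) φ,
    φ.smooth ⊤, fun x i hi => ?_⟩
  change _ ≤ _ * ((1 + ‖x‖) ^ (M + 1))⁻¹
  rw [← div_eq_mul_inv, le_div_iff₀' (by positivity)]
  exact SchwartzMap.one_add_le_sup_seminorm_apply (𝕜 := ℂ) (m := (M + 1, M)) le_rfl hi φ x

/-- Schwartz functions as functions of finite decay. -/
def schwartzLM (n M : ℕ) : 𝓢(RSpace n, ℂ) →ₗ[ℂ] decaySubmodule n M where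
  toFun φ := ⟨φ, schwartz_decays M φ⟩
  map_add' _ _ := rfl
  map_smul' _ _ := rfl

/-- The closure of the space of weighted jets of Schwartz functions. -/
def jetSpace (n M : ℕ) : Submodule ℂ (Jets n M) :=
  (LinearMap.range ((jetLM n M).comp (schwartzLM n M))).topologicalClosure

instance (M : ℕ) : CompleteSpace (jetSpace n M) :=
  (Submodule.isClosed_topologicalClosure _).completeSpace_coe

/-- Functions equal to one on large balls. -/
theorem exists_cutoff (H : Type*) [NormedAddCommGroup H] [InnerProductSpace ℝ H]
    [FiniteDimensional ℝ H] : ∃ χ : ℕ → H → ℂ,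
    (∀ j, ContDiff ℝ ∞ (χ j)) ∧ (∀ j, HasCompactSupport (χ j)) ∧ (∀ j x, ‖χ j x‖ ≤ 1) ∧
    (∀ (j : ℕ) (x : H), ‖x‖ < j + 1 → χ j x = 1) ∧
    ∀ N, ∃ C : ℝ, 0 ≤ C ∧ ∀ j, DerivBound N (fun _ => C) (χ j) := by
  let b : ContDiffBump (0 : H) := ⟨1, 2, one_pos, one_lt_two⟩
  let g : H → ℂ := fun x => (b x : ℂ)
  have hg : ContDiff ℝ ∞ g := Complex.ofRealCLM.contDiff.comp b.contDiff
  have hgc : HasCompactSupport g := b.hasCompactSupport.comp_left (g := fun x : ℝ => (x : ℂ)) rfl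
  have hgs := IsSymbol.of_hasCompactSupport hg hgc
  let L : ℕ → H →L[ℝ] H := fun j => ((j + 1 : ℝ)⁻¹) • ContinuousLinearMap.id ℝ H
  refine ⟨fun j x => g (L j x), fun j => hg.comp (L j).contDiff, fun j => ?_, fun j x => ?_,
    fun j x hx => ?_, fun N => ?_⟩
  · exact hgc.comp_homeomorph (Homeomorph.smulOfNeZero ((j + 1 : ℝ)⁻¹)
      (inv_ne_zero (Nat.cast_add_one_ne_zero j)))
  · change ‖((b _ : ℝ) : ℂ)‖ ≤ 1
    rw [Complex.norm_real, Real.norm_of_nonneg b.nonneg]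
    exact b.le_one
  · change ((b _ : ℝ) : ℂ) = 1
    rw [b.one_of_mem_closedBall, Complex.ofReal_one]
    rw [mem_closedBall_zero_iff]
    change ‖((j + 1 : ℝ)⁻¹) • x‖ ≤ 1
    have hj : (0 : ℝ) < j + 1 := by positivity
    rw [norm_smul, norm_inv, Real.norm_of_nonneg hj.le, inv_mul_le_iff₀ hj, mul_one]
    exact hx.le
  · obtain ⟨C, hC, h⟩ := hgs N
    refine ⟨C, hC, fun j => (h.comp_clm (L j)).mono fun x => ?_⟩
    -- Dilating by a factor at most 1 does not increase derivatives, so the bounds of the undilated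
    -- bump hold for all `j`.
    have : ‖L j‖ ≤ 1 := by
      refine (norm_smul_le _ _).trans ?_
      rw [norm_inv, Real.norm_of_nonneg (by positivity)]
      refine mul_le_one₀ (inv_le_one_of_one_le₀ (by linarith [Nat.cast_nonneg (α := ℝ) j]))
        (norm_nonneg _) ContinuousLinearMap.norm_id_le
    rw [max_eq_left this]
    simp

/-- Truncations change the function only where `|ξ| ≥ j + 1`. There the spare power in `Decays`
makes the weighted error at most a constant over `1 + |ξ|`. -/
theorem Decays.exists_approx {M : ℕ} {f : RSpace n → ℂ} (hf : Decays M f) :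
    ∃ u : ℕ → 𝓢(RSpace n, ℂ), ∀ ε : ℝ, 0 < ε → ∀ᶠ j in atTop, ∀ ξ, ∀ i ≤ M,
      (1 + ‖ξ‖) ^ M * ‖iteratedFDeriv ℝ i (fun x => f x - u j x) ξ‖ ≤ ε := by
  obtain ⟨χ, h1, h2, -, h4, h5⟩ := exists_cutoff (RSpace n)
  obtain ⟨C, hf⟩ := hf
  obtain ⟨K, hK, h5⟩ := h5 M
  let u : ℕ → 𝓢(RSpace n, ℂ) := fun j =>
    ((h2 j).mul_right (f' := f)).toSchwartzMap ((h1 j).mul hf.1)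
  have hu : ∀ j x, f x - u j x = (1 + -χ j x) * f x := fun j x => by
    change f x - χ j x * f x = _
    ring
  have hd : ∀ j, DerivBound M (fun x => 2 ^ M * ((1 + K) * (C * ((1 + ‖x‖) ^ (M + 1))⁻¹)))
      (fun x => f x - u j x) := fun j => by
    simp only [hu]
    have a := (DerivBound.const (N := M) (P := RSpace n) (1 : ℂ)).add
      ((h5 j).clm_comp (-ContinuousLinearMap.id ℝ ℂ))
    refine (a.mul hf).mono fun x => ?_
    have := hf.nonneg x
    have h6 : ‖-ContinuousLinearMap.id ℝ ℂ‖ ≤ 1 := by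
      rw [norm_neg]; exact ContinuousLinearMap.norm_id_le
    have h7 : ‖-ContinuousLinearMap.id ℝ ℂ‖ * K ≤ K := mul_le_of_le_one_left hK h6
    have h8 : ‖(1 : ℂ)‖ = 1 := norm_one
    rw [h8]
    gcongr
  refine ⟨u, fun ε hε => ?_⟩
  have hC : 0 ≤ C := by simpa using hf.nonneg 0
  set D := 2 ^ M * ((1 + K) * C) with hD
  have hD0 : 0 ≤ D := by positivity
  obtain ⟨J, hJ⟩ := exists_nat_gt (D / ε)
  filter_upwards [eventually_ge_atTop J] with j hj ξ i hi
  rcases lt_or_ge ‖ξ‖ (j + 1) with hlt | hge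
  · have : (fun x => f x - u j x) =ᶠ[𝓝 ξ] fun _ => 0 := by
      filter_upwards [(isOpen_lt continuous_norm continuous_const).mem_nhds hlt] with x hx
      rw [hu, h4 j x hx]; ring
    rw [(this.iteratedFDeriv ℝ i).eq_of_nhds, iteratedFDeriv_fun_zero]
    simpa using hε.le
  · have h1 := (hd j).2 ξ i hi
    have h2 : (0 : ℝ) < 1 + ‖ξ‖ := by positivity
    have h3 : D / (1 + ‖ξ‖) ≤ ε := by
      rw [div_le_iff₀ h2]
      rw [div_lt_iff₀ hε] at hJ
      have : (J : ℝ) ≤ j := by exact_mod_cast hj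
      nlinarith
    calc _ ≤ (1 + ‖ξ‖) ^ M * (2 ^ M * ((1 + K) * (C * ((1 + ‖ξ‖) ^ (M + 1))⁻¹))) := by gcongr
      _ = D / (1 + ‖ξ‖) := by rw [hD, pow_succ]; field_simp
      _ ≤ ε := h3

theorem jetLM_mem {M : ℕ} (f : decaySubmodule n M) : jetLM n M f ∈ jetSpace n M := by
  obtain ⟨u, hu⟩ := Decays.exists_approx f.2
  have key : Tendsto (fun j => jetLM n M (schwartzLM n M (u j))) atTop (𝓝 (jetLM n M f)) := by
    rw [tendsto_iff_norm_sub_tendsto_zero, Metric.tendsto_atTop]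
    intro ε hε
    obtain ⟨J, hJ⟩ := eventually_atTop.1 (hu (ε / 2) (half_pos hε))
    refine ⟨J, fun j hj => ?_⟩
    have h1 : ‖jetLM n M (f - schwartzLM n M (u j))‖ ≤ ε / 2 :=
      norm_jetLM_le (half_pos hε).le (hJ j hj)
    rw [map_sub] at h1
    rw [dist_zero_right, norm_norm, norm_sub_rev]
    exact h1.trans_lt (half_lt_self hε)
  exact mem_closure_of_tendsto key
    (Eventually.of_forall fun j => LinearMap.mem_range_self
      ((jetLM n M).comp (schwartzLM n M)) (u j))

/-- The weighted jet of a function of finite decay. -/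
def toJet (n M : ℕ) : decaySubmodule n M →ₗ[ℂ] jetSpace n M :=
  (jetLM n M).codRestrict _ jetLM_mem

theorem coe_toJet {M : ℕ} (f : decaySubmodule n M) : (toJet n M f : Jets n M) = jetLM n M f := rfl

theorem norm_toJet_le {M : ℕ} {f : decaySubmodule n M} {K : ℝ} (hK : 0 ≤ K)
    (h : ∀ ξ, ∀ i ≤ M, (1 + ‖ξ‖) ^ M * ‖iteratedFDeriv ℝ i (f : RSpace n → ℂ) ξ‖ ≤ K) :
    ‖toJet n M f‖ ≤ K := by
  change ‖(toJet n M f : Jets n M)‖ ≤ K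
  rw [coe_toJet]
  exact norm_jetLM_le hK h

/-- Evaluation at a point on the space of weighted jets. -/
def evalJet (M : ℕ) (ξ : RSpace n) : jetSpace n M →L[ℂ] ℂ :=
  LinearMap.mkContinuous
    { toFun := fun w => (((1 + ‖ξ‖) ^ M : ℝ) : ℂ)⁻¹ *
        ((w : Jets n M) ((0 : Fin (M + 1)), ξ)) (fun _ => 0)
      map_add' := fun w w' => by
        rw [← mul_add]; rfl
      map_smul' := fun c w => by
        rw [RingHom.id_apply, smul_eq_mul, mul_left_comm]; rfl } 1 fun w => by
    change ‖(((1 + ‖ξ‖) ^ M : ℝ) : ℂ)⁻¹ * ((w : Jets n M) ((0 : Fin (M + 1)), ξ)) (fun _ => 0)‖ ≤ _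
    rw [norm_mul, norm_inv, Complex.norm_real, Real.norm_of_nonneg (by positivity)]
    refine mul_le_mul (inv_le_one_of_one_le₀ (one_le_pow₀ (by linarith [norm_nonneg ξ]))) ?_
      (norm_nonneg _) zero_le_one
    refine le_trans ?_ (lp.norm_apply_le_norm ENNReal.top_ne_zero (w : Jets n M)
      ((0 : Fin (M + 1)), ξ))
    refine (((w : Jets n M) ((0 : Fin (M + 1)), ξ)).le_opNorm (fun _ => 0)).trans (le_of_eq ?_)
    have : ∀ a : ℝ, a * ∏ _i : Fin 0, ‖(0 : RSpace n)‖ = a := fun a => by simp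
    exact this _

theorem evalJet_apply {M : ℕ} (ξ : RSpace n) (w : jetSpace n M) :
    evalJet M ξ w = (((1 + ‖ξ‖) ^ M : ℝ) : ℂ)⁻¹ *
        ((w : Jets n M) ((0 : Fin (M + 1)), ξ)) (fun _ => 0) := rfl

theorem evalJet_toJet {M : ℕ} (ξ : RSpace n) (f : decaySubmodule n M) :
    evalJet M ξ (toJet n M f) = (f : RSpace n → ℂ) ξ := by
  rw [evalJet_apply, coe_toJet, jetLM_apply]
  change _ * (((1 + ‖ξ‖) ^ M : ℝ) • (f : RSpace n → ℂ) ξ) = _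
  have : (((1 + ‖ξ‖) ^ M : ℝ) : ℂ) ≠ 0 := by
    exact_mod_cast (by positivity : (0 : ℝ) < (1 + ‖ξ‖) ^ M).ne'
  rw [Complex.real_smul, inv_mul_cancel_left₀ this]

theorem exists_seq_toJet {M : ℕ} (w : jetSpace n M) : ∃ u : ℕ → 𝓢(RSpace n, ℂ),
    Tendsto (fun j => jetLM n M (schwartzLM n M (u j))) atTop (𝓝 (w : Jets n M)) := by
  obtain ⟨x, hx, h⟩ := mem_closure_iff_seq_limit.1 w.2
  choose u hu using hx
  have e : x = fun j => jetLM n M (schwartzLM n M (u j)) := funext fun j => (hu j).symm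
  exact ⟨u, e ▸ h⟩

/-- A weighted jet that vanishes in order zero is zero. -/
theorem evalJet_injective {M : ℕ} (w : jetSpace n M) (h : ∀ ξ, evalJet M ξ w = 0) : w = 0 := by
  obtain ⟨u, hu⟩ := exists_seq_toJet w
  have hunif : ∀ (l : ℕ) (hl : l < M + 1), ∀ ε : ℝ, 0 < ε → ∀ᶠ j in atTop, ∀ ξ : RSpace n,
      ‖((w : Jets n M) (⟨l, hl⟩, ξ)) - ((1 + ‖ξ‖) ^ M : ℝ) • iteratedFDeriv ℝ l (u j) ξ‖ < ε := by
    intro l hl ε hε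
    filter_upwards [(Metric.tendsto_nhds.1 hu) ε hε] with j hj ξ
    rw [dist_comm, dist_eq_norm] at hj
    exact (lp.norm_apply_le_norm ENNReal.top_ne_zero
      ((w : Jets n M) - jetLM n M (schwartzLM n M (u j))) (⟨l, hl⟩, ξ)).trans_lt hj
  have hlim : ∀ (l : ℕ) (hl : l < M + 1) (ξ : RSpace n) (v : Fin l → RSpace n),
      Tendsto (fun j => iteratedFDeriv ℝ l (u j) ξ v) atTop
        (𝓝 ((((1 + ‖ξ‖) ^ M : ℝ) : ℝ)⁻¹ • ((w : Jets n M) (⟨l, hl⟩, ξ)) v)) := by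
    intro l hl ξ v
    have h1 : Tendsto (fun j => ((1 + ‖ξ‖) ^ M : ℝ) • iteratedFDeriv ℝ l (u j) ξ) atTop
        (𝓝 ((w : Jets n M) (⟨l, hl⟩, ξ))) := by
      rw [Metric.tendsto_nhds]
      intro ε hε
      filter_upwards [hunif l hl ε hε] with j hj
      rw [dist_comm, dist_eq_norm]
      exact hj ξ
    have h2 := ((ContinuousMultilinearMap.apply ℝ (fun _ : Fin l => RSpace n) ℂ v).continuous.tendsto
      _).comp h1
    have h3 := h2.const_smul (((1 + ‖ξ‖) ^ M : ℝ))⁻¹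
    refine h3.congr fun j => ?_
    have : ((1 + ‖ξ‖) ^ M : ℝ) ≠ 0 := by positivity
    change ((1 + ‖ξ‖) ^ M : ℝ)⁻¹ • (((1 + ‖ξ‖) ^ M : ℝ) • iteratedFDeriv ℝ l (u j) ξ v) = _
    rw [smul_smul, inv_mul_cancel₀ this, one_smul]
  -- Induction on the order. If the components of order `l` vanish, then along each line the `l`-th
  -- derivatives of the approximants tend to zero while their derivatives converge uniformly, by
  -- weights at least 1; the limit of the latter is the derivative of zero.
  have hz : ∀ (l : ℕ) (hl : l < M + 1) (ξ : RSpace n), (w : Jets n M) (⟨l, hl⟩, ξ) = 0 := by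
    intro l
    induction l with
    | zero =>
      intro hl ξ
      ext v
      have h1 := h ξ
      rw [evalJet_apply, mul_eq_zero] at h1
      have h2 : (((1 + ‖ξ‖) ^ M : ℝ) : ℂ)⁻¹ ≠ 0 := by
        refine inv_ne_zero ?_
        exact_mod_cast (by positivity : (0 : ℝ) < (1 + ‖ξ‖) ^ M).ne'
      have h3 := h1.resolve_left h2
      rw [Subsingleton.elim v (fun _ => 0)]
      exact h3
    | succ l ih =>
      intro hl ξ
      ext v
      have hl' : l < M + 1 := by omega
      let F : ℕ → ℝ → ℂ := fun j t => iteratedFDeriv ℝ l (u j) (ξ + t • v 0) (Fin.tail v)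
      let F' : ℕ → ℝ → ℂ := fun j t => iteratedFDeriv ℝ (l + 1) (u j) (ξ + t • v 0) v
      let g' : ℝ → ℂ := fun t => (((1 + ‖ξ + t • v 0‖) ^ M : ℝ) : ℝ)⁻¹ •
        ((w : Jets n M) (⟨l + 1, hl⟩, ξ + t • v 0)) v
      have hd : ∀ j t, HasDerivAt (F j) (F' j t) t := by
        intro j t
        have hs : ContDiff ℝ ∞ (u j) := (u j).smooth ⊤
        have h1 : DifferentiableAt ℝ (iteratedFDeriv ℝ l (u j)) (ξ + t • v 0) :=
          (hs.differentiable_iteratedFDeriv (by exact_mod_cast ENat.natCast_lt_top l)) _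
        have h2 : HasDerivAt (fun t : ℝ => ξ + t • v 0) (v 0) t := by
          simpa using ((hasDerivAt_id t).smul_const (v 0)).const_add ξ
        have h3 := h1.hasFDerivAt.comp_hasDerivAt t h2
        have h4 := (ContinuousMultilinearMap.apply ℝ (fun _ : Fin l => RSpace n) ℂ
          (Fin.tail v)).hasFDerivAt.comp_hasDerivAt t h3
        exact h4
      have hunif' : TendstoUniformly F' g' atTop := by
        rw [Metric.tendstoUniformly_iff]
        intro ε hε
        have hp : 0 < ∏ i, ‖v i‖ + 1 := by positivity
        filter_upwards [hunif (l + 1) hl (ε / (∏ i, ‖v i‖ + 1)) (by positivity)] with j hj t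
        have h1 := hj (ξ + t • v 0)
        set ξ' := ξ + t • v 0 with hξ'
        have hw1 : (1 : ℝ) ≤ (1 + ‖ξ'‖) ^ M := one_le_pow₀ (by linarith [norm_nonneg ξ'])
        have h2 : g' t - F' j t = (((1 + ‖ξ'‖) ^ M : ℝ))⁻¹ •
            (((w : Jets n M) (⟨l + 1, hl⟩, ξ')) -
              ((1 + ‖ξ'‖) ^ M : ℝ) • iteratedFDeriv ℝ (l + 1) (u j) ξ') v := by
          change _ = _ • (((w : Jets n M) (⟨l + 1, hl⟩, ξ')) v -
              ((1 + ‖ξ'‖) ^ M : ℝ) • iteratedFDeriv ℝ (l + 1) (u j) ξ' v)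
          rw [smul_sub, smul_smul, inv_mul_cancel₀ (by positivity), one_smul]
        rw [dist_eq_norm, h2, norm_smul, norm_inv, Real.norm_of_nonneg (by positivity)]
        have h3 := ((((w : Jets n M) (⟨l + 1, hl⟩, ξ')) -
              ((1 + ‖ξ'‖) ^ M : ℝ) • iteratedFDeriv ℝ (l + 1) (u j) ξ')).le_opNorm v
        have h4 : ((1 + ‖ξ'‖) ^ M : ℝ)⁻¹ ≤ 1 := inv_le_one_of_one_le₀ hw1
        rw [lt_div_iff₀ hp] at h1
        have h5 : ∏ i, ‖v i‖ ≤ ∏ i, ‖v i‖ + 1 := by linarith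
        calc _ ≤ 1 * _ := mul_le_mul_of_nonneg_right h4 (norm_nonneg _)
          _ ≤ _ := by rw [one_mul]; exact h3
          _ ≤ _ := mul_le_mul_of_nonneg_left h5 (norm_nonneg _)
          _ < ε := h1
      have hF0 : ∀ t, Tendsto (fun j => F j t) atTop (𝓝 0) := by
        intro t
        have := hlim l hl' (ξ + t • v 0) (Fin.tail v)
        rw [ih hl'] at this
        simpa using this
      have h1 := hasDerivAt_of_tendstoUniformly hunif' (Eventually.of_forall fun j => hd j) hF0 0
      have h2 : g' 0 = 0 := h1.unique (hasDerivAt_const _ _)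
      have h3 := (smul_eq_zero.1 h2).resolve_left (by positivity)
      have h4 : ξ + (0 : ℝ) • v 0 = ξ := by rw [zero_smul, add_zero]
      rwa [h4] at h3
  refine Subtype.ext (lp.ext (funext fun i => ?_))
  exact hz i.1 i.1.2 i.2

end JetSpace

/-! ### Extension of operators of finite order -/

section Extension

variable {n : ℕ} {X : Type*} [NormedAddCommGroup X] [NormedSpace ℂ X]

open Classical in
/-- The weighted jet of a function, or zero if the function does not decay. -/
def jetOf (M : ℕ) (f : RSpace n → ℂ) : jetSpace n M :=
  if h : Decays M f then toJet n M ⟨f, h⟩ else 0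

theorem jetOf_eq {M : ℕ} {f : RSpace n → ℂ} (h : Decays M f) : jetOf M f = toJet n M ⟨f, h⟩ :=
  dif_pos h

theorem evalJet_jetOf {M : ℕ} {f : RSpace n → ℂ} (h : Decays M f) (ξ : RSpace n) :
    evalJet M ξ (jetOf M f) = f ξ := by
  rw [jetOf_eq h, evalJet_toJet]

/-- Point evaluations are bounded and separate jets, so identities that involve derivatives or
integrals of jets reduce to scalar ones at each `ξ`. -/
theorem jet_ext {M : ℕ} {w w' : jetSpace n M} (h : ∀ ξ, evalJet M ξ w = evalJet M ξ w') :
    w = w' :=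
  sub_eq_zero.1 (evalJet_injective _ fun ξ => by rw [map_sub, h ξ, sub_self])

theorem Decays.const_mul {M : ℕ} {f : RSpace n → ℂ} (c : ℂ) (hf : Decays M f) :
    Decays M (fun x => c * f x) := (decaySubmodule n M).smul_mem c hf

theorem Decays.sum {M : ℕ} {ι : Type*} (s : Finset ι) {f : ι → RSpace n → ℂ}
    (hf : ∀ i ∈ s, Decays M (f i)) : Decays M (fun x => ∑ i ∈ s, f i x) := by
  have := (decaySubmodule n M).sum_mem (t := s) (f := f) hf
  have e : (fun x => ∑ i ∈ s, f i x) = ∑ i ∈ s, f i := by funext x; simp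
  rw [e]
  exact this

theorem norm_jetOf_le {M : ℕ} {f : RSpace n → ℂ} {K : ℝ} (hK : 0 ≤ K) (hf : Decays M f)
    (h : ∀ ξ, ∀ i ≤ M, (1 + ‖ξ‖) ^ M * ‖iteratedFDeriv ℝ i f ξ‖ ≤ K) : ‖jetOf M f‖ ≤ K := by
  rw [jetOf_eq hf]
  exact norm_toJet_le hK h

/-- Continuity controls `‖B φ‖` by finitely many seminorms; `M` is the largest index that occurs in
them. -/
theorem exists_hasOrder (B : 𝓢(RSpace n, ℂ) →L[ℂ] (X →L[ℂ] X)) : ∃ M, HasOrder B M := by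
  obtain ⟨s, C, -, h⟩ := Seminorm.bound_of_continuous (schwartz_withSeminorms ℂ (RSpace n) ℂ)
    ((normSeminorm ℂ (X →L[ℂ] X)).comp B.toLinearMap) (continuous_norm.comp B.continuous)
  obtain ⟨M, hM⟩ : ∃ M : ℕ, s ⊆ Finset.Iic (M, M) := by
    refine ⟨s.sup (fun p => max p.1 p.2), fun p hp => ?_⟩
    have := Finset.le_sup (f := fun p : ℕ × ℕ => max p.1 p.2) hp
    rw [Finset.mem_Iic, Prod.le_def]
    exact ⟨(le_max_left _ _).trans this, (le_max_right _ _).trans this⟩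
  refine ⟨M, C, fun φ => (h φ).trans ?_⟩
  have := Finset.sup_mono (f := schwartzSeminormFamily ℂ (RSpace n) ℂ) hM φ
  exact mul_le_mul_of_nonneg_left this C.2

/-- Makes `B` bounded for the jet norm, as its extension by density requires. -/
theorem seminorm_le_jet (M : ℕ) (φ : 𝓢(RSpace n, ℂ)) :
    (Finset.Iic (M, M)).sup (schwartzSeminormFamily ℂ (RSpace n) ℂ) φ ≤
      ‖toJet n M (schwartzLM n M φ)‖ := by
  refine Seminorm.finset_sup_apply_le (norm_nonneg _) ?_
  rintro ⟨k, l⟩ hkl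
  have hk : k ≤ M ∧ l ≤ M := by simpa [Prod.le_def] using hkl
  refine SchwartzMap.seminorm_le_bound ℂ k l _ (norm_nonneg _) fun ξ => ?_
  have h1 := lp.norm_apply_le_norm ENNReal.top_ne_zero (jetLM n M (schwartzLM n M φ))
    ((⟨l, by omega⟩ : Fin (M + 1)), ξ)
  rw [jetLM_apply, jetFun, norm_smul, Real.norm_of_nonneg (by positivity)] at h1
  refine le_trans ?_ h1
  have h2 : ‖ξ‖ ^ k ≤ (1 + ‖ξ‖) ^ M :=
    (pow_le_pow_left₀ (norm_nonneg _) (by linarith) k).trans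
      (pow_le_pow_right₀ (by linarith [norm_nonneg ξ]) hk.1)
  exact mul_le_mul_of_nonneg_right h2 (norm_nonneg _)

variable [CompleteSpace X]

/-- The extension of an operator of order `M` to weighted jets. -/
def extJet (M : ℕ) (B : 𝓢(RSpace n, ℂ) →L[ℂ] (X →L[ℂ] X)) : jetSpace n M →L[ℂ] (X →L[ℂ] X) :=
  B.toLinearMap.extendOfNorm ((toJet n M).comp (schwartzLM n M))

theorem extJet_schwartz {M : ℕ} {B : 𝓢(RSpace n, ℂ) →L[ℂ] (X →L[ℂ] X)} (hB : HasOrder B M)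
    (φ : 𝓢(RSpace n, ℂ)) : extJet M B (jetOf M φ) = B φ := by
  rw [jetOf_eq (schwartz_decays M φ)]
  refine LinearMap.extendOfNorm_eq (f := B.toLinearMap)
    (e := (toJet n M).comp (schwartzLM n M)) ?_ ?_ φ
  · intro w
    obtain ⟨u, hu⟩ := exists_seq_toJet w
    refine mem_closure_of_tendsto (f := fun j => toJet n M (schwartzLM n M (u j))) (b := atTop) ?_
      (Eventually.of_forall fun j => ⟨u j, rfl⟩)
    exact tendsto_subtype_rng.2 hu
  · obtain ⟨C, hC⟩ := hB
    refine ⟨max C 0, fun φ => (hC φ).trans ?_⟩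
    exact mul_le_mul (le_max_left _ _) (seminorm_le_jet M φ) (apply_nonneg _ _)
      (le_max_right _ _)

theorem isValueAt_extJet {M : ℕ} {B : 𝓢(RSpace n, ℂ) →L[ℂ] (X →L[ℂ] X)} (hB : HasOrder B M)
    {f : RSpace n → ℂ} (hf : Decays M f) : IsValueAt B f (extJet M B (jetOf M f)) := by
  refine ⟨hf.contDiff, M, hB, ?_⟩
  obtain ⟨u, hu⟩ := hf.exists_approx
  refine ⟨u, fun ε hε => ?_, ?_⟩
  · filter_upwards [hu ε hε] with j hj k hk l hl ξ
    refine le_trans ?_ (hj ξ l hl)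
    have h2 : ‖ξ‖ ^ k ≤ (1 + ‖ξ‖) ^ M :=
      (pow_le_pow_left₀ (norm_nonneg _) (by linarith) k).trans
        (pow_le_pow_right₀ (by linarith [norm_nonneg ξ]) hk)
    exact mul_le_mul_of_nonneg_right h2 (norm_nonneg _)
  · simp only [← extJet_schwartz hB]
    refine ((extJet M B).continuous.tendsto _).comp ?_
    rw [tendsto_iff_norm_sub_tendsto_zero, Metric.tendsto_atTop]
    intro ε hε
    obtain ⟨J, hJ⟩ := eventually_atTop.1 (hu (ε / 2) (half_pos hε))
    refine ⟨J, fun j hj => ?_⟩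
    have h1 : ‖toJet n M (⟨f, hf⟩ - schwartzLM n M (u j))‖ ≤ ε / 2 :=
      norm_toJet_le (half_pos hε).le (hJ j hj)
    rw [map_sub] at h1
    rw [dist_zero_right, norm_norm, norm_sub_rev, jetOf_eq hf, jetOf_eq (schwartz_decays M (u j))]
    exact h1.trans_lt (half_lt_self hε)

end Extension

/-! ### Smooth families of functions of finite decay -/

section Families

variable {P G : Type*} [NormedAddCommGroup P] [NormedSpace ℝ P] [NormedAddCommGroup G]
  [NormedSpace ℝ G]

theorem contDiff_iteratedFDeriv {f : P → G} (hf : ContDiff ℝ ∞ f) (l : ℕ) :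
    ContDiff ℝ ∞ (iteratedFDeriv ℝ l f) :=
  contDiff_infty.2 fun _ => hf.iteratedFDeriv_right (by exact_mod_cast le_top)

/-- Symmetry of the second derivative, used once for each order, moves the direction `h` past the
iterated derivative. -/
theorem iteratedFDeriv_fderiv_apply {f : P → G} (hf : ContDiff ℝ ∞ f) (h : P) (l : ℕ) (x : P) :
    iteratedFDeriv ℝ l (fun y => fderiv ℝ f y h) x = fderiv ℝ (iteratedFDeriv ℝ l f) x h := by
  induction l generalizing x with
  | zero =>
    ext v
    have hd : DifferentiableAt ℝ (iteratedFDeriv ℝ 0 f) x :=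
      hf.differentiable_iteratedFDeriv (m := 0) (by simp) x
    have := hd.iteratedFDeriv_succ_apply_left' (m := Fin.cons h v)
    rw [iteratedFDeriv_succ_apply_left] at this
    simp only [Fin.cons_zero, Fin.tail_cons] at this
    rw [this]
    simp [iteratedFDeriv_zero_apply]
  | succ l ih =>
    ext v
    have hs : ContDiff ℝ ∞ (iteratedFDeriv ℝ l f) :=
      contDiff_iteratedFDeriv hf _
    have hs1 : ContDiff ℝ ∞ (iteratedFDeriv ℝ (l + 1) f) :=
      contDiff_iteratedFDeriv hf _
    have hs' : Differentiable ℝ (fderiv ℝ (iteratedFDeriv ℝ l f)) :=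
      (hs.fderiv_right (m := ∞) (by simp)).differentiable (by simp)
    rw [iteratedFDeriv_succ_apply_left, funext ih]
    have hsym : IsSymmSndFDerivAt ℝ (iteratedFDeriv ℝ l f) x :=
      (hs.contDiffAt (x := x)).isSymmSndFDerivAt
        (by simpa using (WithTop.coe_le_coe.2 (le_top : ((2 : ℕ) : ℕ∞) ≤ ⊤) : (2 : ℕ∞ω) ≤ ∞))
    have e1 : fderiv ℝ (fun y => fderiv ℝ (iteratedFDeriv ℝ l f) y h) x (v 0) =
        fderiv ℝ (fderiv ℝ (iteratedFDeriv ℝ l f)) x (v 0) h := by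
      rw [fderiv_clm_apply (hs' x) (differentiableAt_const h)]
      simp
    have e2 : (fderiv ℝ (iteratedFDeriv ℝ (l + 1) f) x h) v =
        (fderiv ℝ (fderiv ℝ (iteratedFDeriv ℝ l f)) x h (v 0)) (Fin.tail v) := by
      have h3 : fderiv ℝ (fun y => iteratedFDeriv ℝ (l + 1) f y v) x h =
          (fderiv ℝ (iteratedFDeriv ℝ (l + 1) f) x h) v := by
        rw [fderiv_continuousMultilinear_apply_const (hs1.differentiable (by simp) x)]
        simp
      have h4 : (fun y => iteratedFDeriv ℝ (l + 1) f y v) = fun y =>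
          (fderiv ℝ (iteratedFDeriv ℝ l f) y (v 0)) (Fin.tail v) := rfl
      rw [← h3, h4, fderiv_continuousMultilinear_apply_const
        ((hs' x).clm_apply (differentiableAt_const _)),
        fderiv_clm_apply (hs' x) (differentiableAt_const _)]
      simp
    rw [e1, e2, hsym.eq]

/-- The mean value inequality on the segment, applied first to the derivative and then to the
function itself; the missing factor 1/2 is immaterial. -/
theorem norm_sub_sub_fderiv_le {F : P → G} (hF : ContDiff ℝ ∞ F) {s : Set P} (hs : Convex ℝ s)
    {K : ℝ} (h : ∀ x ∈ s, ‖fderiv ℝ (fderiv ℝ F) x‖ ≤ K) {p q : P} (hp : p ∈ s) (hq : q ∈ s) :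
    ‖F q - F p - fderiv ℝ F p (q - p)‖ ≤ K * ‖q - p‖ ^ 2 := by
  have hF' : Differentiable ℝ (fderiv ℝ F) :=
    (hF.fderiv_right (m := ∞) (by simp)).differentiable (by simp)
  have hK : 0 ≤ K := (norm_nonneg _).trans (h p hp)
  have hseg : segment ℝ p q ⊆ s := hs.segment_subset hp hq
  have h1 : ∀ x ∈ segment ℝ p q, ‖fderiv ℝ F x - fderiv ℝ F p‖ ≤ K * ‖q - p‖ := by
    intro x hx
    have := (convex_segment p q).norm_image_sub_le_of_norm_hasFDerivWithin_le
      (fun y _ => (hF' y).hasFDerivAt.hasFDerivWithinAt) (fun y hy => h y (hseg hy))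
      (left_mem_segment ℝ p q) hx
    refine this.trans (mul_le_mul_of_nonneg_left ?_ hK)
    exact norm_sub_le_of_mem_segment hx
  have := (convex_segment p q).norm_image_sub_le_of_norm_hasFDerivWithin_le'
    (fun y _ => (hF.differentiable (by simp) y).hasFDerivAt.hasFDerivWithinAt) h1
    (left_mem_segment ℝ p q) (right_mem_segment ℝ p q)
  exact this.trans (le_of_eq (by ring))

theorem norm_fderiv_fderiv_iteratedFDeriv {f : P → G} (l : ℕ) (x : P) :
    ‖fderiv ℝ (fderiv ℝ (iteratedFDeriv ℝ l f)) x‖ = ‖iteratedFDeriv ℝ (l + 2) f x‖ := by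
  rw [fderiv_iteratedFDeriv, LinearIsometryEquiv.comp_fderiv, ← norm_fderiv_iteratedFDeriv]
  exact LinearIsometry.norm_toContinuousLinearMap_comp
    (continuousMultilinearCurryLeftEquiv ℝ (fun _ : Fin (l + 1) => P) G).toLinearIsometry

variable {n : ℕ} {E : Type*} [NormedAddCommGroup E] [NormedSpace ℝ E]

/-- The derivatives of `f` in both variables are `O((1 + |ζ|)^a (1 + |ξ|)^{-M-1})`, with `a`
depending on the order of the derivative. -/
def JointDecays (M : ℕ) (f : E × RSpace n → ℂ) : Prop :=
  ∀ N : ℕ, ∃ (C : ℝ) (a : ℕ), 0 ≤ C ∧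
    DerivBound N (fun p => C * (1 + ‖p.1‖) ^ a * ((1 + ‖p.2‖) ^ (M + 1))⁻¹) f

theorem JointDecays.contDiff {M : ℕ} {f : E × RSpace n → ℂ} (hf : JointDecays M f) :
    ContDiff ℝ ∞ f := by
  obtain ⟨C, a, -, h⟩ := hf 0
  exact h.1

theorem DerivBound.slice {N : ℕ} {w : E × RSpace n → ℝ} {f : E × RSpace n → ℂ}
    (h : DerivBound N w f) (ζ : E) : DerivBound N (fun ξ => w (ζ, ξ)) (fun ξ => f (ζ, ξ)) := by
  have := (h.comp_add (ζ, 0)).comp_clm (ContinuousLinearMap.inr ℝ E (RSpace n))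
  have e : max 1 ‖ContinuousLinearMap.inr ℝ E (RSpace n)‖ = 1 :=
    max_eq_left (ContinuousLinearMap.opNorm_le_bound _ zero_le_one fun x => by
      simp [Prod.norm_def])
  simpa [e] using this

theorem JointDecays.decays {M : ℕ} {f : E × RSpace n → ℂ} (hf : JointDecays M f) (ζ : E) :
    Decays M (fun ξ => f (ζ, ξ)) := by
  obtain ⟨C, a, -, h⟩ := hf M
  exact ⟨C * (1 + ‖ζ‖) ^ a, h.slice ζ⟩

theorem JointDecays.fderiv_apply {M : ℕ} {f : E × RSpace n → ℂ} (hf : JointDecays M f)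
    (v : E × RSpace n) : JointDecays M (fun p => fderiv ℝ f p v) := fun N => by
  obtain ⟨C, a, hC, h⟩ := hf (N + 1)
  exact ⟨‖v‖ * C, a, by positivity, (h.fderiv_apply v).mono fun p => le_of_eq (by ring)⟩

theorem iteratedFDeriv_slice {f : E × RSpace n → ℂ} (hf : ContDiff ℝ ∞ f) (ζ : E) (l : ℕ)
    (ξ : RSpace n) : iteratedFDeriv ℝ l (fun ξ => f (ζ, ξ)) ξ =
      (iteratedFDeriv ℝ l f (ζ, ξ)).compContinuousLinearMap
        (fun _ => ContinuousLinearMap.inr ℝ E (RSpace n)) := by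
  have h1 : ContDiff ℝ ∞ (fun p : E × RSpace n => f (p + (ζ, 0))) :=
    hf.comp (contDiff_id.add contDiff_const)
  have h2 := (ContinuousLinearMap.inr ℝ E (RSpace n)).iteratedFDeriv_comp_right h1 ξ (i := l)
    (by exact_mod_cast le_top)
  have h3 : (fun p : E × RSpace n => f (p + (ζ, 0))) ∘ (ContinuousLinearMap.inr ℝ E (RSpace n)) =
      fun ξ => f (ζ, ξ) := by
    funext x
    simp
  rw [h3, iteratedFDeriv_comp_add_right] at h2
  rw [h2]
  simp

variable [FiniteDimensional ℝ E]

/-- The derivative of a family of weighted jets. -/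
def jetFamilyDeriv (M : ℕ) (f : E × RSpace n → ℂ) (hf : JointDecays M f) (ζ : E) :
    E →L[ℝ] jetSpace n M :=
  LinearMap.toContinuousLinearMap
    { toFun := fun h => jetOf M (fun ξ => fderiv ℝ f (ζ, ξ) (h, 0))
      map_add' := fun h k => jet_ext fun ξ => by
        rw [map_add, evalJet_jetOf ((hf.fderiv_apply _).decays ζ),
          evalJet_jetOf ((hf.fderiv_apply _).decays ζ),
          evalJet_jetOf ((hf.fderiv_apply _).decays ζ), ← map_add, Prod.mk_add_mk, add_zero]
      map_smul' := fun c h => jet_ext fun ξ => by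
        rw [RingHom.id_apply, ContinuousLinearMap.map_smul_of_tower,
          evalJet_jetOf ((hf.fderiv_apply _).decays ζ),
          evalJet_jetOf ((hf.fderiv_apply _).decays ζ), ← map_smul,
          Prod.smul_mk, smul_zero] }

theorem jetFamilyDeriv_apply {M : ℕ} {f : E × RSpace n → ℂ} (hf : JointDecays M f) (ζ h : E) :
    jetFamilyDeriv M f hf ζ h = jetOf M (fun ξ => fderiv ℝ f (ζ, ξ) (h, 0)) := rfl

/-- The second-order Taylor estimate in `ζ` is applied to every `D^l f` with `l ≤ M`, which uses
derivatives of order up to `M + 2`. The bounds carry the decay in `ξ`, so the remainder is `O(|h|²)`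
in the jet norm. -/
theorem hasFDerivAt_jetOf {M : ℕ} {f : E × RSpace n → ℂ} (hf : JointDecays M f) (ζ : E) :
    HasFDerivAt (fun ζ => jetOf M (fun ξ => f (ζ, ξ))) (jetFamilyDeriv M f hf ζ) ζ := by
  obtain ⟨C, a, hC, hb⟩ := hf (M + 2)
  have hsm := hf.contDiff
  have key : ∀ ζ' : E, ‖ζ' - ζ‖ ≤ 1 →
      ‖jetOf M (fun ξ => f (ζ', ξ)) - jetOf M (fun ξ => f (ζ, ξ)) -
        jetFamilyDeriv M f hf ζ (ζ' - ζ)‖ ≤ C * (2 + ‖ζ‖) ^ a * ‖ζ' - ζ‖ ^ 2 := by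
    intro ζ' hζ'
    set h := ζ' - ζ with hh
    have d1 := hf.decays ζ'
    have d2 := hf.decays ζ
    have d3 := (hf.fderiv_apply (h, 0)).decays ζ
    have d4 : Decays M (fun ξ => f (ζ', ξ) - f (ζ, ξ) - fderiv ℝ f (ζ, ξ) (h, 0)) :=
      (decaySubmodule n M).sub_mem ((decaySubmodule n M).sub_mem d1 d2) d3
    have e : jetOf M (fun ξ => f (ζ', ξ)) - jetOf M (fun ξ => f (ζ, ξ)) -
        jetFamilyDeriv M f hf ζ h =
        jetOf M (fun ξ => f (ζ', ξ) - f (ζ, ξ) - fderiv ℝ f (ζ, ξ) (h, 0)) := by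
      refine jet_ext fun ξ => ?_
      rw [map_sub, map_sub, jetFamilyDeriv_apply, evalJet_jetOf d1, evalJet_jetOf d2,
        evalJet_jetOf d3, evalJet_jetOf d4]
    rw [e]
    refine norm_jetOf_le (by positivity) d4 fun ξ l hl => ?_
    have c1 : ContDiff ℝ ∞ (fun ξ : RSpace n => f (ζ', ξ)) := d1.contDiff
    have c2 : ContDiff ℝ ∞ (fun ξ : RSpace n => f (ζ, ξ)) := d2.contDiff
    have c3 : ContDiff ℝ ∞ (fun ξ : RSpace n => fderiv ℝ f (ζ, ξ) (h, 0)) := d3.contDiff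
    have hl' : ((l : ℕ) : ℕ∞ω) ≤ ∞ := by exact_mod_cast le_top
    have e1 : iteratedFDeriv ℝ l (fun ξ => f (ζ', ξ) - f (ζ, ξ) - fderiv ℝ f (ζ, ξ) (h, 0)) ξ =
        (iteratedFDeriv ℝ l f (ζ', ξ) - iteratedFDeriv ℝ l f (ζ, ξ) -
          fderiv ℝ (iteratedFDeriv ℝ l f) (ζ, ξ) ((ζ', ξ) - (ζ, ξ))).compContinuousLinearMap
        (fun _ => ContinuousLinearMap.inr ℝ E (RSpace n)) := by
      have a1 := iteratedFDeriv_sub_apply (x := ξ) (i := l)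
        ((c1.sub c2).of_le hl').contDiffAt (c3.of_le hl').contDiffAt
      have a2 : iteratedFDeriv ℝ l (fun ξ => f (ζ', ξ) - f (ζ, ξ)) ξ = _ :=
        iteratedFDeriv_sub_apply (x := ξ) (i := l)
        (c1.of_le hl').contDiffAt (c2.of_le hl').contDiffAt
      have a3 := iteratedFDeriv_slice (hf.fderiv_apply (h, 0)).contDiff ζ l ξ
      refine a1.trans ?_
      rw [a2, a3, iteratedFDeriv_slice hsm, iteratedFDeriv_slice hsm,
        iteratedFDeriv_fderiv_apply hsm, Prod.mk_sub_mk, sub_self]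
      rfl
    rw [e1]
    let s : Set (E × RSpace n) := Metric.closedBall ζ 1 ×ˢ {ξ}
    have hs : Convex ℝ s := (convex_closedBall ζ 1).prod (convex_singleton ξ)
    -- The segment between the two points has constant `ξ`, so the decay weight is the same along it
    -- and only `1 + |ζ|` has to be bounded on a unit ball.
    have hF : ContDiff ℝ ∞ (iteratedFDeriv ℝ l f) := contDiff_iteratedFDeriv hsm _
    have hK : ∀ x ∈ s, ‖fderiv ℝ (fderiv ℝ (iteratedFDeriv ℝ l f)) x‖ ≤
        C * (2 + ‖ζ‖) ^ a * ((1 + ‖ξ‖) ^ (M + 1))⁻¹ := by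
      rintro ⟨x, y⟩ ⟨hx, hy⟩
      obtain rfl : y = ξ := hy
      rw [norm_fderiv_fderiv_iteratedFDeriv]
      refine (hb.2 _ _ (by omega)).trans ?_
      have : 1 + ‖x‖ ≤ 2 + ‖ζ‖ := by
        have h1 : ‖x - ζ‖ ≤ 1 := by simpa [dist_eq_norm] using hx
        have h2 := norm_le_norm_add_norm_sub ζ x
        rw [norm_sub_rev] at h2
        linarith
      dsimp only
      gcongr
    have hT := norm_sub_sub_fderiv_le hF hs hK (p := (ζ, ξ)) (q := (ζ', ξ))
      ⟨by simp, rfl⟩ ⟨by simpa [dist_eq_norm] using hζ', rfl⟩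
    have hn : ‖((ζ', ξ) : E × RSpace n) - (ζ, ξ)‖ = ‖h‖ := by
      simp [Prod.norm_def, hh]
    rw [hn] at hT
    have hinr : ‖ContinuousLinearMap.inr ℝ E (RSpace n)‖ ≤ 1 :=
      ContinuousLinearMap.opNorm_le_bound _ zero_le_one fun x => by simp [Prod.norm_def]
    have hcomp := ContinuousMultilinearMap.norm_compContinuousLinearMap_le
      (iteratedFDeriv ℝ l f (ζ', ξ) - iteratedFDeriv ℝ l f (ζ, ξ) -
          fderiv ℝ (iteratedFDeriv ℝ l f) (ζ, ξ) ((ζ', ξ) - (ζ, ξ)))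
        (fun _ => ContinuousLinearMap.inr ℝ E (RSpace n))
    have hprod : ∏ _i : Fin l, ‖ContinuousLinearMap.inr ℝ E (RSpace n)‖ ≤ 1 :=
      Finset.prod_le_one (fun _ _ => norm_nonneg _) fun _ _ => hinr
    have hfin := hcomp.trans ((mul_le_of_le_one_right (norm_nonneg _) hprod).trans hT)
    have hw : (1 + ‖ξ‖) ^ M * ((1 + ‖ξ‖) ^ (M + 1))⁻¹ ≤ 1 := by
      rw [← div_eq_mul_inv, div_le_one (by positivity)]
      exact pow_le_pow_right₀ (by linarith [norm_nonneg ξ]) (by omega)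
    calc _ ≤ (1 + ‖ξ‖) ^ M * (C * (2 + ‖ζ‖) ^ a * ((1 + ‖ξ‖) ^ (M + 1))⁻¹ * ‖h‖ ^ 2) :=
          mul_le_mul_of_nonneg_left hfin (by positivity)
      _ = (C * (2 + ‖ζ‖) ^ a * ‖h‖ ^ 2) * ((1 + ‖ξ‖) ^ M * ((1 + ‖ξ‖) ^ (M + 1))⁻¹) := by ring
      _ ≤ _ := mul_le_of_le_one_right (by positivity) hw
  refine HasFDerivAt.of_isLittleO ?_
  refine Asymptotics.IsBigO.trans_isLittleO (g := fun ζ' => ‖ζ' - ζ‖ ^ 2) ?_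
    (Asymptotics.isLittleO_pow_sub_sub ζ (by norm_num))
  refine Asymptotics.IsBigO.of_bound (C * (2 + ‖ζ‖) ^ a) ?_
  filter_upwards [Metric.closedBall_mem_nhds ζ one_pos] with ζ' hζ'
  rw [Real.norm_of_nonneg (by positivity)]
  exact key ζ' (by simpa [dist_eq_norm] using hζ')

/-- Each directional derivative of the family of jets is again the family of jets of a jointly
decaying function, so differentiability propagates to all orders. -/
theorem contDiff_jetOf {M : ℕ} {f : E × RSpace n → ℂ} (hf : JointDecays M f) :
    ContDiff ℝ ∞ (fun ζ => jetOf M (fun ξ => f (ζ, ξ))) := by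
  rw [contDiff_infty]
  intro k
  induction k generalizing f with
  | zero =>
    exact contDiff_zero.2 (continuous_iff_continuousAt.2 fun ζ =>
      (hasFDerivAt_jetOf hf ζ).continuousAt)
  | succ k ih =>
    have e : fderiv ℝ (fun ζ => jetOf M (fun ξ => f (ζ, ξ))) = jetFamilyDeriv M f hf :=
      funext fun ζ => (hasFDerivAt_jetOf hf ζ).fderiv
    push_cast
    rw [contDiff_succ_iff_fderiv]
    refine ⟨fun ζ => (hasFDerivAt_jetOf hf ζ).differentiableAt, by simp, ?_⟩
    rw [e, contDiff_clm_apply_iff]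
    exact fun h => ih (hf.fderiv_apply (h, 0))

end Families

/-! ### Exterior products -/

section Exterior

variable {n : ℕ} {F F' : Type*} [NormedAddCommGroup F] [NormedSpace ℂ F]
  [NormedAddCommGroup F'] [NormedSpace ℂ F']

theorem wedge_apply {k l : ℕ} (η : Covec n k F) (θ : Covec n l ℂ) (v : Fin (k + l) → CSpace n) :
    wedge η θ v = ((k.factorial * l.factorial : ℕ) : ℝ)⁻¹ •
      ∑ σ : Equiv.Perm (Fin (k + l)), Equiv.Perm.sign σ •
        (θ (fun j => v (σ (Fin.natAdd k j))) • η (fun i => v (σ (Fin.castAdd l i)))) := by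
  rw [wedge, ContinuousAlternatingMap.smul_apply,
    ContinuousMultilinearMap.alternatization_apply_apply]
  rfl

theorem wedge_add_left {k l : ℕ} (η η' : Covec n k F) (θ : Covec n l ℂ) :
    wedge (η + η') θ = wedge η θ + wedge η' θ := by
  ext v
  simp only [wedge_apply, ContinuousAlternatingMap.add_apply, smul_add, Finset.sum_add_distrib]

theorem wedge_add_right {k l : ℕ} (η : Covec n k F) (θ θ' : Covec n l ℂ) :
    wedge η (θ + θ') = wedge η θ + wedge η θ' := by
  ext v
  simp only [wedge_apply, ContinuousAlternatingMap.add_apply, smul_add, add_smul,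
    Finset.sum_add_distrib]

theorem wedge_smul_left {k l : ℕ} (c : ℂ) (η : Covec n k F) (θ : Covec n l ℂ) :
    wedge (c • η) θ = c • wedge η θ := by
  ext v
  simp only [wedge_apply, ContinuousAlternatingMap.smul_apply]
  refine Eq.trans ?_ (smul_comm (((k.factorial * l.factorial : ℕ) : ℝ)⁻¹) c _)
  rw [Finset.smul_sum (r := c)]
  congr 1
  refine Finset.sum_congr rfl fun σ _ => ?_
  rw [smul_comm c (Equiv.Perm.sign σ)]
  congr 1
  exact smul_comm _ _ _

theorem wedge_smul_right {k l : ℕ} (c : ℂ) (η : Covec n k F) (θ : Covec n l ℂ) :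
    wedge η (c • θ) = c • wedge η θ := by
  ext v
  simp only [wedge_apply, ContinuousAlternatingMap.smul_apply]
  refine Eq.trans ?_ (smul_comm (((k.factorial * l.factorial : ℕ) : ℝ)⁻¹) c _)
  rw [Finset.smul_sum (r := c)]
  congr 1
  refine Finset.sum_congr rfl fun σ _ => ?_
  rw [smul_comm c (Equiv.Perm.sign σ), smul_eq_mul, mul_smul]

theorem wedge_sum_left {k l : ℕ} {ι : Type*} (s : Finset ι) (η : ι → Covec n k F)
    (θ : Covec n l ℂ) : wedge (∑ i ∈ s, η i) θ = ∑ i ∈ s, wedge (η i) θ :=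
  map_sum (AddMonoidHom.mk' (fun η : Covec n k F => wedge η θ)
    fun a b => wedge_add_left a b θ) η s

theorem wedge_sum_right {k l : ℕ} {ι : Type*} (s : Finset ι) (η : Covec n k F)
    (θ : ι → Covec n l ℂ) : wedge η (∑ i ∈ s, θ i) = ∑ i ∈ s, wedge η (θ i) :=
  map_sum (AddMonoidHom.mk' (fun θ : Covec n l ℂ => wedge η θ)
    fun a b => wedge_add_right η a b) θ s

/-- The covector `v ↦ E(v) w`. -/
def tensCovec {k : ℕ} (E : Covec n k ℂ) : F →L[ℂ] Covec n k F :=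
  LinearMap.mkContinuous
    { toFun := fun w =>
        (ContinuousLinearMap.toSpanSingleton ℂ w |>.restrictScalars ℝ).compContinuousAlternatingMap E
      map_add' := fun w w' => by ext v; exact smul_add _ _ _
      map_smul' := fun c w => by ext v; exact smul_comm _ _ _ } ‖E‖ fun w => by
    refine ContinuousAlternatingMap.opNorm_le_bound _ (by positivity) fun v => ?_
    change ‖E v • w‖ ≤ _
    rw [norm_smul]
    calc _ ≤ (‖E‖ * ∏ i, ‖v i‖) * ‖w‖ := by gcongr; exact E.le_opNorm v
      _ = _ := by ring

theorem tensCovec_apply {k : ℕ} (E : Covec n k ℂ) (w : F) (v : Fin k → CSpace n) :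
    tensCovec E w v = E v • w := rfl

theorem wedge_tensCovec {k l : ℕ} (E : Covec n k ℂ) (w : F) (θ : Covec n l ℂ)
    (v : Fin (k + l) → CSpace n) : wedge (tensCovec E w) θ v = wedge E θ v • w := by
  simp only [wedge_apply, tensCovec_apply]
  rw [smul_assoc, Finset.sum_smul]
  congr 1
  refine Finset.sum_congr rfl fun σ _ => ?_
  rw [Units.smul_def, Units.smul_def, smul_assoc, smul_assoc]

/-- A one-form as an alternating form. -/
def oneForm (L : CSpace n →L[ℝ] F) : Covec n (0 + 1) F :=
  ContinuousAlternatingMap.ofSubsingleton ℝ (CSpace n) F (0 : Fin 1) L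

theorem oneForm_apply (L : CSpace n →L[ℝ] F) (v : Fin (0 + 1) → CSpace n) :
    oneForm L v = L (v 0) := rfl

theorem sum_perm_comp {m : ℕ} (T : (Fin m → CSpace n) → F) (π : Equiv.Perm (Fin m))
    (v : Fin m → CSpace n) :
    ∑ σ : Equiv.Perm (Fin m), Equiv.Perm.sign σ • T (fun i => v (σ (π i))) =
      Equiv.Perm.sign π • ∑ σ : Equiv.Perm (Fin m), Equiv.Perm.sign σ • T (fun i => v (σ i)) := by
  rw [Finset.smul_sum, ← Equiv.sum_comp (Equiv.mulRight π)
    (fun σ : Equiv.Perm (Fin m) =>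
      Equiv.Perm.sign π • Equiv.Perm.sign σ • T (fun i => v (σ i)))]
  refine Finset.sum_congr rfl fun σ _ => ?_
  rw [Equiv.coe_mulRight, Equiv.Perm.sign_mul, smul_smul, mul_comm (Equiv.Perm.sign σ), ← mul_assoc,
    Int.units_mul_self, one_mul]
  rfl

/-- The product with a one-form on the right. -/
theorem wedge_oneForm_apply {N : ℕ} (η : Covec n N F) (L : CSpace n →L[ℝ] ℂ)
    (v : Fin (N + (0 + 1)) → CSpace n) :
    wedge η (oneForm L) v = (-1 : ℤ) ^ N • ∑ i : Fin (N + 1), (-1 : ℤ) ^ (i : ℕ) •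
      (L (v i) • η (Fin.removeNth i v)) := by
  let T : (Fin (N + 1) → CSpace n) → F := fun v => L (v 0) • η (Fin.tail v)
  let R : CSpace n [⋀^Fin (N + 1)]→L[ℝ] F := ContinuousAlternatingMap.alternatizeUncurryFin
    (((ContinuousLinearMap.toSpanSingleton ℂ η).restrictScalars ℝ).comp L)
  have hR : ∀ v : Fin (N + 1) → CSpace n, R v = ∑ i : Fin (N + 1), (-1 : ℤ) ^ (i : ℕ) •
      (L (v i) • η (Fin.removeNth i v)) := fun v => by
    simp only [R, ContinuousAlternatingMap.alternatizeUncurryFin_apply]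
    rfl
  let S : F := ∑ σ : Equiv.Perm (Fin (N + 1)), Equiv.Perm.sign σ • T (fun i => v (σ i))
  -- Antisymmetrizing `R`, which is already alternating, multiplies it by `(N + 1)!`. Each of the `N
  -- + 1` terms of `R` contributes the same sum `S`, since the cycle that brings `i` to the front
  -- has the sign of that term.
  have hS : ((N + 1 : ℕ) : ℂ) • S = (((N + 1).factorial : ℕ) : ℂ) • R v := by
    have h1 : ∑ σ : Equiv.Perm (Fin (N + 1)), Equiv.Perm.sign σ • R (fun i => v (σ i)) =
        (((N + 1).factorial : ℕ) : ℂ) • R v := by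
      have : ∀ σ : Equiv.Perm (Fin (N + 1)), Equiv.Perm.sign σ • R (fun i => v (σ i)) = R v := by
        intro σ
        have := R.toAlternatingMap.map_perm v σ
        change R (fun i => v (σ i)) = _ at this
        rw [this, smul_smul, Int.units_mul_self, one_smul]
        rfl
      rw [Finset.sum_congr rfl fun σ _ => this σ, Finset.sum_const, Finset.card_univ,
        Fintype.card_perm, Fintype.card_fin, Nat.cast_smul_eq_nsmul]
    rw [← h1]
    have h2 : ∀ (w : Fin (N + 1) → CSpace n), R w = ∑ i : Fin (N + 1), (-1 : ℤ) ^ (i : ℕ) •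
        T (fun j => w (i.cycleRange.symm j)) := by
      intro w
      rw [hR]
      refine Finset.sum_congr rfl fun i _ => ?_
      congr 1
      simp only [T, Fin.cycleRange_symm_zero]
      congr 2
      funext j
      simp [Fin.tail, Fin.removeNth]
    simp only [h2, Finset.smul_sum]
    rw [Finset.sum_comm]
    have h3 : ∀ i : Fin (N + 1), ∑ σ : Equiv.Perm (Fin (N + 1)), Equiv.Perm.sign σ •
        ((-1 : ℤ) ^ (i : ℕ) • T (fun j => v (σ (i.cycleRange.symm j)))) = S := by
      intro i
      have h4 := sum_perm_comp T i.cycleRange.symm v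
      rw [Equiv.Perm.sign_symm, Fin.sign_cycleRange] at h4
      calc _ = (-1 : ℤ) ^ (i : ℕ) • ∑ σ : Equiv.Perm (Fin (N + 1)), Equiv.Perm.sign σ •
            T (fun j => v (σ (i.cycleRange.symm j))) := by
            rw [Finset.smul_sum]
            exact Finset.sum_congr rfl fun σ _ => smul_comm _ _ _
        _ = S := by
            rw [h4, Units.smul_def, smul_smul]
            push_cast
            rw [← mul_pow]
            simp [S]
    rw [Finset.sum_congr rfl fun i _ => h3 i, Finset.sum_const, Finset.card_univ,
      Fintype.card_fin, Nat.cast_smul_eq_nsmul]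
  have hS' : S = ((N.factorial : ℕ) : ℂ) • R v := by
    have h0 : ((N + 1 : ℕ) : ℂ) ≠ 0 := by exact_mod_cast Nat.succ_ne_zero N
    refine smul_right_injective F h0 ?_
    change ((N + 1 : ℕ) : ℂ) • S = ((N + 1 : ℕ) : ℂ) • ((N.factorial : ℕ) : ℂ) • R v
    rw [hS, smul_smul, Nat.factorial_succ, Nat.cast_mul]
  -- Moving the one-form from the last slot to the first is a rotation of `N + 1` slots, of sign
  -- `(-1)^N`.
  have h5 : ∑ σ : Equiv.Perm (Fin (N + 1)), Equiv.Perm.sign σ •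
      (L (v (σ (Fin.last N))) • η (fun i => v (σ (Fin.castSucc i)))) = (-1 : ℤ) ^ N • S := by
    have h6 := sum_perm_comp T (finRotate (N + 1)).symm v
    rw [Equiv.Perm.sign_symm, sign_finRotate, Nat.add_sub_cancel, Units.smul_def] at h6
    push_cast at h6
    rw [← h6]
    refine Finset.sum_congr rfl fun σ _ => ?_
    have e0 : (finRotate (N + 1)).symm 0 = Fin.last N := by
      rw [Equiv.symm_apply_eq, finRotate_last]
    have e1 : ∀ j : Fin N, (finRotate (N + 1)).symm j.succ = j.castSucc := fun j => by
      rw [Equiv.symm_apply_eq]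
      exact (finRotate_of_lt j.2).symm
    have e2 : Fin.tail (fun i => v (σ ((finRotate (N + 1)).symm i))) =
        fun i => v (σ (Fin.castSucc i)) := by
      funext j
      change v (σ ((finRotate (N + 1)).symm j.succ)) = _
      rw [e1]
    simp only [T, e0, e2]
  rw [wedge_apply, ← hR]
  have h7 : ∑ σ : Equiv.Perm (Fin (N + (0 + 1))), Equiv.Perm.sign σ •
      (oneForm L (fun j => v (σ (Fin.natAdd N j))) • η (fun i => v (σ (Fin.castAdd (0 + 1) i)))) =
      (-1 : ℤ) ^ N • S := h5
  rw [h7, hS']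
  rw [Nat.zero_add, Nat.factorial_one, mul_one, smul_comm]
  congr 1
  have h8 : (N.factorial : ℝ) ≠ 0 := by exact_mod_cast N.factorial_ne_zero
  rw [Nat.cast_smul_eq_nsmul, ← Nat.cast_smul_eq_nsmul ℝ, smul_smul, inv_mul_cancel₀ h8, one_smul]

/-! ### Exterior products of one-forms -/

/-- The exterior product of one-forms, as a determinant. -/
def detForm {k : ℕ} (a : Fin k → (CSpace n →L[ℝ] ℂ)) : Covec n k ℂ :=
  ContinuousMultilinearMap.alternatization
    ((ContinuousMultilinearMap.mkPiAlgebra ℝ (Fin k) ℂ).compContinuousLinearMap a)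

theorem detForm_apply {k : ℕ} (a : Fin k → (CSpace n →L[ℝ] ℂ)) (v : Fin k → CSpace n) :
    detForm a v = ∑ σ : Equiv.Perm (Fin k), Equiv.Perm.sign σ • ∏ i, a i (v (σ i)) := by
  rw [detForm, ContinuousMultilinearMap.alternatization_apply_apply]
  rfl

theorem detForm_eq_det {k : ℕ} (a : Fin k → (CSpace n →L[ℝ] ℂ)) (v : Fin k → CSpace n) :
    detForm a v = (Matrix.of fun i j => a i (v j)).det := by
  rw [detForm_apply, ← Matrix.det_transpose, Matrix.det_apply]
  rfl

/-- Expanding both determinants gives a sum over `σ` and over block permutations `τ ⊕ ρ`. For each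
of the `k! l!` blocks, the substitution `σ ↦ σ(τ ⊕ ρ)` produces the full determinant, and the
normalization of `wedge` cancels their number. -/
theorem wedge_detForm {k l : ℕ} (a : Fin k → (CSpace n →L[ℝ] ℂ)) (c : Fin l → (CSpace n →L[ℝ] ℂ)) :
    wedge (detForm a) (detForm c) = detForm (Fin.append a c) := by
  ext v
  rw [wedge_apply]
  let Q : Equiv.Perm (Fin (k + l)) → ℂ := fun σ =>
    Equiv.Perm.sign σ • ∏ i, Fin.append a c i (v (σ i))
  have h : ∀ σ : Equiv.Perm (Fin (k + l)), Equiv.Perm.sign σ •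
      (detForm c (fun j => v (σ (Fin.natAdd k j))) • detForm a (fun i => v (σ (Fin.castAdd l i)))) =
      ∑ ρ : Equiv.Perm (Fin l), ∑ τ : Equiv.Perm (Fin k),
        Q (σ * finSumFinEquiv.permCongr (Equiv.Perm.sumCongr τ ρ)) := by
    intro σ
    rw [detForm_apply, detForm_apply, smul_eq_mul, Finset.sum_mul_sum, Finset.smul_sum]
    refine Finset.sum_congr rfl fun ρ _ => ?_
    rw [Finset.smul_sum]
    refine Finset.sum_congr rfl fun τ _ => ?_
    simp only [Q]
    rw [Equiv.Perm.sign_mul, Equiv.Perm.sign_permCongr, Equiv.Perm.sign_sumCongr,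
      Fin.prod_univ_add]
    simp only [Fin.append_left, Fin.append_right, Equiv.Perm.mul_apply, Equiv.permCongr_apply,
      finSumFinEquiv_symm_apply_castAdd, finSumFinEquiv_symm_apply_natAdd,
      Equiv.Perm.sumCongr_apply, Sum.map_inl, Sum.map_inr, finSumFinEquiv_apply_left,
      finSumFinEquiv_apply_right]
    simp only [Units.smul_def, zsmul_eq_mul]
    push_cast
    ring
  rw [Finset.sum_congr rfl fun σ _ => h σ, Finset.sum_comm]
  have h2 : ∀ (ρ : Equiv.Perm (Fin l)), ∑ σ, ∑ τ : Equiv.Perm (Fin k),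
      Q (σ * finSumFinEquiv.permCongr (Equiv.Perm.sumCongr τ ρ)) =
      (k.factorial : ℂ) * detForm (Fin.append a c) v := by
    intro ρ
    rw [Finset.sum_comm]
    have : ∀ τ : Equiv.Perm (Fin k),
        ∑ σ, Q (σ * finSumFinEquiv.permCongr (Equiv.Perm.sumCongr τ ρ)) =
        detForm (Fin.append a c) v := fun τ => by
      rw [detForm_apply]
      exact Equiv.sum_comp (Equiv.mulRight (finSumFinEquiv.permCongr (Equiv.Perm.sumCongr τ ρ))) Q
    rw [Finset.sum_congr rfl fun τ _ => this τ, Finset.sum_const, Finset.card_univ,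
      Fintype.card_perm, Fintype.card_fin, nsmul_eq_mul]
  rw [Finset.sum_congr rfl fun ρ _ => h2 ρ, Finset.sum_const, Finset.card_univ,
    Fintype.card_perm, Fintype.card_fin, nsmul_eq_mul, Complex.real_smul]
  push_cast
  have h3 : (k.factorial : ℂ) ≠ 0 := by exact_mod_cast k.factorial_ne_zero
  have h4 : (l.factorial : ℂ) ≠ 0 := by exact_mod_cast l.factorial_ne_zero
  field_simp

theorem detForm_one (L : CSpace n →L[ℝ] ℂ) : oneForm L = detForm (fun _ : Fin (0 + 1) => L) := by
  ext v
  rw [detForm_apply, oneForm_apply]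
  simp [Finset.univ_unique]

end Exterior

/-! ### Conjugate-linear parts -/

section Wirtinger

variable {n : ℕ} {F : Type*} [NormedAddCommGroup F] [NormedSpace ℂ F]
  {G : Type*} [NormedAddCommGroup G] [NormedSpace ℂ G]

/-- The coordinate `dzⱼ`. -/
def dz (j : Fin n) : CSpace n →L[ℝ] ℂ :=
  (EuclideanSpace.proj j : CSpace n →L[ℂ] ℂ).restrictScalars ℝ

/-- The conjugate coordinate `dz̄ⱼ`. -/
def dzbar (j : Fin n) : CSpace n →L[ℝ] ℂ := (Complex.conjCLE : ℂ →L[ℝ] ℂ).comp (dz j)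

@[simp] theorem dz_apply (j : Fin n) (v : CSpace n) : dz j v = v j := rfl

@[simp] theorem dzbar_apply (j : Fin n) (v : CSpace n) : dzbar j v = conj (v j) := rfl

theorem conjPart_apply (L : CSpace n →L[ℝ] F) (v : CSpace n) :
    conjPart L v = (1 / 2 : ℂ) • (L v + Complex.I • L (Complex.I • v)) := rfl

theorem conjPart_add (L L' : CSpace n →L[ℝ] F) :
    conjPart (L + L') = conjPart L + conjPart L' := by
  ext v
  simp only [conjPart_apply, add_apply]
  module

theorem conjPart_smul (c : ℂ) (L : CSpace n →L[ℝ] F) : conjPart (c • L) = c • conjPart L := by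
  ext v
  simp only [conjPart_apply, smul_apply]
  module

theorem conjPart_zero : conjPart (0 : CSpace n →L[ℝ] F) = 0 := by
  ext v
  simp [conjPart_apply]

theorem conjPart_sum {ι : Type*} (s : Finset ι) (L : ι → (CSpace n →L[ℝ] F)) :
    conjPart (∑ i ∈ s, L i) = ∑ i ∈ s, conjPart (L i) :=
  map_sum (AddMonoidHom.mk' (fun L : CSpace n →L[ℝ] F => conjPart L) conjPart_add) L s

theorem conjPart_comp (T : F →L[ℂ] G) (L : CSpace n →L[ℝ] F) :
    conjPart ((T.restrictScalars ℝ).comp L) = (T.restrictScalars ℝ).comp (conjPart L) := by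
  ext v
  simp [conjPart_apply]

theorem conjPart_smulRight (L : CSpace n →L[ℝ] ℂ) (w : F) :
    conjPart (L.smulRight w) = (conjPart L).smulRight w := by
  ext v
  simp only [conjPart_apply, ContinuousLinearMap.smulRight_apply, smul_eq_mul]
  module

theorem conjPart_dz (j : Fin n) : conjPart (dz j) = 0 := by
  ext v
  simp only [conjPart_apply, dz_apply, PiLp.smul_apply, smul_eq_mul, ← mul_assoc,
    Complex.I_mul_I]
  simp

theorem conjPart_dzbar (j : Fin n) : conjPart (dzbar j) = dzbar j := by
  ext v
  simp only [conjPart_apply, dzbar_apply, PiLp.smul_apply, smul_eq_mul, map_mul, Complex.conj_I,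
    ← mul_assoc, mul_neg, Complex.I_mul_I]
  ring

theorem conjPart_I_smul (L : CSpace n →L[ℝ] F) (v : CSpace n) :
    conjPart L (Complex.I • v) = -Complex.I • conjPart L v := by
  simp only [conjPart_apply, smul_smul, Complex.I_mul_I]
  rw [neg_one_smul, map_neg, smul_add, smul_add, smul_smul, smul_smul]
  have h : -Complex.I * (1 / 2) * Complex.I = 1 / 2 := by
    linear_combination (-1 / 2 : ℂ) * Complex.I_mul_I
  rw [h, smul_neg]
  module

theorem conjPart_smul_right (L : CSpace n →L[ℝ] F) (c : ℂ) (v : CSpace n) :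
    conjPart L (c • v) = conj c • conjPart L v := by
  conv_lhs => rw [← Complex.re_add_im c, add_smul, mul_smul, map_add, Complex.coe_smul,
    Complex.coe_smul, map_smul, map_smul, conjPart_I_smul]
  rw [← Complex.coe_smul, ← Complex.coe_smul, smul_smul, ← add_smul]
  congr 1
  apply Complex.ext <;> simp

/-- The standard basis vector of `ℂⁿ`. -/
abbrev eC (j : Fin n) : CSpace n := EuclideanSpace.single j 1

theorem eq_sum_eC (v : CSpace n) : v = ∑ k, v k • eC k := by
  ext j
  simp [eC, Pi.single_apply]

theorem conjPart_eq_sum (L : CSpace n →L[ℝ] F) (v : CSpace n) :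
    conjPart L v = ∑ k, dzbar k v • conjPart L (eC k) := by
  conv_lhs => rw [eq_sum_eC v, map_sum]
  exact Finset.sum_congr rfl fun k _ => conjPart_smul_right L _ _

theorem dbar_eq {k : ℕ} {η : CSpace n → Covec n k F} {η' : CSpace n →L[ℝ] Covec n k F}
    {ζ : CSpace n} (h : HasFDerivAt η η' ζ) :
    dbar η ζ = ContinuousAlternatingMap.alternatizeUncurryFin (conjPart η') := by
  rw [dbar, h.fderiv]

/-- `|z|²` as a complex number. -/
def nsq (z : CSpace n) : ℂ := ∑ k, dzbar k z * dz k z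

theorem nsq_eq (z : CSpace n) : nsq z = (‖z‖ : ℂ) ^ 2 := by
  rw [nsq, ← Complex.ofReal_pow, EuclideanSpace.norm_sq_eq, Complex.ofReal_sum]
  refine Finset.sum_congr rfl fun k _ => ?_
  rw [dzbar_apply, dz_apply, Complex.conj_mul', Complex.ofReal_pow]

theorem nsq_eq_ofReal (z : CSpace n) : nsq z = ((‖z‖ ^ 2 : ℝ) : ℂ) := by
  rw [nsq_eq, Complex.ofReal_pow]

theorem nsq_ne_zero {z : CSpace n} (hz : z ≠ 0) : nsq z ≠ 0 := by
  rw [nsq_eq]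
  simpa using hz

/-- The derivative of `|z|²`. -/
def nsqDeriv (z : CSpace n) : CSpace n →L[ℝ] ℂ :=
  ∑ k, (dzbar k z • dz k + dz k z • dzbar k)

theorem hasFDerivAt_nsq (z : CSpace n) : HasFDerivAt nsq (nsqDeriv z) z := by
  unfold nsq nsqDeriv
  exact HasFDerivAt.fun_sum fun k _ => (dzbar k).hasFDerivAt.mul (dz k).hasFDerivAt

theorem contDiff_nsq : ContDiff ℝ ∞ (nsq : CSpace n → ℂ) := by
  unfold nsq
  fun_prop

theorem conjPart_nsqDeriv (z : CSpace n) :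
    conjPart (nsqDeriv z) = ∑ k, dz k z • dzbar k := by
  rw [nsqDeriv, conjPart_sum]
  refine Finset.sum_congr rfl fun k _ => ?_
  rw [conjPart_add, conjPart_smul, conjPart_smul, conjPart_dz, conjPart_dzbar, smul_zero, zero_add]

/-- The one-form `∑ z̄ⱼ dzⱼ`. -/
def radForm (z : CSpace n) : CSpace n →L[ℝ] ℂ := ∑ k, dzbar k z • dz k

theorem radForm_eq (z : CSpace n) : radForm z = (innerSL ℂ z).restrictScalars ℝ := by
  ext v
  simp only [radForm, sum_apply, smul_apply, dz_apply,
    dzbar_apply, smul_eq_mul, ContinuousLinearMap.coe_restrictScalars', innerSL_apply_apply,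
    PiLp.inner_apply, RCLike.inner_apply]
  exact Finset.sum_congr rfl fun k _ => mul_comm _ _

/-- The scalar factor of the form `b`. -/
def bCoef (z : CSpace n) : ℂ := (2 * Real.pi * Complex.I * nsq z)⁻¹

theorem bForm_eq (z : CSpace n) : bForm n z = bCoef z • oneForm (radForm z) := by
  ext v
  rw [bForm, bCoef, nsq_eq, radForm_eq]
  rfl

theorem bForm_eq_sum (z : CSpace n) :
    bForm n z = ∑ j, (bCoef z * dzbar j z) • oneForm (dz j) := by
  rw [bForm_eq]
  ext v
  simp only [ContinuousAlternatingMap.smul_apply, oneForm_apply, radForm,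
    sum_apply, smul_apply, ContinuousAlternatingMap.sum_apply,
    Finset.smul_sum, mul_smul]

/-- The radial conjugate-linear form in `∂̄b`. -/
def bNone (z : CSpace n) : CSpace n →L[ℝ] ℂ := -(nsq z)⁻¹ • ∑ k, dz k z • dzbar k

/-- Product rule for `|z|^{-2} z̄ⱼ`: the indices `some i` carry `dz̄ᵢ ∧ dzᵢ`, and `none` carries the
term in which `|z|^{-2}` is differentiated, a product with the radial form `∑ z̄ⱼ dzⱼ`. -/
theorem dbar_bForm {z : CSpace n} (hz : z ≠ 0) :
    dbar (bForm n) z = bCoef z • ∑ i : Option (Fin n),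
      detForm ![i.elim (bNone z) dzbar, i.elim (radForm z) dz] := by
  have h0 := nsq_ne_zero hz
  have hc : HasFDerivAt bCoef (-(bCoef z * (nsq z)⁻¹) • nsqDeriv z) z := by
    have h1 : HasFDerivAt (fun z : CSpace n => (2 * Real.pi * Complex.I)⁻¹ * (nsq z)⁻¹) _ z :=
      (((hasFDerivAt_inv' (𝕜 := ℝ) h0).comp z (hasFDerivAt_nsq z))).const_mul _
    have hb : (bCoef : CSpace n → ℂ) = fun z => (2 * Real.pi * Complex.I)⁻¹ * (nsq z)⁻¹ := by
      funext w
      rw [bCoef, mul_inv]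
    rw [hb]
    refine h1.congr_fderiv ?_
    ext v
    change (2 * Real.pi * Complex.I)⁻¹ * (-((nsq z)⁻¹ * nsqDeriv z v * (nsq z)⁻¹)) =
      -((2 * Real.pi * Complex.I)⁻¹ * (nsq z)⁻¹ * (nsq z)⁻¹) * nsqDeriv z v
    ring
  have h2 : HasFDerivAt (bForm n) (∑ j : Fin n, (bCoef z • dzbar j +
      dzbar j z • (-(bCoef z * (nsq z)⁻¹) • nsqDeriv z)).smulRight (oneForm (dz j))) z := by
    rw [show bForm n = fun z => ∑ j, (bCoef z * dzbar j z) • oneForm (dz j) from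
      funext bForm_eq_sum]
    exact HasFDerivAt.fun_sum fun j _ => (hc.mul (dzbar j).hasFDerivAt).smul_const _
  rw [dbar_eq h2, conjPart_sum]
  have h3 : ∀ j : Fin n, conjPart ((bCoef z • dzbar j +
      dzbar j z • (-(bCoef z * (nsq z)⁻¹) • nsqDeriv z)).smulRight (oneForm (dz j))) =
      (bCoef z • (dzbar j + dzbar j z • bNone z)).smulRight (oneForm (dz j)) := by
    intro j
    rw [conjPart_smulRight, conjPart_add, conjPart_smul, conjPart_smul, conjPart_smul,
      conjPart_dzbar, conjPart_nsqDeriv, bNone]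
    congr 1
    module
  simp only [h3]
  ext v
  rw [ContinuousAlternatingMap.alternatizeUncurryFin_apply]
  refine (Fin.sum_univ_two _).trans ?_
  simp only [sum_apply, ContinuousLinearMap.smulRight_apply,
    ContinuousAlternatingMap.sum_apply, ContinuousAlternatingMap.smul_apply, oneForm_apply,
    Fintype.sum_option, detForm_eq_det, Matrix.det_fin_two, Option.elim, Matrix.of_apply,
    Matrix.cons_val_zero, Matrix.cons_val_one, smul_apply,
    add_apply, ContinuousAlternatingMap.add_apply]
  have e0 : (0 : Fin 2).removeNth v 0 = v 1 := rfl
  have e1 : (1 : Fin 2).removeNth v 0 = v 0 := rfl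
  rw [e0, e1]
  simp only [radForm, sum_apply, smul_apply, smul_eq_mul,
    Fin.val_zero, pow_zero, one_smul, Fin.val_one, pow_one, neg_smul, Finset.mul_sum, mul_add,
    mul_sub, Finset.sum_add_distrib, Finset.sum_sub_distrib, add_mul]
  have a1 : ∀ a b : CSpace n, ∑ x : Fin n, bCoef z * (dzbar x z * bNone z a) * dz x b =
      ∑ x : Fin n, bCoef z * (bNone z a * (dzbar x z * dz x b)) := fun a b =>
    Finset.sum_congr rfl fun x _ => by ring
  have a2 : ∀ a b : CSpace n, ∑ x : Fin n, bCoef z * dzbar x a * dz x b =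
      ∑ x : Fin n, bCoef z * (dzbar x a * dz x b) := fun a b =>
    Finset.sum_congr rfl fun x _ => by ring
  have a3 : ∀ a b : CSpace n, ∑ x : Fin n, bCoef z * (bNone z a * (dzbar x z * dz x b)) =
      bCoef z * bNone z a * ∑ x : Fin n, dzbar x z * dz x b := fun a b => by
    rw [Finset.mul_sum]
    exact Finset.sum_congr rfl fun x _ => by ring
  have a4 : ∀ a b : CSpace n, ∑ x : Fin n, bCoef z * (dzbar x a * dz x b) =
      bCoef z * ∑ x : Fin n, dzbar x a * dz x b := fun a b => by
    rw [Finset.mul_sum]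
  simp only [a1, a2, a3, a4]
  ring

/-- The rows `p_{J 0}, q_{J 0}, p_{J 1}, q_{J 1}, …`. -/
def pairRows {ι α : Type*} {k : ℕ} (p q : ι → α) (J : Fin k → ι) (r : Fin (2 * k)) : α :=
  if (r : ℕ) % 2 = 0 then p (J ⟨r / 2, by omega⟩) else q (J ⟨r / 2, by omega⟩)

theorem append_pairRows {ι α : Type*} {k : ℕ} (p q : ι → α) (J : Fin k → ι) (i : ι) :
    (Fin.append (pairRows p q J) ![p i, q i] : Fin (2 * k + 2) → α) =
      pairRows (k := k + 1) p q (Fin.snoc J i) := by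
  funext r
  induction r using Fin.addCases with
  | left r =>
    rw [Fin.append_left]
    have h : (⟨(r : ℕ) / 2, by omega⟩ : Fin (k + 1)) = Fin.castSucc ⟨(r : ℕ) / 2, by omega⟩ := rfl
    simp only [pairRows, Fin.val_castAdd]
    rw [h, Fin.snoc_castSucc (α := fun _ => ι)]
  | right r =>
    rw [Fin.append_right]
    have h : ∀ h', (⟨(2 * k + (r : ℕ)) / 2, h'⟩ : Fin (k + 1)) = Fin.last k := fun h' => by
      ext
      have := r.2
      simp only [Fin.val_last]
      omega
    simp only [pairRows, Fin.val_natAdd]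
    rw [h, Fin.snoc_last (α := fun _ => ι)]
    fin_cases r <;> simp

/-- The power of a sum of two-forms is expanded over all choices `J` of one summand per factor. -/
theorem dbarPow_eq {z : CSpace n} (hz : z ≠ 0) (k : ℕ) :
    dbarPow n k z = bCoef z ^ k • ∑ J : Fin k → Option (Fin n),
      detForm (pairRows (fun i => i.elim (bNone z) dzbar) (fun i => i.elim (radForm z) dz) J) := by
  induction k with
  | zero =>
    ext v
    rw [Fintype.sum_unique, pow_zero, one_smul, detForm_apply]
    change (1 : ℂ) = ∑ σ : Equiv.Perm (Fin 0), _ • ∏ i : Fin 0, _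
    simp
  | succ k ih =>
    change wedge (dbarPow n k z) (dbar (bForm n) z) = _
    rw [ih, dbar_bForm hz, wedge_smul_left, wedge_smul_right, smul_smul, ← pow_succ,
      wedge_sum_left]
    congr 1
    rw [← Equiv.sum_comp (Fin.snocEquiv fun _ => Option (Fin n)), Fintype.sum_prod_type,
      Finset.sum_comm]
    refine Finset.sum_congr rfl fun J _ => ?_
    rw [wedge_sum_right]
    refine Finset.sum_congr rfl fun i _ => ?_
    rw [wedge_detForm]
    exact congrArg detForm (append_pairRows (fun i : Option (Fin n) => i.elim (bNone z) dzbar)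
      (fun i => i.elim (radForm z) dz) J i)

theorem detForm_eq_zero {k : ℕ} (a : Fin k → (CSpace n →L[ℝ] ℂ)) {i j : Fin k} (hij : i ≠ j)
    (h : a i = a j) : detForm a = 0 := by
  ext v
  rw [detForm_eq_det]
  refine Matrix.det_zero_of_row_eq hij ?_
  funext l
  simp [h]

/-- The constant forms `dzⱼ ∧ (∑ dz̄ᵢ ∧ dzᵢ)ⁿ⁻¹`. -/
def bmBasis (n : ℕ) (j : Fin n) : Covec n (1 + 2 * (n - 1)) ℂ :=
  ∑ J : Fin (n - 1) → Fin n, detForm (Fin.append (fun _ : Fin 1 => dz j) (pairRows dzbar dz J))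

/-- The coefficients `z̄ⱼ / |z|²ⁿ` of the Bochner–Martinelli kernel. -/
def bmKer (j : Fin n) (z : CSpace n) : ℂ := dzbar j z * ((nsq z)⁻¹) ^ n

theorem oneForm_sum_smul {ι : Type*} (s : Finset ι) (c : ι → ℂ) (L : ι → (CSpace n →L[ℝ] ℂ)) :
    oneForm (∑ i ∈ s, c i • L i) = ∑ i ∈ s, c i • oneForm (L i) := by
  ext v
  simp [oneForm_apply]

/-- The form `b` is itself a multiple of the radial form. Every choice `J` that contains `none`
repeats this row and vanishes, so only `∑ dz̄ᵢ ∧ dzᵢ` survives from `∂̄b`. -/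
theorem bmForm_eq (hn : 1 ≤ n) (z : CSpace n) :
    bmForm n z = ((2 * Real.pi * Complex.I)⁻¹) ^ n • ∑ j, bmKer j z • bmBasis n j := by
  -- At the origin both sides are zero because the inverse of zero is zero; the formula thus holds
  -- without exception.
  by_cases hz : z = 0
  · subst hz
    have h1 : bForm n 0 = (0 : ℂ) • bForm n 0 := by
      rw [bForm_eq, bCoef, nsq_eq]
      simp
    have h2 : ∀ j : Fin n, bmKer j 0 = 0 := fun j => by simp [bmKer]
    rw [bmForm, h1, wedge_smul_left]
    simp [h2]
  obtain ⟨m, rfl⟩ : ∃ m, n = m + 1 := ⟨n - 1, by omega⟩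
  have h1 : bmForm (m + 1) z = bCoef z ^ (m + 1) • ∑ J : Fin m → Option (Fin (m + 1)),
      detForm (Fin.append (fun _ : Fin 1 => radForm z) (pairRows
        (fun i : Option (Fin (m + 1)) => i.elim (bNone z) dzbar)
        (fun i => i.elim (radForm z) dz) J)) := by
    change wedge (bForm (m + 1) z) (dbarPow (m + 1) m z) = _
    rw [dbarPow_eq hz, bForm_eq, wedge_smul_left, wedge_smul_right, smul_smul, ← pow_succ',
      detForm_one, wedge_sum_right]
    congr 1
    refine Finset.sum_congr rfl fun J _ => ?_
    exact wedge_detForm _ _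
  have h2 : ∑ J : Fin m → Option (Fin (m + 1)),
      detForm (Fin.append (fun _ : Fin 1 => radForm z) (pairRows
        (fun i : Option (Fin (m + 1)) => i.elim (bNone z) dzbar)
        (fun i => i.elim (radForm z) dz) J)) =
      ∑ J : Fin m → Fin (m + 1),
        detForm (Fin.append (fun _ : Fin 1 => radForm z) (pairRows dzbar dz J)) := by
    symm
    refine Fintype.sum_of_injective (fun J i => some (J i)) (fun J J' h => ?_) _ _ ?_ ?_
    · funext i
      exact Option.some_injective _ (congrFun h i)
    · intro J hJ
      obtain ⟨i, hi⟩ : ∃ i, J i = none := by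
        by_contra hcon
        push Not at hcon
        refine hJ ⟨fun i => (J i).get (Option.isSome_iff_ne_none.2 (hcon i)), ?_⟩
        funext i
        simp
      refine detForm_eq_zero _ (i := Fin.castAdd (2 * m) 0)
        (j := Fin.natAdd 1 ⟨2 * i + 1, by omega⟩) ?_ ?_
      · intro h
        have := congrArg Fin.val h
        simp at this
      · rw [Fin.append_left, Fin.append_right]
        have e : (2 * (i : ℕ) + 1) / 2 = i := by omega
        have e' : (2 * (i : ℕ) + 1) % 2 = 1 := by omega
        simp [pairRows, e, e', hi]
    · intro J
      rfl
  have h3 : ∀ J : Fin m → Fin (m + 1),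
      detForm (Fin.append (fun _ : Fin 1 => radForm z) (pairRows dzbar dz J)) =
      ∑ j, dzbar j z •
        detForm (Fin.append (fun _ : Fin 1 => dz j) (pairRows dzbar dz J)) := by
    intro J
    have e : ∀ L : CSpace (m + 1) →L[ℝ] ℂ,
        detForm (Fin.append (fun _ : Fin 1 => L) (pairRows dzbar dz J)) =
        wedge (k := 1) (oneForm L) (detForm (pairRows dzbar dz J)) := fun L => by
      rw [detForm_one]
      exact (wedge_detForm _ _).symm
    simp only [e]
    rw [radForm, oneForm_sum_smul, wedge_sum_left]
    exact Finset.sum_congr rfl fun j _ => wedge_smul_left _ _ _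
  rw [h1, h2]
  simp only [h3]
  rw [Finset.sum_comm]
  rw [show bCoef z ^ (m + 1) = ((2 * Real.pi * Complex.I)⁻¹) ^ (m + 1) * ((nsq z)⁻¹) ^ (m + 1) by
    rw [bCoef, mul_inv, mul_pow], mul_smul]
  congr 1
  rw [Finset.smul_sum]
  refine Finset.sum_congr rfl fun j _ => ?_
  rw [← Finset.smul_sum, smul_smul, bmKer, mul_comm (dzbar j z)]
  rfl

end Wirtinger

/-! ### Top-degree pairings of the Bochner–Martinelli basis -/

section Pairing

/-- The matrix of a self-map of `Fin k`. -/
def selMat {k : ℕ} (a : Fin k → Fin k) : Matrix (Fin k) (Fin k) ℂ :=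
  Matrix.of fun l c => if a l = c then 1 else 0

theorem det_selMat_eq_zero {k : ℕ} {a : Fin k → Fin k} (h : ¬ Function.Injective a) :
    (selMat a).det = 0 := by
  simp only [Function.Injective, not_forall] at h
  obtain ⟨i, j, hij, hne⟩ := h
  refine Matrix.det_zero_of_row_eq hne ?_
  funext c
  simp [selMat, hij]

theorem det_selMat_sq {k : ℕ} {a : Fin k → Fin k} (h : Function.Injective a) :
    (selMat a).det * (selMat a).det = 1 := by
  let σ : Equiv.Perm (Fin k) := Equiv.ofBijective a (Finite.injective_iff_bijective.1 h)
  have e : selMat a = (1 : Matrix (Fin k) (Fin k) ℂ).submatrix σ id := by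
    ext i j
    simp [selMat, Matrix.one_apply, σ]
  rw [e, Matrix.det_permute, Matrix.det_one, mul_one]
  norm_cast
  rw [Int.units_mul_self]
  rfl

/-- If both maps were injective they would be permutations. The one starting with `j ≠ k` would then
take the value `k` among the entries of `J`, which contradicts injectivity of the other. -/
theorem sum_det_selMat_of_ne {m : ℕ} {j k : Fin (m + 1)} (hjk : j ≠ k) (J : Fin m → Fin (m + 1)) :
    (selMat (Fin.cons k J)).det * (selMat (Fin.cons j J)).det = 0 := by
  by_cases h1 : Function.Injective (Fin.cons k J : Fin (m + 1) → Fin (m + 1))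
  · by_cases h2 : Function.Injective (Fin.cons j J : Fin (m + 1) → Fin (m + 1))
    · exfalso
      obtain ⟨i, hi⟩ := Finite.injective_iff_surjective.1 h2 k
      induction i using Fin.cases with
      | zero => exact hjk hi
      | succ i => exact (Fin.cons_injective_iff.1 h1).1 ⟨i, hi⟩
    · rw [det_selMat_eq_zero h2, mul_zero]
  · rw [det_selMat_eq_zero h1, zero_mul]

/-- Each injective completion of `j` contributes the square of a sign, and these completions are the
`m!` embeddings into the complement of `j`. -/
theorem sum_det_selMat_self {m : ℕ} (j : Fin (m + 1)) :
    ∑ J : Fin m → Fin (m + 1), (selMat (Fin.cons j J)).det * (selMat (Fin.cons j J)).det =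
      m.factorial := by
  classical
  have h1 : ∀ J : Fin m → Fin (m + 1),
      (selMat (Fin.cons j J)).det * (selMat (Fin.cons j J)).det =
        if Function.Injective (Fin.cons j J : Fin (m + 1) → Fin (m + 1)) then (1 : ℂ) else 0 := by
    intro J
    split_ifs with h
    · exact det_selMat_sq h
    · rw [det_selMat_eq_zero h, zero_mul]
  rw [Finset.sum_congr rfl fun J _ => h1 J, Finset.sum_boole]
  congr 1
  rw [← Fintype.card_subtype]
  have e : {J : Fin m → Fin (m + 1) //
      Function.Injective (Fin.cons j J : Fin (m + 1) → Fin (m + 1))} ≃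
      (Fin m ↪ {i : Fin (m + 1) // i ≠ j}) :=
    { toFun := fun J => ⟨fun i => ⟨J.1 i, fun h => (Fin.cons_injective_iff.1 J.2).1 ⟨i, h⟩⟩,
        fun a b hab => (Fin.cons_injective_iff.1 J.2).2 (congrArg Subtype.val hab)⟩
      invFun := fun f => ⟨fun i => (f i).1, Fin.cons_injective_iff.2
        ⟨fun ⟨i, hi⟩ => (f i).2 hi, fun a b hab => f.injective (Subtype.ext hab)⟩⟩
      left_inv := fun J => rfl
      right_inv := fun f => rfl }
  rw [Fintype.card_congr e, Fintype.card_embedding_eq, Fintype.card_fin]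
  have : Fintype.card {i : Fin (m + 1) // i ≠ j} = m := by
    rw [Fintype.card_subtype_compl, Fintype.card_fin, Fintype.card_subtype_eq, Nat.add_sub_cancel]
  rw [this, Nat.descFactorial_self]

theorem dz_frame {n N : ℕ} (l : Fin n) (c : Fin N) :
    dz l (frame n N c) =
      if (l : ℕ) = (c : ℕ) / 2 then (if (c : ℕ) % 2 = 0 then 1 else Complex.I) else 0 := rfl

theorem dzbar_frame {n N : ℕ} (l : Fin n) (c : Fin N) :
    dzbar l (frame n N c) =
      if (l : ℕ) = (c : ℕ) / 2 then (if (c : ℕ) % 2 = 0 then 1 else -Complex.I) else 0 := by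
  change conj (dz l (frame n N c)) = _
  rw [dz_frame]
  split_ifs <;> simp

/-- The enumeration of rows and columns by pairs. -/
def pairEquiv (m : ℕ) : Fin (m + 1) × Fin 2 ≃ Fin (1 + 2 * m + 1) :=
  finProdFinEquiv.trans (finCongr (by ring))

theorem pairEquiv_val (m : ℕ) (x : Fin (m + 1) × Fin 2) :
    (pairEquiv m x : ℕ) = x.2 + 2 * x.1 := rfl

theorem finRotate_symm_succ {N : ℕ} (j : Fin N) : (finRotate (N + 1)).symm j.succ = j.castSucc := by
  rw [Equiv.symm_apply_eq]
  exact (finRotate_of_lt j.2).symm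

/-- After the last row is rotated to the front, the rows come in pairs `(dz̄, dz)` and the frame in
pairs `(e, ie)`. The matrix is then a block matrix of two selection matrices times `1 ⊗ Q`, where
`Q` has determinant `2i`. -/
theorem detForm_frame {m : ℕ} (j k : Fin (m + 1)) (J : Fin m → Fin (m + 1)) :
    detForm (Fin.append (Fin.append (fun _ : Fin 1 => dz j) (pairRows dzbar dz J))
      (fun _ : Fin (0 + 1) => dzbar k)) (frame (m + 1) (1 + 2 * m + (0 + 1))) =
      -((2 * Complex.I) ^ (m + 1) *
        ((selMat (Fin.cons k J)).det * (selMat (Fin.cons j J)).det)) := by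
  rw [detForm_eq_det]
  set R : Fin (1 + 2 * m + 1) → (CSpace (m + 1) →L[ℝ] ℂ) :=
    Fin.append (Fin.append (fun _ : Fin 1 => dz j) (pairRows dzbar dz J))
      (fun _ : Fin (0 + 1) => dzbar k) with hR
  let M : Matrix (Fin (1 + 2 * m + 1)) (Fin (1 + 2 * m + 1)) ℂ :=
    Matrix.of fun i l => R i (frame (m + 1) (1 + 2 * m + 1) l)
  change M.det = _
  -- The rotation is a cycle of even length `2m + 2`, hence odd; this is the source of the minus
  -- sign.
  let ρ : Equiv.Perm (Fin (1 + 2 * m + 1)) := (finRotate (1 + 2 * m + 1)).symm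
  have hrow : ∀ (l : Fin (m + 1)) (s : Fin 2), R (ρ (pairEquiv m (l, s))) =
      if s = 0 then dzbar ((Fin.cons k J : Fin (m + 1) → Fin (m + 1)) l)
        else dz ((Fin.cons j J : Fin (m + 1) → Fin (m + 1)) l) := by
    intro l s
    induction l using Fin.cases with
    | zero =>
      fin_cases s
      · have h1 : pairEquiv m (0, 0) = 0 := by
          ext
          rw [pairEquiv_val]
          rfl
        have h2 : ρ 0 = Fin.natAdd (1 + 2 * m) (0 : Fin (0 + 1)) := by
          change (finRotate (1 + 2 * m + 1)).symm 0 = _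
          rw [Equiv.symm_apply_eq]
          exact finRotate_last.symm
        simp only [Fin.zero_eta, h1, h2, if_true, hR]
        rw [Fin.append_right]
        rfl
      · have h1 : pairEquiv m (0, 1) = Fin.succ (Fin.castAdd (2 * m) (0 : Fin 1)) := by
          ext
          rw [pairEquiv_val]
          simp
        have h2 : ρ (Fin.succ (Fin.castAdd (2 * m) (0 : Fin 1))) =
            Fin.castAdd (0 + 1) (Fin.castAdd (2 * m) (0 : Fin 1)) := finRotate_symm_succ _
        simp only [Fin.mk_one, h1, h2, hR]
        rw [Fin.append_left, Fin.append_left]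
        rfl
    | succ l =>
      have h1 : pairEquiv m (l.succ, s) =
          Fin.succ (Fin.natAdd 1 (⟨(s : ℕ) + 2 * (l : ℕ), by omega⟩ : Fin (2 * m))) := by
        ext
        rw [pairEquiv_val]
        simp only [Fin.val_succ, Fin.val_natAdd]
        omega
      have h2 : ρ (Fin.succ (Fin.natAdd 1 (⟨(s : ℕ) + 2 * (l : ℕ), by omega⟩ : Fin (2 * m)))) =
          Fin.castAdd (0 + 1) (Fin.natAdd 1
            (⟨(s : ℕ) + 2 * (l : ℕ), by omega⟩ : Fin (2 * m))) := finRotate_symm_succ _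
      rw [h1, h2, hR, Fin.append_left, Fin.append_right]
      have h3 : ((s : ℕ) + 2 * (l : ℕ)) / 2 = l := by omega
      have h4 : ((s : ℕ) + 2 * (l : ℕ)) % 2 = s := by omega
      simp only [pairRows, h3, h4, Fin.eta, Fin.cons_succ, Fin.val_eq_zero_iff]
  let Q : Matrix (Fin 2) (Fin 2) ℂ := !![1, -Complex.I; 1, Complex.I]
  let P : Fin 2 → Matrix (Fin (m + 1)) (Fin (m + 1)) ℂ :=
    ![selMat (Fin.cons k J), selMat (Fin.cons j J)]
  have hM : (M.submatrix ρ id).submatrix (pairEquiv m) (pairEquiv m) =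
      Matrix.blockDiagonal P *
        Matrix.kroneckerMap (fun x y => x * y) (1 : Matrix (Fin (m + 1)) (Fin (m + 1)) ℂ) Q := by
    ext ⟨l, s⟩ ⟨l', s'⟩
    have hl : (Matrix.blockDiagonal P *
        Matrix.kroneckerMap (fun x y => x * y) (1 : Matrix (Fin (m + 1)) (Fin (m + 1)) ℂ) Q)
        (l, s) (l', s') = P s l l' * Q s s' := by
      rw [Matrix.mul_apply, Fintype.sum_prod_type, Finset.sum_eq_single l',
        Finset.sum_eq_single s]
      · simp [Matrix.blockDiagonal_apply]
      · intro t _ ht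
        simp [Matrix.blockDiagonal_apply, ht.symm]
      · simp
      · intro x _ hx
        refine Finset.sum_eq_zero fun t _ => ?_
        simp [Matrix.one_apply_ne hx]
      · simp
    rw [hl]
    change R (ρ (pairEquiv m (l, s))) (frame (m + 1) (1 + 2 * m + 1) (pairEquiv m (l', s'))) = _
    rw [hrow]
    have h3 : ((pairEquiv m (l', s') : Fin _) : ℕ) / 2 = l' := by
      rw [pairEquiv_val]
      have := s'.2
      change ((s' : ℕ) + 2 * (l' : ℕ)) / 2 = l'
      omega
    have h4 : ((pairEquiv m (l', s') : Fin _) : ℕ) % 2 = s' := by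
      rw [pairEquiv_val]
      have := s'.2
      change ((s' : ℕ) + 2 * (l' : ℕ)) % 2 = s'
      omega
    fin_cases s
    · simp only [Fin.zero_eta, if_true, dzbar_frame, h3, h4, Fin.val_inj]
      fin_cases s' <;> simp [P, Q, selMat] <;> split_ifs <;> simp
    · simp only [Fin.mk_one, one_ne_zero, if_false, dz_frame, h3, h4, Fin.val_inj]
      fin_cases s' <;> simp [P, Q, selMat]
  have hdet := congrArg Matrix.det hM
  rw [Matrix.det_submatrix_equiv_self, Matrix.det_permute, Matrix.det_mul,
    Matrix.det_blockDiagonal, Matrix.det_kronecker, Matrix.det_one, one_pow, one_mul,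
    Fintype.card_fin, Fin.prod_univ_two, Equiv.Perm.sign_symm, sign_finRotate] at hdet
  have hQ : Q.det = 2 * Complex.I := by
    rw [Matrix.det_fin_two]
    simp only [Q, Matrix.of_apply, Matrix.cons_val', Matrix.cons_val_zero, Matrix.cons_val_one,
      Matrix.cons_val_fin_one]
    ring
  rw [hQ] at hdet
  have hs : ((-1 : ℤˣ) ^ (1 + 2 * m + 1 - 1)) = -1 := by
    rw [Nat.add_sub_cancel]
    exact Odd.neg_one_pow ⟨m, by ring⟩
  rw [hs] at hdet
  simp only [P, Matrix.cons_val_zero, Matrix.cons_val_one] at hdet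
  push_cast at hdet
  linear_combination (-1 : ℂ) * hdet

variable {n : ℕ} {F : Type*} [NormedAddCommGroup F] [NormedSpace ℂ F]

/-- The constant in the pairing of the Bochner–Martinelli basis with the `dz̄ⱼ`. -/
def bmScale (n : ℕ) : ℂ := (n - 1).factorial * (2 * Complex.I) ^ n

theorem bmScale_ne_zero (n : ℕ) : bmScale n ≠ 0 := by
  rw [bmScale]
  have : ((n - 1).factorial : ℂ) ≠ 0 := by exact_mod_cast Nat.factorial_ne_zero _
  simp [this]

/-- Duality of the constant forms with the `dz̄ₖ`. It turns wedge products with `∂̄u`, and `∂̄` of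
such forms, into sums of `∂/∂z̄ⱼ`. -/
theorem wedge_bmBasis_dzbar (j k : Fin n) :
    wedge (bmBasis n j) (oneForm (dzbar k)) (frame n (1 + 2 * (n - 1) + (0 + 1))) =
      if j = k then -bmScale n else 0 := by
  obtain ⟨m, rfl⟩ : ∃ m, n = m + 1 := ⟨n - 1, by have := j.2; omega⟩
  have h1 : wedge (bmBasis (m + 1) j) (oneForm (dzbar k))
      (frame (m + 1) (1 + 2 * m + (0 + 1))) = ∑ J : Fin m → Fin (m + 1),
      -((2 * Complex.I) ^ (m + 1) *
        ((selMat (Fin.cons k J)).det * (selMat (Fin.cons j J)).det)) := by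
    rw [bmBasis, wedge_sum_left, ContinuousAlternatingMap.sum_apply]
    refine Finset.sum_congr rfl fun J _ => ?_
    rw [detForm_one, wedge_detForm]
    exact detForm_frame j k J
  refine h1.trans ?_
  rw [Finset.sum_neg_distrib, ← Finset.mul_sum]
  split_ifs with h
  · subst h
    rw [sum_det_selMat_self, bmScale, Nat.add_sub_cancel, mul_comm]
  · rw [Finset.sum_eq_zero fun J _ => sum_det_selMat_of_ne h J]
    simp

theorem odd_degree (n : ℕ) : (-1 : ℤ) ^ (1 + 2 * (n - 1)) = -1 :=
  Odd.neg_one_pow ⟨n - 1, by ring⟩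

/-- The form `∑ gⱼ Eⱼ` with coefficients `gⱼ` in the Bochner–Martinelli basis. -/
def bmComb (g : Fin n → F) : Covec n (1 + 2 * (n - 1)) F :=
  ∑ j, tensCovec (bmBasis n j) (g j)

theorem bmComb_apply (g : Fin n → F) (v : Fin (1 + 2 * (n - 1)) → CSpace n) :
    bmComb g v = ∑ j, bmBasis n j v • g j := by
  rw [bmComb, ContinuousAlternatingMap.sum_apply]
  rfl

/-- The pairing of a one-form with a basis form. -/
def bmPair (j : Fin n) (θ : Covec n (0 + 1) ℂ) : ℂ :=
  wedge (bmBasis n j) θ (frame n (1 + 2 * (n - 1) + (0 + 1)))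

theorem wedge_bmComb (g : Fin n → F) (θ : Covec n (0 + 1) ℂ) :
    wedge (bmComb g) θ (frame n (1 + 2 * (n - 1) + (0 + 1))) = ∑ j, bmPair j θ • g j := by
  rw [bmComb, wedge_sum_left, ContinuousAlternatingMap.sum_apply]
  exact Finset.sum_congr rfl fun j _ => wedge_tensCovec _ _ _ _

theorem bmPair_conjPart (j : Fin n) (L : CSpace n →L[ℝ] ℂ) :
    bmPair j (oneForm (conjPart L)) = -bmScale n * conjPart L (eC j) := by
  have h : conjPart L = ∑ k, conjPart L (eC k) • dzbar k := by
    ext v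
    rw [conjPart_eq_sum]
    simp [sum_apply, smul_apply, mul_comm]
  rw [bmPair, h, oneForm_sum_smul, wedge_sum_right, ContinuousAlternatingMap.sum_apply,
    Finset.sum_eq_single j]
  · rw [wedge_smul_right, ContinuousAlternatingMap.smul_apply, wedge_bmBasis_dzbar, if_pos rfl,
      smul_eq_mul, mul_comm, ← h]
  · intro k _ hk
    rw [wedge_smul_right, ContinuousAlternatingMap.smul_apply, wedge_bmBasis_dzbar,
      if_neg hk.symm, smul_zero]
  · simp

theorem alternatize_bmBasis (j k : Fin n) :
    ∑ i : Fin (1 + 2 * (n - 1) + 1), (-1 : ℤ) ^ (i : ℕ) •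
      (dzbar k (frame n (1 + 2 * (n - 1) + 1) i) *
        bmBasis n j (i.removeNth (frame n (1 + 2 * (n - 1) + 1)))) =
      if j = k then bmScale n else 0 := by
  have h := wedge_oneForm_apply (bmBasis n j) (dzbar k) (frame n (1 + 2 * (n - 1) + 1))
  rw [odd_degree, neg_one_smul] at h
  have h2 := wedge_bmBasis_dzbar j k
  have h3 := h.symm.trans h2
  have h4 := congrArg Neg.neg h3
  rw [neg_neg] at h4
  refine Eq.trans h4 ?_
  split_ifs <;> simp

/-- The value on the frame of the alternation of `v ↦ ∑ Lⱼ(v) Eⱼ`. -/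
theorem alternatize_bmComb (L : Fin n → (CSpace n →L[ℝ] F))
    (T : CSpace n →L[ℝ] Covec n (1 + 2 * (n - 1)) F)
    (hT : ∀ v, T v = bmComb fun j => L j v) :
    ContinuousAlternatingMap.alternatizeUncurryFin (conjPart T)
      (frame n (1 + 2 * (n - 1) + 1)) = bmScale n • ∑ j, conjPart (L j) (eC j) := by
  have hT' : ∀ v w, conjPart T v w = ∑ j, ∑ k,
      (dzbar k v * bmBasis n j w) • conjPart (L j) (eC k) := by
    intro v w
    have h1 : ∀ u, T u w = ∑ j, bmBasis n j w • L j u := fun u => by rw [hT, bmComb_apply]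
    rw [conjPart_apply, ContinuousAlternatingMap.smul_apply, ContinuousAlternatingMap.add_apply,
      ContinuousAlternatingMap.smul_apply, h1, h1]
    simp only [Finset.smul_sum, ← Finset.sum_add_distrib]
    refine Finset.sum_congr rfl fun j _ => ?_
    have h2 := conjPart_eq_sum (L j) v
    rw [conjPart_apply] at h2
    calc _ = bmBasis n j w • ((1 / 2 : ℂ) • (L j v + Complex.I • L j (Complex.I • v))) := by
          module
      _ = _ := by
          rw [h2, Finset.smul_sum]
          exact Finset.sum_congr rfl fun k _ => by rw [smul_smul, mul_comm]
  rw [ContinuousAlternatingMap.alternatizeUncurryFin_apply]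
  simp only [hT', Finset.smul_sum]
  rw [Finset.sum_comm]
  refine Finset.sum_congr rfl fun j _ => ?_
  rw [Finset.sum_comm, Finset.sum_eq_single j]
  · have h := alternatize_bmBasis j j
    rw [if_pos rfl] at h
    rw [← h, Finset.sum_smul]
    exact Finset.sum_congr rfl fun i _ => (smul_assoc _ _ _).symm
  · intro k _ hk
    have h := alternatize_bmBasis j k
    rw [if_neg hk.symm] at h
    have h2 := congrArg (fun c : ℂ => c • conjPart (L j) (eC k)) h
    simp only [zero_smul, Finset.sum_smul] at h2
    rw [← h2]
    exact Finset.sum_congr rfl fun i _ => (smul_assoc _ _ _).symm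
  · simp

/-- The frame is a basis, so a form of top degree vanishes if it vanishes on the frame. -/
theorem covec_top_eq_zero (hn : 1 ≤ n) (η : Covec n (1 + 2 * (n - 1) + 1) F)
    (h : η (frame n (1 + 2 * (n - 1) + 1)) = 0) : η = 0 := by
  -- An alternating form vanishes on dependent vectors, and the pairing of `E₀` with `dz̄₀` does not
  -- vanish on the frame.
  have hli : LinearIndependent ℝ (frame n (1 + 2 * (n - 1) + 1)) := by
    by_contra hcon
    have h1 := AlternatingMap.map_linearDependent
      (wedge (bmBasis n ⟨0, hn⟩) (oneForm (dzbar ⟨0, hn⟩))).toAlternatingMap _ hcon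
    have h2 := wedge_bmBasis_dzbar (⟨0, hn⟩ : Fin n) ⟨0, hn⟩
    rw [if_pos rfl] at h2
    exact neg_ne_zero.2 (bmScale_ne_zero n) (h2.symm.trans h1)
  have hcard : Fintype.card (Fin (1 + 2 * (n - 1) + 1)) = Module.finrank ℝ (CSpace n) := by
    rw [finrank_real_of_complex, finrank_euclideanSpace_fin, Fintype.card_fin]
    omega
  let b := basisOfLinearIndependentOfCardEqFinrank hli hcard
  have hb : ∀ i, b i = frame n (1 + 2 * (n - 1) + 1) i := fun i => by
    simp [b]
  have key : η.toAlternatingMap = 0 := by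
    refine Module.Basis.ext_alternating b fun v hv => ?_
    let σ : Equiv.Perm (Fin (1 + 2 * (n - 1) + 1)) :=
      Equiv.ofBijective v (Finite.injective_iff_bijective.1 hv)
    have h1 := η.toAlternatingMap.map_perm (frame n (1 + 2 * (n - 1) + 1)) σ
    simp only [hb]
    refine h1.trans ?_
    change Equiv.Perm.sign σ • η (frame n (1 + 2 * (n - 1) + 1)) = 0
    rw [h, smul_zero]
  ext v
  exact DFunLike.congr_fun key v

end Pairing

/-! ### Forms with coefficients in the Bochner–Martinelli basis -/

section BMForms

variable {n : ℕ} {F : Type*} [NormedAddCommGroup F] [NormedSpace ℂ F]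
  {G : Type*} [NormedAddCommGroup G] [NormedSpace ℂ G]

/-- The derivative `∂u/∂z̄ⱼ`. -/
def wirt (u : CSpace n → F) (j : Fin n) (ζ : CSpace n) : F := conjPart (fderiv ℝ u ζ) (eC j)

theorem wirt_of_hasFDerivAt {u : CSpace n → F} {u' : CSpace n →L[ℝ] F} {ζ : CSpace n}
    (h : HasFDerivAt u u' ζ) (j : Fin n) : wirt u j ζ = conjPart u' (eC j) := by
  rw [wirt, h.fderiv]

theorem wirt_apply (u : CSpace n → F) (j : Fin n) (ζ : CSpace n) :
    wirt u j ζ = (1 / 2 : ℂ) •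
      (fderiv ℝ u ζ (eC j) + Complex.I • fderiv ℝ u ζ (Complex.I • eC j)) := rfl

theorem norm_wirt_le (u : CSpace n → F) (j : Fin n) (ζ : CSpace n) :
    ‖wirt u j ζ‖ ≤ ‖fderiv ℝ u ζ‖ := by
  have h1 : ‖fderiv ℝ u ζ (eC j)‖ ≤ ‖fderiv ℝ u ζ‖ := by
    simpa using (fderiv ℝ u ζ).le_opNorm (eC j)
  have h2 : ‖fderiv ℝ u ζ (Complex.I • eC j)‖ ≤ ‖fderiv ℝ u ζ‖ := by
    simpa [norm_smul] using (fderiv ℝ u ζ).le_opNorm (Complex.I • eC j)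
  rw [wirt_apply, norm_smul]
  have h3 := norm_add_le (fderiv ℝ u ζ (eC j)) (Complex.I • fderiv ℝ u ζ (Complex.I • eC j))
  rw [norm_smul, Complex.norm_I, one_mul] at h3
  have h4 : ‖(1 / 2 : ℂ)‖ = 1 / 2 := by norm_num
  rw [h4]
  linarith

theorem wirt_mul {u w : CSpace n → ℂ} {ζ : CSpace n} (hu : DifferentiableAt ℝ u ζ)
    (hw : DifferentiableAt ℝ w ζ) (j : Fin n) :
    wirt (fun z => u z * w z) j ζ = u ζ * wirt w j ζ + w ζ * wirt u j ζ := by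
  have h : HasFDerivAt (fun z => u z * w z) _ ζ := hu.hasFDerivAt.mul hw.hasFDerivAt
  rw [wirt_of_hasFDerivAt h, conjPart_add, conjPart_smul, conjPart_smul]
  rfl

theorem wirt_smul {u : CSpace n → ℂ} {w : CSpace n → F} {ζ : CSpace n}
    (hu : DifferentiableAt ℝ u ζ) (hw : DifferentiableAt ℝ w ζ) (j : Fin n) :
    wirt (fun z => u z • w z) j ζ = u ζ • wirt w j ζ + wirt u j ζ • w ζ := by
  have h : HasFDerivAt (fun z => u z • w z) _ ζ := hu.hasFDerivAt.smul hw.hasFDerivAt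
  rw [wirt_of_hasFDerivAt h, conjPart_add, conjPart_smul,
    conjPart_smulRight]
  rfl

theorem wirt_clm_comp (T : F →L[ℂ] G) {w : CSpace n → F} {ζ : CSpace n}
    (hw : DifferentiableAt ℝ w ζ) (j : Fin n) :
    wirt (fun z => T (w z)) j ζ = T (wirt w j ζ) := by
  have h := ((T.restrictScalars ℝ).hasFDerivAt (x := w ζ)).comp ζ hw.hasFDerivAt
  have h2 : HasFDerivAt (fun z => T (w z)) ((T.restrictScalars ℝ).comp (fderiv ℝ w ζ)) ζ := h
  rw [wirt_of_hasFDerivAt h2, conjPart_comp]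
  rfl

theorem wirt_congr {u w : CSpace n → F} {ζ : CSpace n} (h : u =ᶠ[𝓝 ζ] w) (j : Fin n) :
    wirt u j ζ = wirt w j ζ := by
  rw [wirt, wirt, h.fderiv_eq]

theorem wirt_pow {u : CSpace n → ℂ} {ζ : CSpace n} (hu : DifferentiableAt ℝ u ζ) (m : ℕ)
    (j : Fin n) : wirt (fun z => u z ^ m) j ζ = m * u ζ ^ (m - 1) * wirt u j ζ := by
  have h : HasFDerivAt (fun z => u z ^ m) _ ζ := hu.hasFDerivAt.pow m
  rw [wirt_of_hasFDerivAt h, conjPart_smul, smul_apply, smul_eq_mul, nsmul_eq_mul]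
  rfl

theorem continuous_wirt {u : CSpace n → F} (hu : ContDiff ℝ 1 u) (j : Fin n) :
    Continuous (wirt u j) := by
  have h : Continuous (fderiv ℝ u) := hu.continuous_fderiv one_ne_zero
  have h2 : wirt u j = fun ζ => (1 / 2 : ℂ) •
      (fderiv ℝ u ζ (eC j) + Complex.I • fderiv ℝ u ζ (Complex.I • eC j)) := rfl
  rw [h2]
  fun_prop

theorem hasFDerivAt_constOfIsEmpty {u : CSpace n → F} {u' : CSpace n →L[ℝ] F} {ζ : CSpace n}
    (h : HasFDerivAt u u' ζ) :
    HasFDerivAt (fun ζ => ContinuousAlternatingMap.constOfIsEmpty ℝ (CSpace n) (Fin 0) (u ζ))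
      (((ContinuousAlternatingMap.constOfIsEmptyLIE ℝ (CSpace n) F (Fin 0) :
        F ≃ₗᵢ[ℝ] Covec n 0 F) : F →L[ℝ] Covec n 0 F).comp u') ζ :=
  ((ContinuousAlternatingMap.constOfIsEmptyLIE ℝ (CSpace n) F (Fin 0) :
        F ≃ₗᵢ[ℝ] Covec n 0 F) : F →L[ℝ] Covec n 0 F).hasFDerivAt.comp ζ h

theorem dbarFun_eq {u : CSpace n → ℂ} {ζ : CSpace n} (h : DifferentiableAt ℝ u ζ) :
    dbarFun u ζ = oneForm (conjPart (fderiv ℝ u ζ)) := by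
  rw [dbarFun, dbar_eq (hasFDerivAt_constOfIsEmpty h.hasFDerivAt)]
  ext v
  rw [ContinuousAlternatingMap.alternatizeUncurryFin_apply]
  refine (Fin.sum_univ_one _).trans ?_
  rw [Fin.val_zero, pow_zero, one_smul]
  rfl

theorem bmPair_dbarFun {u : CSpace n → ℂ} {ζ : CSpace n} (h : DifferentiableAt ℝ u ζ)
    (j : Fin n) : bmPair j (dbarFun u ζ) = -bmScale n * wirt u j ζ := by
  rw [dbarFun_eq h, bmPair_conjPart]
  rfl

theorem norm_wirt_le_dbarFun {u : CSpace n → ℂ} {ζ : CSpace n} (h : DifferentiableAt ℝ u ζ)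
    (j : Fin n) : ‖wirt u j ζ‖ ≤ ‖dbarFun u ζ‖ := by
  have h1 := (dbarFun u ζ).le_opNorm (fun _ => eC j)
  rw [dbarFun_eq h, oneForm_apply] at h1
  rw [dbarFun_eq h]
  simpa [wirt] using h1

theorem norm_dbarFun_le {u : CSpace n → ℂ} {ζ : CSpace n} (h : DifferentiableAt ℝ u ζ) :
    ‖dbarFun u ζ‖ ≤ ∑ j, ‖wirt u j ζ‖ := by
  rw [dbarFun_eq h]
  refine ContinuousAlternatingMap.opNorm_le_bound _
    (Finset.sum_nonneg fun j _ => norm_nonneg _) fun v => ?_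
  rw [oneForm_apply, conjPart_eq_sum]
  refine (norm_sum_le _ _).trans ?_
  rw [Finset.sum_mul]
  refine Finset.sum_le_sum fun j _ => ?_
  rw [norm_smul, mul_comm]
  have h2 : ‖dzbar j (v 0)‖ ≤ ∏ i : Fin (0 + 1), ‖v i‖ := by
    rw [dzbar_apply, RCLike.norm_conj, Fin.prod_univ_one]
    exact PiLp.norm_apply_le _ _
  exact mul_le_mul_of_nonneg_left h2 (norm_nonneg _)

/-- The forms `∑ gⱼ Eⱼ`, as a continuous linear map. -/
def bmCombL : (Fin n → F) →L[ℂ] Covec n (1 + 2 * (n - 1)) F :=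
  ∑ j, (tensCovec (bmBasis n j)).comp (ContinuousLinearMap.proj j)

theorem bmCombL_apply (g : Fin n → F) : bmCombL g = bmComb g := by
  rw [bmCombL, sum_apply]
  rfl

theorem hasFDerivAt_bmComb {g : Fin n → CSpace n → F} {g' : Fin n → (CSpace n →L[ℝ] F)}
    {ζ : CSpace n} (h : ∀ j, HasFDerivAt (g j) (g' j) ζ) :
    HasFDerivAt (fun ζ => bmComb fun j => g j ζ)
      ((bmCombL.restrictScalars ℝ).comp (ContinuousLinearMap.pi g')) ζ := by
  have h1 : HasFDerivAt (fun ζ j => g j ζ) (ContinuousLinearMap.pi g') ζ := hasFDerivAt_pi.2 h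
  have h2 := ((bmCombL (n := n) (F := F)).restrictScalars ℝ).hasFDerivAt.comp ζ h1
  refine h2.congr_of_eventuallyEq (Eventually.of_forall fun z => ?_)
  exact (bmCombL_apply _).symm

/-- By duality only `∂gⱼ/∂z̄ⱼ` survives in the top degree, so closedness of `∑ gⱼ Eⱼ` is the
vanishing of a complex divergence. -/
theorem dbar_bmComb_frame {g : Fin n → CSpace n → F} {ζ : CSpace n}
    (h : ∀ j, DifferentiableAt ℝ (g j) ζ) :
    dbar (fun ζ => bmComb fun j => g j ζ) ζ (frame n (1 + 2 * (n - 1) + 1)) =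
      bmScale n • ∑ j, wirt (g j) j ζ := by
  rw [dbar_eq (hasFDerivAt_bmComb fun j => (h j).hasFDerivAt)]
  exact alternatize_bmComb (fun j => fderiv ℝ (g j) ζ) _ fun v => bmCombL_apply _

theorem dbar_bmComb_eq_zero (hn : 1 ≤ n) {g : Fin n → CSpace n → F} {ζ : CSpace n}
    (h : ∀ j, DifferentiableAt ℝ (g j) ζ) (h0 : ∑ j, wirt (g j) j ζ = 0) :
    dbar (fun ζ => bmComb fun j => g j ζ) ζ = 0 := by
  refine covec_top_eq_zero hn _ ?_
  rw [dbar_bmComb_frame h, h0, smul_zero]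

theorem dbar_congr {k : ℕ} {η θ : CSpace n → Covec n k F} {ζ : CSpace n} (h : η =ᶠ[𝓝 ζ] θ) :
    dbar η ζ = dbar θ ζ := by
  rw [dbar, dbar, h.fderiv_eq]

/-- The coefficient of a form at a basis form. -/
def bmCoord (j : Fin n) : Covec n (1 + 2 * (n - 1)) F →L[ℝ] F :=
  (bmScale n)⁻¹ • ∑ i : Fin (1 + 2 * (n - 1) + 1),
    ((-1 : ℂ) ^ (i : ℕ) * dzbar j (frame n (1 + 2 * (n - 1) + 1) i)) •
      ContinuousAlternatingMap.apply ℝ (CSpace n) F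
        (i.removeNth (frame n (1 + 2 * (n - 1) + 1)))

theorem bmCoord_bmComb (j : Fin n) (g : Fin n → F) : bmCoord j (bmComb g) = g j := by
  rw [bmCoord, smul_apply, sum_apply]
  have h1 : ∀ i : Fin (1 + 2 * (n - 1) + 1),
      (((-1 : ℂ) ^ (i : ℕ) * dzbar j (frame n (1 + 2 * (n - 1) + 1) i)) •
      ContinuousAlternatingMap.apply ℝ (CSpace n) F
        (i.removeNth (frame n (1 + 2 * (n - 1) + 1)))) (bmComb g) =
      ∑ k, ((-1 : ℤ) ^ (i : ℕ) • (dzbar j (frame n (1 + 2 * (n - 1) + 1) i) *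
        bmBasis n k (i.removeNth (frame n (1 + 2 * (n - 1) + 1))))) • g k := by
    intro i
    change ((-1 : ℂ) ^ (i : ℕ) * dzbar j (frame n (1 + 2 * (n - 1) + 1) i)) •
      bmComb g (i.removeNth (frame n (1 + 2 * (n - 1) + 1))) = _
    rw [bmComb_apply, Finset.smul_sum]
    refine Finset.sum_congr rfl fun k _ => ?_
    rw [smul_smul, zsmul_eq_mul]
    push_cast
    rw [mul_assoc]
  rw [Finset.sum_congr rfl fun i _ => h1 i, Finset.sum_comm]
  simp only [← Finset.sum_smul, alternatize_bmBasis]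
  simp [smul_smul, inv_mul_cancel₀ (bmScale_ne_zero n)]

theorem contDiff_bmPair {ψ : CSpace n → Covec n (0 + 1) ℂ} (hψ : ContDiff ℝ ∞ ψ) (j : Fin n) :
    ContDiff ℝ ∞ fun ζ => bmPair j (ψ ζ) := by
  have h : ∀ v : Fin (0 + 1) → CSpace n, ContDiff ℝ ∞ fun ζ => ψ ζ v := fun v =>
    (ContinuousAlternatingMap.apply ℝ (CSpace n) ℂ v).contDiff.comp hψ
  simp only [bmPair, wedge_apply]
  refine ContDiff.const_smul _ (ContDiff.sum fun σ _ => ?_)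
  exact ContDiff.const_smul _ ((h _).smul contDiff_const)

theorem bmPair_zero (j : Fin n) : bmPair j (0 : Covec n (0 + 1) ℂ) = 0 := by
  have h := wedge_smul_right (0 : ℂ) (bmBasis n j) (0 : Covec n (0 + 1) ℂ)
  rw [bmPair, show (0 : Covec n (0 + 1) ℂ) = (0 : ℂ) • 0 by simp, h, zero_smul]
  rfl

theorem hasCompactSupport_bmPair {ψ : CSpace n → Covec n (0 + 1) ℂ} (hψ : HasCompactSupport ψ)
    (j : Fin n) : HasCompactSupport fun ζ => bmPair j (ψ ζ) :=
  hψ.comp_left (g := bmPair j) (bmPair_zero j)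

/-- The factor `(1 + ζ·ξ) / (1 + |ξ|²)`. -/
def peak (ξ : RSpace n) (ζ : CSpace n) : ℂ := (1 + dotC ζ ξ) / (1 + (‖ξ‖ : ℂ) ^ 2)

/-- The normalization of the Bochner–Martinelli form. -/
def bmNorm (n : ℕ) : ℂ := ((2 * Real.pi * Complex.I)⁻¹) ^ n

theorem omegaM_eq (hn : 1 ≤ n) (m : ℕ) (ξ : RSpace n) (ζ : CSpace n) :
    omegaM m ξ ζ = bmComb fun j => bmNorm n * (peak ξ ζ ^ m * bmKer j (ζ - toC ξ)) := by
  rw [omegaM, bmForm_eq hn]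
  ext v
  simp only [ContinuousAlternatingMap.smul_apply, ContinuousAlternatingMap.sum_apply, bmComb_apply,
    Finset.smul_sum, smul_eq_mul]
  refine Finset.sum_congr rfl fun j _ => ?_
  rw [bmNorm, peak]
  ring

end BMForms

/-! ### The Bochner–Martinelli formula -/

section BochnerMartinelli

variable {n : ℕ}

theorem finrank_CSpace (n : ℕ) : Module.finrank ℝ (CSpace n) = 2 * n := by
  rw [finrank_real_of_complex, finrank_euclideanSpace_fin]

theorem nontrivial_CSpace (hn : 1 ≤ n) : Nontrivial (CSpace n) := by
  have : Nonempty (Fin n) := ⟨⟨0, hn⟩⟩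
  infer_instance

theorem volume_real_ball_CSpace (hn : 1 ≤ n) :
    (volume : Measure (CSpace n)).real (Metric.ball 0 1) = Real.pi ^ n / n.factorial := by
  have := nontrivial_CSpace hn
  rw [Measure.real, InnerProductSpace.volume_ball, finrank_CSpace, ENNReal.ofReal_one, one_pow,
    one_mul, pow_mul, Real.sq_sqrt Real.pi_pos.le]
  have h : ((2 * n : ℕ) : ℝ) / 2 + 1 = (n : ℝ) + 1 := by
    push_cast
    ring
  rw [h, Real.Gamma_nat_eq_factorial, ENNReal.toReal_ofReal (by positivity)]

/-- In polar coordinates the integrand has the primitive `(y²/(1 + y²))^n / (2n)`, which runs from 0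
to `1/(2n)`; the rest is the volume of the unit ball. -/
theorem integral_radial (hn : 1 ≤ n) :
    ∫ z : CSpace n, ((‖z‖ ^ 2 + 1)⁻¹) ^ (n + 1) = Real.pi ^ n / n.factorial := by
  have := nontrivial_CSpace hn
  have h1 := integral_fun_norm_addHaar (volume : Measure (CSpace n))
    (fun y : ℝ => ((y ^ 2 + 1)⁻¹) ^ (n + 1))
  rw [h1, volume_real_ball_CSpace hn, finrank_CSpace]
  have hn0 : (n : ℝ) ≠ 0 := by exact_mod_cast (by omega : n ≠ 0)
  have h2 : ∫ y : ℝ in Ioi 0, y ^ (2 * n - 1) • ((y ^ 2 + 1)⁻¹) ^ (n + 1) = 1 / (2 * (n : ℝ)) - 0 := by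
    have hd : ∀ x : ℝ, HasDerivAt (fun y : ℝ => (1 - (y ^ 2 + 1)⁻¹) ^ n / (2 * (n : ℝ)))
        (x ^ (2 * n - 1) • ((x ^ 2 + 1)⁻¹) ^ (n + 1)) x := by
      intro x
      have hx : x ^ 2 + 1 ≠ 0 := by positivity
      have h := ((((hasDerivAt_pow 2 x).add_const 1).fun_inv hx).const_sub 1 |>.fun_pow n).div_const
        (2 * (n : ℝ))
      refine h.congr_deriv ?_
      obtain ⟨m, rfl⟩ : ∃ m, n = m + 1 := ⟨n - 1, by omega⟩
      have e : 1 - (x ^ 2 + 1)⁻¹ = x ^ 2 * (x ^ 2 + 1)⁻¹ := by field_simp; ring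
      rw [e, show 2 * (m + 1) - 1 = 2 * m + 1 by omega, Nat.add_sub_cancel, smul_eq_mul,
        mul_pow, ← pow_mul, pow_succ x (2 * m)]
      have e2 : -(-(((2 : ℕ) : ℝ) * x ^ (2 - 1)) / (x ^ 2 + 1) ^ 2) =
          2 * x * ((x ^ 2 + 1)⁻¹) ^ 2 := by
        rw [neg_div, neg_neg, inv_pow, div_eq_mul_inv]
        norm_num
      rw [e2]
      generalize (x ^ 2 + 1)⁻¹ = a
      push_cast
      have e3 : (m : ℝ) + 1 ≠ 0 := by positivity
      field_simp
      ring
    have ht : Tendsto (fun y : ℝ => (1 - (y ^ 2 + 1)⁻¹) ^ n / (2 * (n : ℝ))) atTop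
        (𝓝 (1 / (2 * (n : ℝ)))) := by
      have h3 : Tendsto (fun y : ℝ => (y ^ 2 + 1)⁻¹) atTop (𝓝 0) :=
        (tendsto_atTop_add_const_right _ _ (tendsto_pow_atTop two_ne_zero)).inv_tendsto_atTop
      have h4 := ((h3.const_sub 1).pow n).div_const (2 * (n : ℝ))
      simpa using h4
    have h5 := integral_Ioi_of_hasDerivAt_of_nonneg' (a := 0) (fun x _ => hd x)
      (fun x hx => by
        have : (0 : ℝ) < x := hx
        simp only [smul_eq_mul]
        positivity) ht
    rw [h5]
    simp [show n ≠ 0 by omega]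
  rw [h2, nsmul_eq_mul, smul_eq_mul]
  push_cast
  field_simp
  ring

/-- The singular weight `|z|^{1-2n}`. -/
def radKer (n : ℕ) (z : CSpace n) : ℝ := ‖z‖ * ((‖z‖ ^ 2)⁻¹) ^ n

theorem radKer_nonneg (z : CSpace n) : 0 ≤ radKer n z := by
  unfold radKer
  positivity

theorem norm_bmKer_le (j : Fin n) (z : CSpace n) : ‖bmKer j z‖ ≤ radKer n z := by
  rw [bmKer, radKer, norm_mul, norm_pow, norm_inv, nsq_eq, norm_pow, Complex.norm_real,
    norm_norm, dzbar_apply, RCLike.norm_conj]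
  gcongr
  exact PiLp.norm_apply_le _ _

/-- The Jacobian `r^{2n-1}` cancels the singularity exactly and leaves `(1 + r)^{-2}`. -/
theorem integrable_radKer (hn : 1 ≤ n) :
    Integrable fun z : CSpace n => radKer n z * ((1 + ‖z‖) ^ 2)⁻¹ := by
  have := nontrivial_CSpace hn
  have h1 := integrable_fun_norm_addHaar (volume : Measure (CSpace n))
    (f := fun y : ℝ => y * ((y ^ 2)⁻¹) ^ n * ((1 + y) ^ 2)⁻¹)
  refine h1.2 ?_
  rw [finrank_CSpace]
  have h2 : Integrable (fun y : ℝ => (1 + ‖y‖) ^ (-(2 : ℝ))) :=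
    integrable_one_add_norm (by simp)
  refine (h2.integrableOn (s := Ioi 0)).congr_fun (fun y hy => ?_) measurableSet_Ioi
  have hy' : (0 : ℝ) < y := hy
  obtain ⟨m, rfl⟩ : ∃ m, n = m + 1 := ⟨n - 1, by omega⟩
  simp only [smul_eq_mul]
  rw [Real.norm_of_nonneg hy'.le, Real.rpow_neg (by positivity), Real.rpow_two,
    show 2 * (m + 1) - 1 = 2 * m + 1 by omega, ← mul_assoc, ← mul_assoc, ← pow_succ,
    show 2 * m + 1 + 1 = 2 * (m + 1) by ring, inv_pow, ← pow_mul, mul_inv_cancel₀ (by positivity),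
    one_mul]

theorem measurable_bmKer (j : Fin n) : Measurable (bmKer j : CSpace n → ℂ) := by
  unfold bmKer
  exact (dzbar j).continuous.measurable.mul ((contDiff_nsq.continuous.measurable.inv).pow_const n)

theorem integrable_bmKer_mul (hn : 1 ≤ n) (j : Fin n) {w : CSpace n → ℂ}
    (hw : AEStronglyMeasurable w) {C : ℝ} (hC : ∀ z, ‖w z‖ ≤ C * ((1 + ‖z‖) ^ 2)⁻¹) :
    Integrable fun z => bmKer j z * w z := by
  refine ((integrable_radKer hn).const_mul C).mono'
    ((measurable_bmKer j).aestronglyMeasurable.mul hw) (Eventually.of_forall fun z => ?_)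
  rw [norm_mul]
  calc ‖bmKer j z‖ * ‖w z‖ ≤ radKer n z * (C * ((1 + ‖z‖) ^ 2)⁻¹) :=
        mul_le_mul (norm_bmKer_le j z) (hC z) (norm_nonneg _) (radKer_nonneg z)
    _ = _ := by ring

theorem integral_mul_fderiv_of_hasCompactSupport {f g : CSpace n → ℂ} (hf : ContDiff ℝ 1 f)
    (hg : ContDiff ℝ 1 g) (hc : HasCompactSupport g) (v : CSpace n) :
    Integrable (fun z => f z * fderiv ℝ g z v) ∧ Integrable (fun z => fderiv ℝ f z v * g z) ∧
      ∫ z, f z * fderiv ℝ g z v = -∫ z, fderiv ℝ f z v * g z := by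
  have hf' : Continuous fun z => fderiv ℝ f z v :=
    (hf.continuous_fderiv one_ne_zero).clm_apply continuous_const
  have hg' : Continuous fun z => fderiv ℝ g z v :=
    (hg.continuous_fderiv one_ne_zero).clm_apply continuous_const
  have i1 : Integrable (fun z => f z * fderiv ℝ g z v) :=
    (hf.continuous.mul hg').integrable_of_hasCompactSupport
      (HasCompactSupport.mul_left (hc.fderiv_apply (𝕜 := ℝ) v))
  have i2 : Integrable (fun z => fderiv ℝ f z v * g z) :=
    (hf'.mul hg.continuous).integrable_of_hasCompactSupport hc.mul_left
  have i3 : Integrable (fun z => f z * g z) :=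
    (hf.continuous.mul hg.continuous).integrable_of_hasCompactSupport hc.mul_left
  exact ⟨i1, i2, integral_mul_fderiv_eq_neg_fderiv_mul_of_integrable i2 i1 i3
    (fun x _ => hf.differentiable one_ne_zero x) (fun x _ => hg.differentiable one_ne_zero x)⟩

theorem integral_mul_wirt {f g : CSpace n → ℂ} (hf : ContDiff ℝ 1 f)
    (hg : ContDiff ℝ 1 g) (hc : HasCompactSupport g) (j : Fin n) :
    Integrable (fun z => f z * wirt g j z) ∧ Integrable (fun z => wirt f j z * g z) ∧
      ∫ z, f z * wirt g j z = -∫ z, wirt f j z * g z := by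
  obtain ⟨a1, a2, a3⟩ := integral_mul_fderiv_of_hasCompactSupport hf hg hc (eC j)
  obtain ⟨b1, b2, b3⟩ := integral_mul_fderiv_of_hasCompactSupport hf hg hc (Complex.I • eC j)
  have e1 : (fun z => f z * wirt g j z) = fun z => (1 / 2 : ℂ) * (f z * fderiv ℝ g z (eC j)) +
      (1 / 2 * Complex.I) * (f z * fderiv ℝ g z (Complex.I • eC j)) := by
    funext z
    rw [wirt_apply, smul_eq_mul, smul_eq_mul]
    ring
  have e2 : (fun z => wirt f j z * g z) = fun z => (1 / 2 : ℂ) * (fderiv ℝ f z (eC j) * g z) +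
      (1 / 2 * Complex.I) * (fderiv ℝ f z (Complex.I • eC j) * g z) := by
    funext z
    rw [wirt_apply, smul_eq_mul, smul_eq_mul]
    ring
  rw [e1, e2]
  refine ⟨(a1.const_mul _).add (b1.const_mul _), (a2.const_mul _).add (b2.const_mul _), ?_⟩
  rw [integral_add (a1.const_mul _) (b1.const_mul _), integral_add (a2.const_mul _) (b2.const_mul _),
    integral_const_mul, integral_const_mul, integral_const_mul, integral_const_mul, a3, b3]
  ring

/-- The regularized kernels. -/
def regKer (t : ℝ) (j : Fin n) (z : CSpace n) : ℂ := dzbar j z * ((nsq z + (t : ℂ) ^ 2)⁻¹) ^ n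

theorem nsq_add_eq (t : ℝ) (z : CSpace n) :
    nsq z + (t : ℂ) ^ 2 = ((‖z‖ ^ 2 + t ^ 2 : ℝ) : ℂ) := by
  rw [nsq_eq]
  push_cast
  rfl

theorem nsq_add_ne_zero {t : ℝ} (ht : 0 < t) (z : CSpace n) : nsq z + (t : ℂ) ^ 2 ≠ 0 := by
  rw [nsq_add_eq]
  exact_mod_cast (by positivity : ‖z‖ ^ 2 + t ^ 2 ≠ 0)

theorem contDiff_regKer {t : ℝ} (ht : 0 < t) (j : Fin n) : ContDiff ℝ ∞ (regKer t j) := by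
  unfold regKer
  exact (dzbar j).contDiff.mul
    (((contDiff_nsq.add contDiff_const).inv fun z => nsq_add_ne_zero ht z).pow n)

theorem wirt_regKer {t : ℝ} (j : Fin n) {z : CSpace n} (h0 : nsq z + (t : ℂ) ^ 2 ≠ 0) :
    wirt (regKer t j) j z = ((nsq z + (t : ℂ) ^ 2)⁻¹) ^ n -
      n * ((nsq z + (t : ℂ) ^ 2)⁻¹) ^ (n + 1) * (dzbar j z * dz j z) := by
  have h1 : HasFDerivAt (fun z => ((nsq z + (t : ℂ) ^ 2)⁻¹) ^ n) _ z :=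
    ((hasFDerivAt_inv' (𝕜 := ℝ) h0).comp z ((hasFDerivAt_nsq z).add_const ((t : ℂ) ^ 2))).pow n
  have h2 : HasFDerivAt (regKer t j) _ z := (dzbar j).hasFDerivAt.mul h1
  have h3 : ∀ L : CSpace n →L[ℝ] ℂ, (-((ContinuousLinearMap.mulLeftRight ℝ ℂ)
      (nsq z + (t : ℂ) ^ 2)⁻¹) (nsq z + (t : ℂ) ^ 2)⁻¹).comp L =
      (-((nsq z + (t : ℂ) ^ 2)⁻¹) ^ 2) • L := by
    intro L
    ext v
    change -((nsq z + (t : ℂ) ^ 2)⁻¹ * L v * (nsq z + (t : ℂ) ^ 2)⁻¹) =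
      -((nsq z + (t : ℂ) ^ 2)⁻¹) ^ 2 * L v
    ring
  have h4 : conjPart (nsqDeriv z) (eC j) = dz j z := by
    rw [conjPart_nsqDeriv, sum_apply, Finset.sum_eq_single j]
    · simp
    · intro k _ hk
      simp [hk]
    · simp
  rw [wirt_of_hasFDerivAt h2, conjPart_add, conjPart_smul, conjPart_smul, h3, ]
  rw [conjPart_smul, conjPart_smul, conjPart_dzbar]
  simp only [add_apply, smul_apply, h4, smul_eq_mul, nsmul_eq_mul]
  have h5 : dzbar j (eC j) = 1 := by simp
  rw [h5]
  rcases Nat.eq_zero_or_pos n with hn | hn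
  · subst hn
    exact j.elim0
  · obtain ⟨m, rfl⟩ : ∃ m, n = m + 1 := ⟨n - 1, by omega⟩
    simp only [Nat.add_sub_cancel]
    ring

/-- With `a = (|z|² + t²)⁻¹`, the divergence is `n(aⁿ - |z|² a^{n+1}) = n t² a^{n+1}`. The value `t
= 0` is admitted off the origin and gives closedness of the unregularized kernel. -/
theorem sum_wirt_regKer {t : ℝ} {z : CSpace n} (h0 : nsq z + (t : ℂ) ^ 2 ≠ 0) :
    ∑ j, wirt (regKer t j) j z =
      n * ((t ^ 2 * ((‖z‖ ^ 2 + t ^ 2)⁻¹) ^ (n + 1) : ℝ) : ℂ) := by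
  simp only [fun j => wirt_regKer j h0, Finset.sum_sub_distrib, Finset.sum_const, Finset.card_univ,
    Fintype.card_fin, nsmul_eq_mul, ← Finset.mul_sum]
  change n * ((nsq z + (t : ℂ) ^ 2)⁻¹) ^ n - n * ((nsq z + (t : ℂ) ^ 2)⁻¹) ^ (n + 1) * nsq z = _
  have h1 : ((t ^ 2 * ((‖z‖ ^ 2 + t ^ 2)⁻¹) ^ (n + 1) : ℝ) : ℂ) =
      (t : ℂ) ^ 2 * ((nsq z + (t : ℂ) ^ 2)⁻¹) ^ (n + 1) := by
    rw [nsq_add_eq]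
    push_cast
    ring
  rw [h1]
  linear_combination (-(n : ℂ) * ((nsq z + (t : ℂ) ^ 2)⁻¹) ^ n) * mul_inv_cancel₀ h0

theorem sum_wirt_bmKer {z : CSpace n} (hz : z ≠ 0) : ∑ j, wirt (bmKer j) j z = 0 := by
  have h := sum_wirt_regKer (n := n) (t := 0) (z := z) (by simpa using nsq_ne_zero hz)
  have e : ∀ j : Fin n, (regKer 0 j : CSpace n → ℂ) = bmKer j := fun j => by
    funext w
    simp [regKer, bmKer]
  simpa [e] using h

/-- The substitution `z ↦ tz` removes `t` from the kernel and puts it into `u`; dominated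
convergence then yields the mass of the kernel times `u 0`. -/
theorem tendsto_integral_approx (hn : 1 ≤ n) {u : CSpace n → ℂ} (hu : Continuous u)
    (hc : HasCompactSupport u) :
    Tendsto (fun k : ℕ => ∫ z, (((1 / ((k : ℝ) + 1)) ^ 2 *
      ((‖z‖ ^ 2 + (1 / ((k : ℝ) + 1)) ^ 2)⁻¹) ^ (n + 1) : ℝ) : ℂ) * u z) atTop
      (𝓝 ((Real.pi ^ n / n.factorial : ℝ) * u 0)) := by
  have h1 : ∀ t : ℝ, 0 < t → ∫ z : CSpace n, ((t ^ 2 *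
      ((‖z‖ ^ 2 + t ^ 2)⁻¹) ^ (n + 1) : ℝ) : ℂ) * u z =
      ∫ z : CSpace n, ((((‖z‖ ^ 2 + 1)⁻¹) ^ (n + 1) : ℝ) : ℂ) * u (t • z) := by
    intro t ht
    have h2 := Measure.integral_comp_smul (volume : Measure (CSpace n))
      (fun z => ((t ^ 2 * ((‖z‖ ^ 2 + t ^ 2)⁻¹) ^ (n + 1) : ℝ) : ℂ) * u z) t
    rw [finrank_CSpace, abs_of_pos (by positivity)] at h2
    have h3 : ∫ z : CSpace n, ((t ^ 2 * ((‖z‖ ^ 2 + t ^ 2)⁻¹) ^ (n + 1) : ℝ) : ℂ) * u z =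
        (t ^ (2 * n)) • ∫ z : CSpace n, ((t ^ 2 *
          ((‖t • z‖ ^ 2 + t ^ 2)⁻¹) ^ (n + 1) : ℝ) : ℂ) * u (t • z) := by
      rw [h2, smul_smul, mul_inv_cancel₀ (by positivity), one_smul]
    rw [h3, ← integral_smul]
    congr 1
    funext z
    rw [Complex.real_smul, ← mul_assoc, ← Complex.ofReal_mul]
    congr 2
    rw [norm_smul, Real.norm_of_nonneg ht.le, mul_pow, ← mul_add_one, mul_inv, mul_pow]
    have h4 : (t ^ 2)⁻¹ ^ (n + 1) = (t ^ (2 * n))⁻¹ * (t ^ 2)⁻¹ := by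
      rw [pow_succ, inv_pow, ← pow_mul]
    rw [h4]
    field_simp
  have h5 : ∀ k : ℕ, (0 : ℝ) < 1 / ((k : ℝ) + 1) := fun k => by positivity
  simp only [fun k : ℕ => h1 _ (h5 k)]
  obtain ⟨C, hC⟩ := hc.exists_bound_of_continuous hu
  have hI : (((Real.pi ^ n / n.factorial : ℝ) : ℂ) * u 0) =
      ∫ z : CSpace n, ((((‖z‖ ^ 2 + 1)⁻¹) ^ (n + 1) : ℝ) : ℂ) * u 0 := by
    rw [integral_mul_const, integral_complex_ofReal, integral_radial hn]
  -- A non-integrable function has integral zero by convention, so the positive value computed above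
  -- implies integrability.
  have hint : Integrable fun z : CSpace n => ((‖z‖ ^ 2 + 1)⁻¹) ^ (n + 1) := by
    by_contra hcon
    have h6 := integral_radial hn
    rw [integral_undef hcon] at h6
    have : (0 : ℝ) < Real.pi ^ n / n.factorial := by positivity
    linarith
  rw [hI]
  refine tendsto_integral_of_dominated_convergence
    (fun z => ((‖z‖ ^ 2 + 1)⁻¹) ^ (n + 1) * C) (fun k => ?_) (hint.mul_const C) (fun k => ?_) ?_
  · refine Continuous.aestronglyMeasurable ?_
    have : Continuous fun z : CSpace n => ((‖z‖ ^ 2 + 1)⁻¹) ^ (n + 1) :=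
      (((continuous_norm.pow 2).add continuous_const).inv₀
        fun z => (by positivity : ‖z‖ ^ 2 + 1 ≠ 0)).pow _
    exact (Complex.continuous_ofReal.comp this).mul
      (hu.comp (continuous_const_smul _))
  · refine Eventually.of_forall fun z => ?_
    rw [norm_mul, Complex.norm_real, Real.norm_of_nonneg (by positivity)]
    exact mul_le_mul_of_nonneg_left (hC _) (by positivity)
  · refine Eventually.of_forall fun z => ?_
    refine Tendsto.const_mul _ ?_
    have h7 : Tendsto (fun k : ℕ => (1 / ((k : ℝ) + 1)) • z) atTop (𝓝 ((0 : ℝ) • z)) :=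
      tendsto_one_div_add_atTop_nhds_zero_nat.smul_const z
    rw [zero_smul] at h7
    exact (hu.tendsto 0).comp h7

theorem norm_regKer_le {t : ℝ} (j : Fin n) {z : CSpace n} (hz : z ≠ 0) :
    ‖regKer t j z‖ ≤ radKer n z := by
  rw [regKer, radKer, norm_mul, norm_pow, norm_inv, nsq_add_eq, Complex.norm_real,
    Real.norm_of_nonneg (by positivity), dzbar_apply, RCLike.norm_conj]
  have h0 : 0 < ‖z‖ := norm_pos_iff.2 hz
  gcongr
  · exact PiLp.norm_apply_le _ _
  · nlinarith [sq_nonneg t]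

theorem tendsto_regKer (j : Fin n) {z : CSpace n} (hz : z ≠ 0) :
    Tendsto (fun k : ℕ => regKer (1 / ((k : ℝ) + 1)) j z) atTop (𝓝 (bmKer j z)) := by
  have h1 : Tendsto (fun k : ℕ => nsq z + ((1 / ((k : ℝ) + 1) : ℝ) : ℂ) ^ 2) atTop
      (𝓝 (nsq z + ((0 : ℝ) : ℂ) ^ 2)) :=
    (((Complex.continuous_ofReal.tendsto 0).comp
      tendsto_one_div_add_atTop_nhds_zero_nat).pow 2).const_add _
  rw [Complex.ofReal_zero, zero_pow two_ne_zero, add_zero] at h1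
  exact ((h1.inv₀ (nsq_ne_zero hz)).pow n).const_mul _

theorem ae_ne_zero (hn : 1 ≤ n) : ∀ᵐ z : CSpace n, z ≠ 0 := by
  have := nontrivial_CSpace hn
  exact Measure.ae_ne volume 0

/-- The Bochner–Martinelli formula for compactly supported functions. -/
theorem bochnerMartinelli_of_hasCompactSupport (hn : 1 ≤ n) {u : CSpace n → ℂ}
    (hu : ContDiff ℝ 1 u) (hc : HasCompactSupport u) :
    ∑ j, ∫ z, bmKer j z * wirt u j z =
      -((Real.pi ^ n / (n - 1).factorial : ℝ) : ℂ) * u 0 := by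
  have hpos : ∀ k : ℕ, (0 : ℝ) < 1 / ((k : ℝ) + 1) := fun k => by positivity
  have hcw : ∀ j, HasCompactSupport (wirt u j) := fun j => by
    refine (hc.fderiv (𝕜 := ℝ)).comp_left (g := fun L => conjPart L (eC j)) ?_
    rw [conjPart_zero]
    rfl
  have hb : ∀ j, ∃ C, ∀ z, ‖wirt u j z‖ ≤ C * ((1 + ‖z‖) ^ 2)⁻¹ := fun j => by
    have h1 : Continuous fun z => ((1 + ‖z‖ : ℝ) : ℂ) ^ 2 * wirt u j z :=
      ((Complex.continuous_ofReal.comp (continuous_const.add continuous_norm)).pow 2).mul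
        (continuous_wirt hu j)
    obtain ⟨C, hC⟩ := (HasCompactSupport.mul_left (hcw j)
      (f := fun z => ((1 + ‖z‖ : ℝ) : ℂ) ^ 2)).exists_bound_of_continuous h1
    refine ⟨C, fun z => ?_⟩
    have h2 := hC z
    simp only [Pi.mul_apply] at h2
    rw [norm_mul, norm_pow, Complex.norm_real, Real.norm_of_nonneg (by positivity)] at h2
    rw [← div_eq_mul_inv, le_div_iff₀ (by positivity), mul_comm]
    exact h2
  have hlim : Tendsto (fun k : ℕ => ∑ j, ∫ z, regKer (1 / ((k : ℝ) + 1)) j z * wirt u j z) atTop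
      (𝓝 (∑ j, ∫ z, bmKer j z * wirt u j z)) := by
    refine tendsto_finsetSum _ fun j _ => ?_
    obtain ⟨C, hC⟩ := hb j
    refine tendsto_integral_of_dominated_convergence
      (fun z => C * (radKer n z * ((1 + ‖z‖) ^ 2)⁻¹)) (fun k => ?_)
      ((integrable_radKer hn).const_mul C) (fun k => ?_) ?_
    · exact ((contDiff_regKer (hpos k) j).continuous.mul
        (continuous_wirt hu j)).aestronglyMeasurable
    · filter_upwards [ae_ne_zero hn] with z hz
      rw [norm_mul]
      calc _ ≤ radKer n z * (C * ((1 + ‖z‖) ^ 2)⁻¹) :=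
            mul_le_mul (norm_regKer_le j hz) (hC z) (norm_nonneg _) (radKer_nonneg z)
        _ = _ := by ring
    · filter_upwards [ae_ne_zero hn] with z hz
      exact (tendsto_regKer j hz).mul_const _
  -- Integration by parts puts the divergence on the regularized kernel, where it is `n` times an
  -- approximate identity of mass `πⁿ/n!`.
  have heq : ∀ k : ℕ, ∑ j, ∫ z, regKer (1 / ((k : ℝ) + 1)) j z * wirt u j z =
      -(n : ℂ) * ∫ z, (((1 / ((k : ℝ) + 1)) ^ 2 *
      ((‖z‖ ^ 2 + (1 / ((k : ℝ) + 1)) ^ 2)⁻¹) ^ (n + 1) : ℝ) : ℂ) * u z := by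
    intro k
    have h1 : ∀ j : Fin n, _ := fun j => integral_mul_wirt
      ((contDiff_regKer (hpos k) j).of_le (by exact_mod_cast le_top)) hu hc j
    rw [Finset.sum_congr rfl fun j _ => (h1 j).2.2, Finset.sum_neg_distrib,
      ← integral_finsetSum _ fun j _ => (h1 j).2.1, neg_mul, ← integral_const_mul]
    congr 2
    funext z
    rw [← Finset.sum_mul, sum_wirt_regKer (nsq_add_ne_zero (hpos k) z)]
    ring
  simp only [heq] at hlim
  have h2 := (tendsto_integral_approx hn hu.continuous hc).const_mul (-(n : ℂ))
  rw [tendsto_nhds_unique hlim h2]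
  obtain ⟨m, rfl⟩ : ∃ m, n = m + 1 := ⟨n - 1, by omega⟩
  rw [Nat.add_sub_cancel, Nat.factorial_succ, ← mul_assoc]
  congr 1
  have : (m.factorial : ℂ) ≠ 0 := by exact_mod_cast m.factorial_ne_zero
  have h4 : ((m : ℂ) + 1) ≠ 0 := by exact_mod_cast Nat.succ_ne_zero m
  push_cast
  field_simp

/-- The Bochner–Martinelli formula for decreasing functions. -/
theorem bochnerMartinelli (hn : 1 ≤ n) {u : CSpace n → ℂ} (hu : ContDiff ℝ 1 u) {C : ℝ}
    (hC : ∀ z, ‖u z‖ ≤ C * ((1 + ‖z‖) ^ 2)⁻¹)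
    (hC' : ∀ j z, ‖wirt u j z‖ ≤ C * ((1 + ‖z‖) ^ 2)⁻¹) :
    ∑ j, ∫ z, bmKer j z * wirt u j z =
      -((Real.pi ^ n / (n - 1).factorial : ℝ) : ℂ) * u 0 := by
  let χ : ContDiffBump (0 : CSpace n) := ⟨1, 2, one_pos, one_lt_two⟩
  have hχs : ContDiff ℝ 1 (χ : CSpace n → ℝ) := χ.contDiff
  obtain ⟨K, hK⟩ := (χ.hasCompactSupport.fderiv (𝕜 := ℝ)).exists_bound_of_continuous
    (hχs.continuous_fderiv one_ne_zero)
  -- Dilated cutoffs: eventually 1 near each point, with values and derivatives bounded uniformly in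
  -- `k`, so the compactly supported case passes to the limit by domination.
  let c : ℕ → CSpace n → ℂ := fun k z => ((χ ((1 / ((k : ℝ) + 1)) • z) : ℝ) : ℂ)
  have hcs : ∀ k, ContDiff ℝ 1 (c k) := fun k =>
    Complex.ofRealCLM.contDiff.comp (hχs.comp (contDiff_const_smul _))
  have hpos : ∀ k : ℕ, (0 : ℝ) < 1 / ((k : ℝ) + 1) := fun k => by positivity
  have hle : ∀ k : ℕ, 1 / ((k : ℝ) + 1) ≤ 1 := fun k => by
    rw [div_le_one (by positivity)]
    linarith [Nat.cast_nonneg (α := ℝ) k]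
  have hcc : ∀ k, HasCompactSupport (c k) := fun k => by
    have h1 : HasCompactSupport fun z : CSpace n => χ ((1 / ((k : ℝ) + 1)) • z) :=
      χ.hasCompactSupport.comp_smul (hpos k).ne'
    exact h1.comp_left (g := fun x : ℝ => (x : ℂ)) Complex.ofReal_zero
  have hc1 : ∀ k z, ‖c k z‖ ≤ 1 := fun k z => by
    simp only [c]
    rw [Complex.norm_real, Real.norm_of_nonneg χ.nonneg]
    exact χ.le_one
  have hK0 : 0 ≤ K := (norm_nonneg _).trans (hK 0)
  have hcw : ∀ k j z, ‖wirt (c k) j z‖ ≤ K := fun k j z => by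
    refine (norm_wirt_le _ _ _).trans ?_
    have h1 : HasFDerivAt (c k) (Complex.ofRealCLM.comp ((fderiv ℝ χ ((1 / ((k : ℝ) + 1)) • z)).comp
        ((1 / ((k : ℝ) + 1)) • ContinuousLinearMap.id ℝ (CSpace n)))) z :=
      Complex.ofRealCLM.hasFDerivAt.comp z
        ((hχs.differentiable one_ne_zero _).hasFDerivAt.comp z
          ((1 / ((k : ℝ) + 1)) • ContinuousLinearMap.id ℝ (CSpace n)).hasFDerivAt)
    rw [h1.fderiv]
    refine ContinuousLinearMap.opNorm_le_bound _ hK0 fun v => ?_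
    change ‖((fderiv ℝ χ ((1 / ((k : ℝ) + 1)) • z) ((1 / ((k : ℝ) + 1)) • v) : ℝ) : ℂ)‖ ≤ _
    rw [Complex.norm_real]
    refine (ContinuousLinearMap.le_opNorm _ _).trans ?_
    refine mul_le_mul (hK _) ?_ (norm_nonneg _) hK0
    rw [norm_smul, Real.norm_of_nonneg (hpos k).le]
    exact mul_le_of_le_one_left (norm_nonneg _) (hle k)
  have hev : ∀ z : CSpace n, ∀ᶠ k : ℕ in atTop, c k =ᶠ[𝓝 z] fun _ => 1 := by
    intro z
    have h7 : Tendsto (fun k : ℕ => (1 / ((k : ℝ) + 1)) • z) atTop (𝓝 ((0 : ℝ) • z)) :=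
      tendsto_one_div_add_atTop_nhds_zero_nat.smul_const z
    rw [zero_smul] at h7
    filter_upwards [h7.eventually (Metric.ball_mem_nhds 0 one_pos)] with k hk
    have h8 : Tendsto (fun w : CSpace n => (1 / ((k : ℝ) + 1)) • w) (𝓝 z)
        (𝓝 ((1 / ((k : ℝ) + 1)) • z)) := (continuous_const_smul _).tendsto z
    filter_upwards [h8.eventually (Metric.isOpen_ball.mem_nhds hk)] with w hw
    have h9 : χ ((1 / ((k : ℝ) + 1)) • w) = 1 :=
      χ.one_of_mem_closedBall (Metric.ball_subset_closedBall hw)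
    simp only [c]
    rw [h9, Complex.ofReal_one]
  have hCn : 0 ≤ C := by
    have h := (norm_nonneg _).trans (hC 0)
    simpa using h
  have hlim : Tendsto (fun k : ℕ => ∑ j, ∫ z, bmKer j z * wirt (fun z => c k z * u z) j z) atTop
      (𝓝 (∑ j, ∫ z, bmKer j z * wirt u j z)) := by
    refine tendsto_finsetSum _ fun j _ => ?_
    refine tendsto_integral_of_dominated_convergence
      (fun z => (C + C * K) * (radKer n z * ((1 + ‖z‖) ^ 2)⁻¹)) (fun k => ?_)
      ((integrable_radKer hn).const_mul _) (fun k => ?_) ?_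
    · exact (measurable_bmKer j).aestronglyMeasurable.mul
        (continuous_wirt ((hcs k).mul hu) j).aestronglyMeasurable
    · refine Eventually.of_forall fun z => ?_
      rw [norm_mul, wirt_mul ((hcs k).differentiable one_ne_zero z)
        (hu.differentiable one_ne_zero z)]
      have h1 : ‖c k z * wirt u j z + u z * wirt (c k) j z‖ ≤
          (C + C * K) * ((1 + ‖z‖) ^ 2)⁻¹ := by
        refine (norm_add_le _ _).trans ?_
        rw [norm_mul, norm_mul]
        have a1 : ‖c k z‖ * ‖wirt u j z‖ ≤ 1 * (C * ((1 + ‖z‖) ^ 2)⁻¹) :=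
          mul_le_mul (hc1 k z) (hC' j z) (norm_nonneg _) zero_le_one
        have a2 : ‖u z‖ * ‖wirt (c k) j z‖ ≤ (C * ((1 + ‖z‖) ^ 2)⁻¹) * K :=
          mul_le_mul (hC z) (hcw k j z) (norm_nonneg _) (by positivity)
        linarith
      calc _ ≤ radKer n z * ((C + C * K) * ((1 + ‖z‖) ^ 2)⁻¹) :=
            mul_le_mul (norm_bmKer_le j z) h1 (norm_nonneg _) (radKer_nonneg z)
        _ = _ := by ring
    · refine Eventually.of_forall fun z => ?_
      refine Tendsto.const_mul _ ?_
      refine tendsto_const_nhds.congr' ?_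
      filter_upwards [hev z] with k hk
      refine wirt_congr ?_ j
      filter_upwards [hk] with w hw
      rw [hw, one_mul]
  have heq : ∀ k : ℕ, ∑ j, ∫ z, bmKer j z * wirt (fun z => c k z * u z) j z =
      -((Real.pi ^ n / (n - 1).factorial : ℝ) : ℂ) * u 0 := by
    intro k
    rw [bochnerMartinelli_of_hasCompactSupport hn ((hcs k).mul hu) (hcc k).mul_right]
    have : c k 0 = 1 := by
      simp only [c]
      rw [smul_zero, χ.one_of_mem_closedBall (Metric.mem_closedBall_self zero_le_one),
        Complex.ofReal_one]
    rw [this, one_mul]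
  simp only [heq] at hlim
  exact tendsto_nhds_unique hlim tendsto_const_nhds

/-- The pairing constant, the factor `(2πi)^{-n}` and the constant of the scalar formula multiply to
1: the orientation and the sign conventions agree with the reproducing formula. -/
theorem bmConst_eq (n : ℕ) :
    -bmScale n * bmNorm n * -((Real.pi ^ n / (n - 1).factorial : ℝ) : ℂ) = 1 := by
  have h1 : ((n - 1).factorial : ℂ) ≠ 0 := by exact_mod_cast Nat.factorial_ne_zero _
  have h2 : (Real.pi : ℂ) ≠ 0 := by exact_mod_cast Real.pi_ne_zero
  have h3 : (2 * Complex.I) ^ n * ((2 * Real.pi * Complex.I)⁻¹) ^ n * (Real.pi : ℂ) ^ n = 1 := by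
    rw [← mul_pow, ← mul_pow]
    have : 2 * Complex.I * (2 * Real.pi * Complex.I)⁻¹ * (Real.pi : ℂ) = 1 := by
      field_simp
    rw [this, one_pow]
  rw [bmScale, bmNorm]
  push_cast
  field_simp
  linear_combination h3

end BochnerMartinelli

/-! ### Smooth kernels -/

section Kernels

variable {n : ℕ}

/-- A cutoff equal to one near the origin and supported in the unit ball. -/
def kerBump (n : ℕ) : ContDiffBump (0 : CSpace n) := ⟨1 / 2, 1, by norm_num, by norm_num⟩

/-- A smooth positive function equal to `|z|² / (1 + |z|²)` off the unit ball. -/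
def satDen (z : CSpace n) : ℝ := 1 + (kerBump n z - 1) * invSq z

/-- A smooth kernel that agrees with the Bochner–Martinelli kernel off the unit ball. -/
def satKer (j : Fin n) (z : CSpace n) : ℂ :=
  dzbar j (invSq z • z) * Complex.ofRealCLM (invSq z ^ (n - 1) * ((satDen z)⁻¹) ^ n)

/-- The bump is 1 for `|z| ≤ 1/2`; beyond, the value is at least `1 - 1/(1 + 1/4) = 1/5`. -/
theorem satDen_ge (z : CSpace n) : 1 / 5 ≤ satDen z := by
  have h0 := invSq_pos z
  have h1 : invSq z * (1 + ‖z‖ ^ 2) = 1 := by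
    unfold invSq
    exact inv_mul_cancel₀ (by positivity)
  by_cases h : ‖z‖ ≤ 1 / 2
  · have h2 : kerBump n z = 1 :=
      (kerBump n).one_of_mem_closedBall (by simpa [kerBump] using h)
    rw [satDen, h2]
    norm_num
  · have h2 : 0 ≤ kerBump n z := (kerBump n).nonneg
    push Not at h
    have h3 : 1 / 4 ≤ ‖z‖ ^ 2 := by nlinarith
    rw [satDen]
    nlinarith [mul_nonneg h2 h0.le]

theorem IsSymbol.mul_real {P : Type*} [NormedAddCommGroup P] [NormedSpace ℝ P] {w₁ w₂ : P → ℝ}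
    {f g : P → ℝ} (hf : IsSymbol w₁ f) (hg : IsSymbol w₂ g) :
    IsSymbol (fun x => w₁ x * w₂ x) (fun x => f x * g x) :=
  hf.bilin (ContinuousLinearMap.mul ℝ ℝ) hg

theorem IsSymbol.pow_one {P : Type*} [NormedAddCommGroup P] [NormedSpace ℝ P]
    {f : P → ℝ} (hf : IsSymbol (fun _ => 1) f) (k : ℕ) :
    IsSymbol (fun _ => 1) (fun x => f x ^ k) := by
  induction k with
  | zero => simpa using IsSymbol.const (P := P) (1 : ℝ)
  | succ k ih => simpa [pow_succ] using ih.mul_real hf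

theorem isSymbol_invSq_one {H : Type*} [NormedAddCommGroup H] [InnerProductSpace ℝ H] :
    IsSymbol (fun _ => 1) (invSq : H → ℝ) :=
  isSymbol_invSq.mono zero_le_one fun x => by
    rw [one_mul]
    exact inv_le_one_of_one_le₀ (by linarith [norm_nonneg x])

theorem isSymbol_satDen : IsSymbol (fun _ => 1) (satDen : CSpace n → ℝ) := by
  have h1 : IsSymbol (fun _ => 1) (fun z : CSpace n => kerBump n z + -1) :=
    (IsSymbol.of_hasCompactSupport (kerBump n).contDiff (kerBump n).hasCompactSupport).add
      ((IsSymbol.const (-1 : ℝ)))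
  have h2 := (IsSymbol.const (P := CSpace n) (1 : ℝ)).add
    (by simpa using h1.mul_real isSymbol_invSq_one)
  have e : (satDen : CSpace n → ℝ) = fun z => 1 + (kerBump n z + -1) * invSq z := by
    funext z
    rw [satDen, sub_eq_add_neg]
  rw [e]
  exact h2

theorem isSymbol_satKer (j : Fin n) : IsSymbol (fun _ => 1) (satKer j : CSpace n → ℂ) := by
  have h1 : IsSymbol (fun _ => 1) (fun z : CSpace n => dzbar j (invSq z • z)) :=
    (isSymbol_invSq_smul.clm_comp (dzbar j)).mono zero_le_one fun x => by
      rw [one_mul]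
      exact inv_le_one_of_one_le₀ (by linarith [norm_nonneg x])
  have h2 : IsSymbol (fun _ => 1) (fun z : CSpace n => invSq z ^ (n - 1) * ((satDen z)⁻¹) ^ n) := by
    simpa using (isSymbol_invSq_one.pow_one (n - 1)).mul_real
      ((isSymbol_satDen.inv (by norm_num) satDen_ge).pow_one n)
  have h3 := h1.mul (h2.clm_comp Complex.ofRealCLM)
  simp only [mul_one] at h3
  exact h3

/-- The smooth kernel is `z̄ⱼ(|z|² + bump)^{-n}`, written through `invSq` so that each factor
visibly has bounded derivatives; the bump vanishes for `|z| ≥ 1`. -/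
theorem satKer_eq (hn : 1 ≤ n) (j : Fin n) {z : CSpace n} (hz : 1 ≤ ‖z‖) :
    satKer j z = bmKer j z := by
  have h2 : kerBump n z = 0 := (kerBump n).zero_of_le_dist (by simpa [kerBump] using hz)
  have h0 := invSq_pos z
  have h1 : invSq z * (1 + ‖z‖ ^ 2) = 1 := by
    unfold invSq
    exact inv_mul_cancel₀ (by positivity)
  have h3 : satDen z = invSq z * ‖z‖ ^ 2 := by
    rw [satDen, h2]
    linarith
  rw [satKer, bmKer, h3, nsq_eq_ofReal, map_smul, Complex.real_smul, Complex.ofRealCLM_apply,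
    mul_comm ((invSq z : ℝ) : ℂ), mul_assoc, ← Complex.ofReal_mul, ← Complex.ofReal_inv,
    ← Complex.ofReal_pow]
  congr 2
  obtain ⟨m, rfl⟩ : ∃ m, n = m + 1 := ⟨n - 1, by omega⟩
  rw [Nat.add_sub_cancel, mul_inv, mul_pow, ← mul_assoc, ← pow_succ', ← mul_assoc, ← mul_pow,
    mul_inv_cancel₀ h0.ne', one_pow, one_mul]

/-- The smooth kernels at scale `δ`. -/
def scaledKer (δ : ℝ) (j : Fin n) (z : CSpace n) : ℂ :=
  ((δ⁻¹ ^ (2 * n - 1) : ℝ) : ℂ) * satKer j (δ⁻¹ • z)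

/-- The Bochner–Martinelli kernel is homogeneous of degree `1 - 2n`, which the prefactor
`δ^{-(2n-1)}` compensates. -/
theorem scaledKer_eq (hn : 1 ≤ n) {δ : ℝ} (hδ : 0 < δ) (j : Fin n) {z : CSpace n} (hz : δ ≤ ‖z‖) :
    scaledKer δ j z = bmKer j z := by
  have h1 : 1 ≤ ‖δ⁻¹ • z‖ := by
    rw [norm_smul, norm_inv, Real.norm_of_nonneg hδ.le, ← div_eq_inv_mul, le_div_iff₀ hδ]
    simpa using hz
  rw [scaledKer, satKer_eq hn j h1, bmKer, bmKer, map_smul, Complex.real_smul]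
  have h2 : nsq (δ⁻¹ • z) = ((δ⁻¹ ^ 2 : ℝ) : ℂ) * nsq z := by
    rw [nsq_eq_ofReal, nsq_eq_ofReal, norm_smul, mul_pow, norm_inv, Real.norm_of_nonneg hδ.le,
      Complex.ofReal_mul]
  have h3 : (δ : ℂ) ≠ 0 := by exact_mod_cast hδ.ne'
  rw [h2]
  obtain ⟨m, rfl⟩ : ∃ m, n = m + 1 := ⟨n - 1, by omega⟩
  rw [show 2 * (m + 1) - 1 = 2 * m + 1 by omega, mul_inv, mul_pow]
  push_cast
  have h4 : ((δ : ℂ)⁻¹ ^ (2 * m + 1)) * (δ : ℂ)⁻¹ * ((((δ : ℂ)⁻¹ ^ 2)⁻¹) ^ (m + 1)) = 1 := by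
    rw [← pow_succ, inv_pow ((δ : ℂ)⁻¹ ^ 2), ← pow_mul, show 2 * m + 1 + 1 = 2 * (m + 1) by ring]
    exact mul_inv_cancel₀ (pow_ne_zero _ (inv_ne_zero h3))
  linear_combination (dzbar j z * (nsq z)⁻¹ ^ (m + 1)) * h4

/-- The inclusion of `ℝⁿ` in `ℂⁿ`, as a linear map. -/
def toCL (n : ℕ) : RSpace n →L[ℝ] CSpace n :=
  LinearMap.toContinuousLinearMap
    { toFun := toC
      map_add' := fun x y => by
        ext j
        simp [toC]
      map_smul' := fun c x => by
        ext j
        simp [toC] }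

@[simp] theorem toCL_apply (ξ : RSpace n) : toCL n ξ = toC ξ := rfl

theorem norm_toC (ξ : RSpace n) : ‖toC ξ‖ = ‖ξ‖ := by
  rw [EuclideanSpace.norm_eq, EuclideanSpace.norm_eq]
  simp [toC]

/-- The map `(ζ, ξ) ↦ ζ - ξ`. -/
def diffL (n : ℕ) : CSpace n × RSpace n →L[ℝ] CSpace n :=
  ContinuousLinearMap.fst ℝ _ _ - (toCL n).comp (ContinuousLinearMap.snd ℝ _ _)

/-- Each derivative costs one factor `δ⁻¹`. The constant does not depend on `δ`, so the blow-up of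
the kernel at the real space is polynomial of known order. -/
theorem derivBound_scaledKer (j : Fin n) (N : ℕ) : ∃ C : ℝ, 0 ≤ C ∧ ∀ δ : ℝ, 0 < δ → δ ≤ 1 →
    DerivBound N (fun _ => C * δ⁻¹ ^ (2 * n - 1 + N))
      (fun p : CSpace n × RSpace n => scaledKer δ j (p.1 - toC p.2)) := by
  obtain ⟨C, hC, h⟩ := isSymbol_satKer j N
  refine ⟨max 1 ‖diffL n‖ ^ N * C, by positivity, fun δ hδ hδ1 => ?_⟩
  have h1 := (h.comp_clm (δ⁻¹ • ContinuousLinearMap.id ℝ (CSpace n))).comp_clm (diffL n)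
  have h2 := h1.clm_comp ((δ⁻¹ ^ (2 * n - 1)) • ContinuousLinearMap.id ℝ ℂ)
  refine DerivBound.mono (w₁ := fun p => ‖(δ⁻¹ ^ (2 * n - 1)) • ContinuousLinearMap.id ℝ ℂ‖ *
    (max 1 ‖diffL n‖ ^ N * (max 1 ‖δ⁻¹ • ContinuousLinearMap.id ℝ (CSpace n)‖ ^ N * (C * 1))))
    h2 fun p => ?_
  have h3 : (1 : ℝ) ≤ δ⁻¹ := (one_le_inv₀ hδ).2 hδ1
  have h4 : max 1 ‖δ⁻¹ • ContinuousLinearMap.id ℝ (CSpace n)‖ ≤ δ⁻¹ := by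
    refine max_le h3 ?_
    rw [norm_smul, Real.norm_of_nonneg (by positivity)]
    exact mul_le_of_le_one_right (by positivity) ContinuousLinearMap.norm_id_le
  have h5 : ‖(δ⁻¹ ^ (2 * n - 1)) • ContinuousLinearMap.id ℝ ℂ‖ ≤ δ⁻¹ ^ (2 * n - 1) := by
    rw [norm_smul, Real.norm_of_nonneg (by positivity)]
    exact mul_le_of_le_one_right (by positivity) ContinuousLinearMap.norm_id_le
  rw [pow_add, mul_one]
  calc _ ≤ δ⁻¹ ^ (2 * n - 1) * (max 1 ‖diffL n‖ ^ N * (δ⁻¹ ^ N * C)) := by gcongr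
    _ = _ := by ring

theorem peak_eq (ξ : RSpace n) (ζ : CSpace n) : peak ξ ζ =
    Complex.ofRealCLM (invSq ξ) + ∑ j, dz j ζ * Complex.ofRealCLM ((invSq ξ • ξ) j) := by
  have h : (1 + (‖ξ‖ : ℂ) ^ 2)⁻¹ = Complex.ofRealCLM (invSq ξ) := by
    rw [Complex.ofRealCLM_apply, invSq]
    push_cast
    rfl
  rw [peak, dotC, div_eq_mul_inv, h, add_mul, one_mul, Finset.sum_mul]
  congr 1
  refine Finset.sum_congr rfl fun j _ => ?_
  simp only [Complex.ofRealCLM_apply, PiLp.smul_apply, smul_eq_mul, dz_apply]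
  push_cast
  ring

/-- Both `(1 + |ξ|²)⁻¹` and `(1 + |ξ|²)⁻¹ ξ` are symbols of decay 1, and the dependence on `ζ` is
affine. Decay in `ξ` is bought with growth in `ζ`. -/
theorem isSymbol_peak : IsSymbol (fun p : CSpace n × RSpace n => (1 + ‖p.1‖) * (1 + ‖p.2‖)⁻¹)
    (fun p => peak p.2 p.1) := by
  simp only [peak_eq]
  refine IsSymbol.add ?_ (IsSymbol.sum _ fun j _ => ?_)
  · refine ((isSymbol_invSq.clm_comp Complex.ofRealCLM).comp_clm
      (ContinuousLinearMap.snd ℝ (CSpace n) (RSpace n))).mono zero_le_one fun p => ?_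
    rw [one_mul]
    exact le_mul_of_one_le_left (by positivity) (by linarith [norm_nonneg p.1])
  · exact ((IsSymbol.of_clm (dz j)).comp_clm (ContinuousLinearMap.fst ℝ (CSpace n) (RSpace n))).mul
      (((isSymbol_invSq_smul.clm_comp (EuclideanSpace.proj (𝕜 := ℝ) j)).clm_comp
        Complex.ofRealCLM).comp_clm (ContinuousLinearMap.snd ℝ (CSpace n) (RSpace n)))

/-- The modified kernels, cut off in the parameter. -/
def cutKer (χ : RSpace n → ℂ) (m : ℕ) (δ : ℝ) (j : Fin n) (p : CSpace n × RSpace n) : ℂ :=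
  χ p.2 * (peak p.2 p.1 ^ m * scaledKer δ j (p.1 - toC p.2))

theorem derivBound_cutKer {χ : RSpace n → ℂ} (hχ : IsSymbol (fun _ => 1) χ) (m : ℕ) (j : Fin n)
    (N : ℕ) : ∃ C : ℝ, 0 ≤ C ∧ ∀ δ : ℝ, 0 < δ → δ ≤ 1 →
    DerivBound N (fun p => C * δ⁻¹ ^ (2 * n - 1 + N) * ((1 + ‖p.1‖) ^ m * ((1 + ‖p.2‖) ^ m)⁻¹))
      (cutKer χ m δ j) := by
  obtain ⟨C₁, hC₁, h₁⟩ := derivBound_scaledKer j N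
  obtain ⟨C₂, hC₂, h₂⟩ := (isSymbol_peak (n := n)).pow m N
  obtain ⟨C₃, hC₃, h₃⟩ := hχ.comp_clm (ContinuousLinearMap.snd ℝ (CSpace n) (RSpace n)) N
  refine ⟨2 ^ N * (C₃ * (2 ^ N * (C₂ * C₁))), by positivity, fun δ hδ hδ1 => ?_⟩
  refine (h₃.mul (h₂.mul (h₁ δ hδ hδ1))).mono fun p => le_of_eq ?_
  simp only [mul_pow, inv_pow]
  ring

theorem jointDecays_cutKer {χ : RSpace n → ℂ} (hχ : IsSymbol (fun _ => 1) χ) {m M : ℕ}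
    (hm : M + 1 ≤ m) {δ : ℝ} (hδ : 0 < δ) (hδ1 : δ ≤ 1) (j : Fin n) :
    JointDecays M (cutKer χ m δ j) := by
  intro N
  obtain ⟨C, hC, h⟩ := derivBound_cutKer hχ m j N
  refine ⟨C * δ⁻¹ ^ (2 * n - 1 + N), m, by positivity, (h δ hδ hδ1).mono fun p => ?_⟩
  rw [mul_assoc (C * δ⁻¹ ^ (2 * n - 1 + N))]
  have h1 : ((1 + ‖p.2‖) ^ m)⁻¹ ≤ ((1 + ‖p.2‖) ^ (M + 1))⁻¹ := by
    refine inv_anti₀ (by positivity) (pow_le_pow_right₀ (by linarith [norm_nonneg p.2]) hm)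
  gcongr

/-- Jets of order `M` involve `M` derivatives, whence the exponent `2n - 1 + M`, which is the order
of flatness that the integral representation later demands. -/
theorem norm_jetOf_cutKer_le {χ : RSpace n → ℂ} (hχ : IsSymbol (fun _ => 1) χ) {m M : ℕ}
    (hm : M + 1 ≤ m) (j : Fin n) : ∃ C : ℝ, 0 ≤ C ∧ ∀ δ : ℝ, 0 < δ → δ ≤ 1 → ∀ ζ : CSpace n,
    ‖jetOf M fun ξ => cutKer χ m δ j (ζ, ξ)‖ ≤ C * δ⁻¹ ^ (2 * n - 1 + M) * (1 + ‖ζ‖) ^ m := by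
  obtain ⟨C, hC, h⟩ := derivBound_cutKer hχ m j M
  refine ⟨C, hC, fun δ hδ hδ1 ζ => norm_jetOf_le (by positivity)
    ((jointDecays_cutKer hχ hm hδ hδ1 j).decays ζ) fun ξ i hi => ?_⟩
  have h1 := ((h δ hδ hδ1).slice ζ).2 ξ i hi
  have h2 : (1 + ‖ξ‖) ^ M * ((1 + ‖ξ‖) ^ m)⁻¹ ≤ 1 := by
    rw [← div_eq_mul_inv, div_le_one (by positivity)]
    exact pow_le_pow_right₀ (by linarith [norm_nonneg ξ]) (by omega)
  calc _ ≤ (1 + ‖ξ‖) ^ M * (C * δ⁻¹ ^ (2 * n - 1 + M) * ((1 + ‖ζ‖) ^ m * ((1 + ‖ξ‖) ^ m)⁻¹)) := by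
        gcongr
    _ = (C * δ⁻¹ ^ (2 * n - 1 + M) * (1 + ‖ζ‖) ^ m) * ((1 + ‖ξ‖) ^ M * ((1 + ‖ξ‖) ^ m)⁻¹) := by ring
    _ ≤ (C * δ⁻¹ ^ (2 * n - 1 + M) * (1 + ‖ζ‖) ^ m) * 1 := by gcongr
    _ = _ := mul_one _

theorem wirt_comp_sub {F : Type*} [NormedAddCommGroup F] [NormedSpace ℂ F] (g : CSpace n → F)
    (a : CSpace n) (j : Fin n) (ζ : CSpace n) :
    wirt (fun z => g (z - a)) j ζ = wirt g j (ζ - a) := by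
  rw [wirt, wirt, fderiv_comp_sub]

/-- The factor is an affine function of the `zⱼ`, hence holomorphic; this is why modifying the form
does not disturb closedness. -/
theorem wirt_peak (ξ : RSpace n) (j : Fin n) (ζ : CSpace n) : wirt (peak ξ) j ζ = 0 := by
  have h : HasFDerivAt (peak ξ) (∑ j, Complex.ofRealCLM ((invSq ξ • ξ) j) • dz j) ζ := by
    rw [show peak ξ = fun ζ => Complex.ofRealCLM (invSq ξ) +
      ∑ j, dz j ζ * Complex.ofRealCLM ((invSq ξ • ξ) j) from funext (peak_eq ξ)]
    refine HasFDerivAt.const_add _ (HasFDerivAt.fun_sum fun j _ => ?_)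
    exact (dz j).hasFDerivAt.mul_const _
  rw [wirt_of_hasFDerivAt h, conjPart_sum, Finset.sum_eq_zero]
  · rfl
  · intro k _
    rw [conjPart_smul, conjPart_dz, smul_zero]

theorem contDiff_peak (ξ : RSpace n) : ContDiff ℝ ∞ (peak ξ) := by
  rw [show peak ξ = fun ζ => Complex.ofRealCLM (invSq ξ) +
      ∑ j, dz j ζ * Complex.ofRealCLM ((invSq ξ • ξ) j) from funext (peak_eq ξ)]
  fun_prop

theorem peak_self (ξ : RSpace n) : peak ξ (toC ξ) = 1 := by
  have h : dotC (toC ξ) ξ = (‖ξ‖ : ℂ) ^ 2 := by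
    rw [dotC, ← Complex.ofReal_pow, EuclideanSpace.norm_sq_eq, Complex.ofReal_sum]
    refine Finset.sum_congr rfl fun j _ => ?_
    simp only [toC, Real.norm_eq_abs, sq_abs]
    push_cast
    ring
  rw [peak, h, div_self]
  exact_mod_cast (by positivity : 1 + ‖ξ‖ ^ 2 ≠ 0)

theorem contDiffAt_bmKer (j : Fin n) {z : CSpace n} (hz : z ≠ 0) : ContDiffAt ℝ ∞ (bmKer j) z := by
  unfold bmKer
  exact (dzbar j).contDiff.contDiffAt.mul ((contDiff_nsq.contDiffAt.inv (nsq_ne_zero hz)).pow n)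

/-- The coefficients of the modified Bochner–Martinelli form. -/
def modKer (m : ℕ) (j : Fin n) (ζ : CSpace n) (ξ : RSpace n) : ℂ :=
  peak ξ ζ ^ m * bmKer j (ζ - toC ξ)

theorem sum_wirt_modKer (m : ℕ) {ζ : CSpace n} {ξ : RSpace n} (h : ζ ≠ toC ξ) :
    ∑ j, wirt (fun z => modKer m j z ξ) j ζ = 0 := by
  have h0 : ζ - toC ξ ≠ 0 := sub_ne_zero.2 h
  have h1 : ∀ j : Fin n, wirt (fun z => modKer m j z ξ) j ζ =
      peak ξ ζ ^ m * wirt (bmKer j) j (ζ - toC ξ) := by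
    intro j
    have hp : DifferentiableAt ℝ (peak ξ) ζ := (contDiff_peak ξ).differentiable (by simp) ζ
    have hb : DifferentiableAt ℝ (fun z => bmKer j (z - toC ξ)) ζ :=
      DifferentiableAt.comp (g := bmKer j) (f := fun z => z - toC ξ) ζ
        ((contDiffAt_bmKer j h0).differentiableAt (by simp)) (by fun_prop)
    have h2 := wirt_mul (hp.fun_pow m) hb j
    refine h2.trans ?_
    rw [wirt_pow hp, wirt_peak, mul_zero, mul_zero, add_zero, wirt_comp_sub]
  rw [Finset.sum_congr rfl fun j _ => h1 j, ← Finset.mul_sum, sum_wirt_bmKer h0, mul_zero]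

end Kernels

/-! ### The real subspace -/

section RealSubspace

variable {n : ℕ}

/-- The imaginary part, as a linear map. -/
def imL (n : ℕ) : CSpace n →L[ℝ] RSpace n :=
  LinearMap.toContinuousLinearMap
    { toFun := imPart
      map_add' := fun x y => by
        ext j
        simp [imPart]
      map_smul' := fun c x => by
        ext j
        simp [imPart] }

@[simp] theorem imL_apply (ζ : CSpace n) : imL n ζ = imPart ζ := rfl

theorem continuous_imPart : Continuous (imPart : CSpace n → RSpace n) := (imL n).continuous

theorem imPart_toC (ξ : RSpace n) : imPart (toC ξ) = 0 := by
  ext j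
  simp [imPart, toC]

theorem imPart_sub_toC (ζ : CSpace n) (ξ : RSpace n) : imPart (ζ - toC ξ) = imPart ζ := by
  rw [← imL_apply, map_sub, imL_apply, imL_apply, imPart_toC, sub_zero]

theorem norm_imPart_le (ζ : CSpace n) : ‖imPart ζ‖ ≤ ‖ζ‖ := by
  rw [EuclideanSpace.norm_eq, EuclideanSpace.norm_eq]
  refine Real.sqrt_le_sqrt (Finset.sum_le_sum fun j _ => ?_)
  have h : ‖(imPart ζ) j‖ ≤ ‖ζ j‖ := Complex.abs_im_le_norm (ζ j)
  gcongr

theorem norm_imPart_le_sub (ζ : CSpace n) (ξ : RSpace n) : ‖imPart ζ‖ ≤ ‖ζ - toC ξ‖ := by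
  rw [← imPart_sub_toC ζ ξ]
  exact norm_imPart_le _

theorem mem_realSet_iff (ζ : CSpace n) : ζ ∈ realSet n ↔ imPart ζ = 0 := by
  constructor
  · rintro ⟨ξ, rfl⟩
    exact imPart_toC ξ
  · intro h
    refine ⟨WithLp.toLp 2 fun j => (ζ j).re, ?_⟩
    ext j
    have h2 : (ζ j).im = 0 := congrArg (fun v : RSpace n => v j) h
    apply Complex.ext <;> simp [toC, h2]

theorem imPart_pos {ζ : CSpace n} (h : ζ ∉ realSet n) : 0 < ‖imPart ζ‖ := by
  rw [mem_realSet_iff] at h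
  exact norm_pos_iff.2 h

theorem isClosed_realSet : IsClosed (realSet n) := by
  have : realSet n = imPart ⁻¹' {0} := by
    ext ζ
    exact mem_realSet_iff ζ
  rw [this]
  exact isClosed_singleton.preimage continuous_imPart

theorem ae_notMem_realSet (hn : 1 ≤ n) : ∀ᵐ ζ : CSpace n, ζ ∉ realSet n := by
  have h1 : (realSet n : Set (CSpace n)) = (LinearMap.ker (imL n).toLinearMap : Set (CSpace n)) := by
    ext ζ
    rw [mem_realSet_iff]
    rfl
  have h2 : LinearMap.ker (imL n).toLinearMap ≠ ⊤ := by
    intro h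
    have h3 : Complex.I • (eC ⟨0, hn⟩ : CSpace n) ∈ LinearMap.ker (imL n).toLinearMap := by
      rw [h]
      trivial
    have h4 := congrArg (fun v : RSpace n => v ⟨0, hn⟩) (LinearMap.mem_ker.1 h3)
    simp [imPart] at h4
  have h5 := Measure.addHaar_submodule (volume : Measure (CSpace n)) _ h2
  rw [← h1] at h5
  exact measure_eq_zero_iff_ae_notMem.1 h5

theorem dense_compl_realSet (hn : 1 ≤ n) : Dense ((realSet n)ᶜ : Set (CSpace n)) :=
  Measure.dense_of_ae (ae_notMem_realSet hn)

theorem dist_toC (ξ η : RSpace n) : ‖toC ξ - toC η‖ = ‖ξ - η‖ := by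
  rw [← toCL_apply, ← toCL_apply, ← map_sub, toCL_apply, norm_toC]

end RealSubspace

/-! ### The operator-valued form -/

section OperatorForm

variable {n : ℕ} {X : Type*} [NormedAddCommGroup X] [NormedSpace ℂ X] [CompleteSpace X]
  {M m : ℕ} {B : 𝓢(RSpace n, ℂ) →L[ℂ] (X →L[ℂ] X)}

theorem wirt_jetOf {f : CSpace n × RSpace n → ℂ} (hf : JointDecays M f) (j : Fin n)
    (ζ : CSpace n) (ξ : RSpace n) :
    evalJet M ξ (wirt (fun z => jetOf M fun ξ => f (z, ξ)) j ζ) =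
      wirt (fun z => f (z, ξ)) j ζ := by
  rw [← wirt_clm_comp (evalJet M ξ) (hasFDerivAt_jetOf hf ζ).differentiableAt]
  congr 1
  funext z
  exact evalJet_jetOf (hf.decays z) ξ

theorem sum_wirt_jetOf_eq_zero {f : Fin n → CSpace n × RSpace n → ℂ}
    (hf : ∀ j, JointDecays M (f j)) {ζ : CSpace n}
    (h : ∀ ξ, ∑ j, wirt (fun z => f j (z, ξ)) j ζ = 0) :
    ∑ j, wirt (fun z => jetOf M fun ξ => f j (z, ξ)) j ζ = 0 := by
  refine jet_ext fun ξ => ?_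
  rw [map_sum, map_zero, Finset.sum_congr rfl fun j _ => wirt_jetOf (hf j) j ζ ξ]
  exact h ξ

theorem cutKer_eq (hn : 1 ≤ n) {χ : RSpace n → ℂ} {δ : ℝ} (hδ : 0 < δ) (j : Fin n) {ζ : CSpace n}
    {ξ : RSpace n} (h : χ ξ = 0 ∨ δ ≤ ‖ζ - toC ξ‖) :
    cutKer χ m δ j (ζ, ξ) = χ ξ * modKer m j ζ ξ := by
  rcases h with h | h
  · simp [cutKer, h]
  · rw [cutKer, modKer, scaledKer_eq hn hδ j h]

theorem sum_wirt_cutKer (hn : 1 ≤ n) {χ : RSpace n → ℂ} {δ : ℝ} (hδ : 0 < δ) {ζ : CSpace n}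
    (h : ∀ᶠ z in 𝓝 ζ, ∀ ξ, χ ξ = 0 ∨ δ ≤ ‖z - toC ξ‖) (ξ : RSpace n) :
    ∑ j, wirt (fun z => cutKer χ m δ j (z, ξ)) j ζ = 0 := by
  by_cases hχ : χ ξ = 0
  · refine Finset.sum_eq_zero fun j _ => ?_
    have e : (fun z : CSpace n => cutKer χ m δ j (z, ξ)) = fun _ => 0 := by
      funext z
      simp [cutKer, hχ]
    rw [e, wirt, fderiv_fun_const]
    change conjPart (0 : CSpace n →L[ℝ] ℂ) _ = 0
    rw [conjPart_zero]
    rfl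
  · have hne : ζ ≠ toC ξ := by
      rintro rfl
      rcases h.self_of_nhds ξ with h1 | h1
      · exact hχ h1
      · rw [sub_self, norm_zero] at h1
        linarith
    have h1 : ∀ j : Fin n, wirt (fun z => cutKer χ m δ j (z, ξ)) j ζ =
        χ ξ * wirt (fun z => modKer m j z ξ) j ζ := by
      intro j
      have hd : DifferentiableAt ℝ (fun z => modKer m j z ξ) ζ := by
        have hb : DifferentiableAt ℝ (fun z => bmKer j (z - toC ξ)) ζ :=
          DifferentiableAt.comp (g := bmKer j) (f := fun z => z - toC ξ) ζ
            ((contDiffAt_bmKer j (sub_ne_zero.2 hne)).differentiableAt (by simp)) (by fun_prop)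
        exact ((contDiff_peak ξ).differentiable (by simp) ζ).fun_pow m |>.mul hb
      refine Eq.trans ?_ (wirt_clm_comp (χ ξ • ContinuousLinearMap.id ℂ ℂ) hd j)
      refine wirt_congr ?_ j
      filter_upwards [h] with z hz
      rw [cutKer_eq hn hδ j (hz ξ)]
      rfl
    rw [Finset.sum_congr rfl fun j _ => h1 j, ← Finset.mul_sum, sum_wirt_modKer m hne, mul_zero]

/-- The coefficients of the operator-valued form. -/
def opKer (M : ℕ) (B : 𝓢(RSpace n, ℂ) →L[ℂ] (X →L[ℂ] X)) (m : ℕ) (j : Fin n) (ζ : CSpace n) :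
    X →L[ℂ] X := bmNorm n • extJet M B (jetOf M (modKer m j ζ))

/-- The operator-valued Bochner–Martinelli form. -/
def opForm (M : ℕ) (B : 𝓢(RSpace n, ℂ) →L[ℂ] (X →L[ℂ] X)) (m : ℕ) (ζ : CSpace n) :
    Covec n (1 + 2 * (n - 1)) (X →L[ℂ] X) := bmComb fun j => opKer M B m j ζ

/-- The coefficients of the cut-off operator-valued form. -/
def opCutKer (M : ℕ) (B : 𝓢(RSpace n, ℂ) →L[ℂ] (X →L[ℂ] X)) (χ : RSpace n → ℂ) (m : ℕ) (δ : ℝ)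
    (j : Fin n) (ζ : CSpace n) : X →L[ℂ] X :=
  bmNorm n • extJet M B (jetOf M fun ξ => cutKer χ m δ j (ζ, ξ))

/-- The cut-off operator-valued form. -/
def opCutForm (M : ℕ) (B : 𝓢(RSpace n, ℂ) →L[ℂ] (X →L[ℂ] X)) (χ : RSpace n → ℂ) (m : ℕ) (δ : ℝ)
    (ζ : CSpace n) : Covec n (1 + 2 * (n - 1)) (X →L[ℂ] X) :=
  bmComb fun j => opCutKer M B χ m δ j ζ

theorem contDiff_opCutKer (B : 𝓢(RSpace n, ℂ) →L[ℂ] (X →L[ℂ] X)) {χ : RSpace n → ℂ}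
    (hχ : IsSymbol (fun _ => 1) χ) (hm : M + 1 ≤ m)
    {δ : ℝ} (hδ : 0 < δ) (hδ1 : δ ≤ 1) (j : Fin n) : ContDiff ℝ ∞ (opCutKer M B χ m δ j) :=
  (((extJet M B).restrictScalars ℝ).contDiff.comp
    (contDiff_jetOf (jointDecays_cutKer hχ hm hδ hδ1 j))).const_smul _

theorem contDiff_bmComb {F : Type*} [NormedAddCommGroup F] [NormedSpace ℂ F]
    {g : Fin n → CSpace n → F} (h : ∀ j, ContDiff ℝ ∞ (g j)) :
    ContDiff ℝ ∞ fun ζ => bmComb fun j => g j ζ := by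
  have h1 : ContDiff ℝ ∞ fun ζ j => g j ζ := contDiff_pi.2 h
  have h2 := ((bmCombL (n := n) (F := F)).restrictScalars ℝ).contDiff.comp h1
  have e : (fun ζ => bmComb fun j => g j ζ) =
      ((bmCombL (n := n) (F := F)).restrictScalars ℝ) ∘ fun ζ j => g j ζ :=
    funext fun z => (bmCombL_apply _).symm
  rw [e]
  exact h2

theorem contDiff_opCutForm (B : 𝓢(RSpace n, ℂ) →L[ℂ] (X →L[ℂ] X)) {χ : RSpace n → ℂ}
    (hχ : IsSymbol (fun _ => 1) χ) (hm : M + 1 ≤ m)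
    {δ : ℝ} (hδ : 0 < δ) (hδ1 : δ ≤ 1) : ContDiff ℝ ∞ (opCutForm M B χ m δ) :=
  contDiff_bmComb fun j => contDiff_opCutKer B hχ hm hδ hδ1 j

theorem dbar_opCutForm (hn : 1 ≤ n) (B : 𝓢(RSpace n, ℂ) →L[ℂ] (X →L[ℂ] X)) {χ : RSpace n → ℂ}
    (hχ : IsSymbol (fun _ => 1) χ) (hm : M + 1 ≤ m)
    {δ : ℝ} (hδ : 0 < δ) (hδ1 : δ ≤ 1) {ζ : CSpace n}
    (h : ∀ᶠ z in 𝓝 ζ, ∀ ξ, χ ξ = 0 ∨ δ ≤ ‖z - toC ξ‖) : dbar (opCutForm M B χ m δ) ζ = 0 := by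
  refine dbar_bmComb_eq_zero hn (fun j =>
    (contDiff_opCutKer B hχ hm hδ hδ1 j).differentiable (by simp) ζ) ?_
  have h1 : ∀ j : Fin n, wirt (opCutKer M B χ m δ j) j ζ =
      (bmNorm n • extJet M B) (wirt (fun z => jetOf M fun ξ => cutKer χ m δ j (z, ξ)) j ζ) := by
    intro j
    rw [← wirt_clm_comp (bmNorm n • extJet M B)
      (hasFDerivAt_jetOf (jointDecays_cutKer hχ hm hδ hδ1 j) ζ).differentiableAt]
    rfl
  rw [Finset.sum_congr rfl fun j _ => h1 j, ← map_sum,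
    sum_wirt_jetOf_eq_zero (fun j => jointDecays_cutKer hχ hm hδ hδ1 j)
      (sum_wirt_cutKer hn hδ h), map_zero]

theorem isSymbol_one : IsSymbol (fun _ => 1) (fun _ : RSpace n => (1 : ℂ)) := IsSymbol.const 1

theorem cutKer_one_eq (hn : 1 ≤ n) {δ : ℝ} (hδ : 0 < δ) (j : Fin n) {ζ : CSpace n}
    (h : δ ≤ ‖imPart ζ‖) :
    (fun ξ => cutKer (fun _ => 1) m δ j (ζ, ξ)) = modKer m j ζ := by
  funext ξ
  rw [cutKer_eq hn hδ j (Or.inr (h.trans (norm_imPart_le_sub ζ ξ))), one_mul]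

theorem opKer_eq (hn : 1 ≤ n) (B : 𝓢(RSpace n, ℂ) →L[ℂ] (X →L[ℂ] X)) {δ : ℝ} (hδ : 0 < δ)
    (j : Fin n) {ζ : CSpace n} (h : δ ≤ ‖imPart ζ‖) :
    opKer M B m j ζ = opCutKer M B (fun _ => 1) m δ j ζ := by
  rw [opKer, opCutKer, cutKer_one_eq hn hδ j h]

theorem decays_modKer (hn : 1 ≤ n) (hm : M + 1 ≤ m) (j : Fin n) {ζ : CSpace n}
    (h : ζ ∉ realSet n) : Decays M (modKer m j ζ) := by
  have h0 : 0 < min 1 ‖imPart ζ‖ := lt_min one_pos (imPart_pos h)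
  rw [← cutKer_one_eq hn h0 j (min_le_right _ _)]
  exact (jointDecays_cutKer isSymbol_one hm h0 (min_le_left _ _) j).decays ζ

theorem eventually_le_imPart {ζ : CSpace n} (h : ζ ∉ realSet n) :
    ∀ᶠ z in 𝓝 ζ, min 1 (‖imPart ζ‖ / 2) ≤ ‖imPart z‖ := by
  have h1 : Tendsto (fun z : CSpace n => ‖imPart z‖) (𝓝 ζ) (𝓝 ‖imPart ζ‖) :=
    (continuous_imPart.norm).tendsto ζ
  filter_upwards [h1.eventually (lt_mem_nhds (half_lt_self (imPart_pos h)))] with z hz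
  exact (min_le_right _ _).trans hz.le

/-- Near a non-real point all distances `|z - ξ|` exceed half of `|Im ζ|`, so the singular kernel
may be replaced by the smooth one at a fixed scale. -/
theorem opForm_eventuallyEq (hn : 1 ≤ n) (B : 𝓢(RSpace n, ℂ) →L[ℂ] (X →L[ℂ] X)) {ζ : CSpace n}
    (h : ζ ∉ realSet n) : opForm M B m =ᶠ[𝓝 ζ]
      opCutForm M B (fun _ => 1) m (min 1 (‖imPart ζ‖ / 2)) := by
  have h0 : 0 < min 1 (‖imPart ζ‖ / 2) := lt_min one_pos (half_pos (imPart_pos h))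
  filter_upwards [eventually_le_imPart h] with z hz
  rw [opForm, opCutForm]
  congr 1
  funext j
  exact opKer_eq hn B h0 j hz

theorem contDiffAt_opForm (hn : 1 ≤ n) (B : 𝓢(RSpace n, ℂ) →L[ℂ] (X →L[ℂ] X)) (hm : M + 1 ≤ m)
    {ζ : CSpace n} (h : ζ ∉ realSet n) : ContDiffAt ℝ ∞ (opForm M B m) ζ :=
  (contDiff_opCutForm B isSymbol_one hm (lt_min one_pos (half_pos (imPart_pos h)))
    (min_le_left _ _)).contDiffAt.congr_of_eventuallyEq (opForm_eventuallyEq hn B h)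

theorem dbar_opForm (hn : 1 ≤ n) (B : 𝓢(RSpace n, ℂ) →L[ℂ] (X →L[ℂ] X)) (hm : M + 1 ≤ m)
    {ζ : CSpace n} (h : ζ ∉ realSet n) : dbar (opForm M B m) ζ = 0 := by
  rw [dbar_congr (opForm_eventuallyEq hn B h)]
  refine dbar_opCutForm hn B isSymbol_one hm (lt_min one_pos (half_pos (imPart_pos h)))
    (min_le_left _ _) ?_
  filter_upwards [eventually_le_imPart h] with z hz ξ
  exact Or.inr (hz.trans (norm_imPart_le_sub z ξ))

theorem jetOf_sum {ι : Type*} (s : Finset ι) (c : ι → ℂ) {f : ι → RSpace n → ℂ}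
    (hf : ∀ i ∈ s, Decays M (f i)) :
    jetOf M (fun ξ => ∑ i ∈ s, c i * f i ξ) = ∑ i ∈ s, c i • jetOf M (f i) := by
  refine jet_ext fun ξ => ?_
  rw [evalJet_jetOf (Decays.sum s fun i hi => (hf i hi).const_mul (c i)), map_sum]
  refine Finset.sum_congr rfl fun i hi => ?_
  rw [map_smul, evalJet_jetOf (hf i hi), smul_eq_mul]

theorem isOmegaAt_opForm (hn : 1 ≤ n) (hB : HasOrder B M) (hm : M + 1 ≤ m) :
    IsOmegaAt B m (opForm M B m) := by
  intro ζ hζ v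
  have hd : ∀ j ∈ Finset.univ, Decays M (modKer m j ζ) := fun j _ => decays_modKer hn hm j hζ
  have e1 : (fun ξ => omegaM m ξ ζ v) =
      fun ξ => ∑ j, (bmBasis n j v * bmNorm n) * modKer m j ζ ξ := by
    funext ξ
    rw [omegaM_eq hn, bmComb_apply]
    refine Finset.sum_congr rfl fun j _ => ?_
    rw [smul_eq_mul, mul_assoc]
    rfl
  have e2 : opForm M B m ζ v =
      extJet M B (jetOf M fun ξ => ∑ j, (bmBasis n j v * bmNorm n) * modKer m j ζ ξ) := by
    rw [jetOf_sum Finset.univ _ hd, map_sum, opForm, bmComb_apply]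
    refine Finset.sum_congr rfl fun j _ => ?_
    rw [map_smul, mul_smul]
    rfl
  rw [e1, e2]
  exact isValueAt_extJet hB (Decays.sum _ fun j hj => (hd j hj).const_mul _)

/-- Off the spectrum, the form agrees locally with a smooth cut-off form. -/
theorem exists_opCutForm_eq (hn : 1 ≤ n) {A : Hyperoperator n X} (hA : A.ExtendsTo B)
    (hB : HasOrder B M) (hm : M + 1 ≤ m) {ξ₀ : RSpace n} (hξ : ξ₀ ∉ A.spectrum) :
    ∃ (χ : RSpace n → ℂ) (δ r : ℝ), IsSymbol (fun _ => 1) χ ∧ 0 < δ ∧ δ ≤ 1 ∧ 0 < r ∧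
      (∀ z ∈ Metric.ball (toC ξ₀) r, ∀ ξ, χ ξ = 0 ∨ δ ≤ ‖z - toC ξ‖) ∧
      ∀ z ∈ Metric.ball (toC ξ₀) r, z ∉ realSet n → opForm M B m z = opCutForm M B χ m δ z := by
  obtain ⟨s, hs, hso, hξs⟩ := (Distribution.notMem_dsupport_iff _).1 hξ
  obtain ⟨R, hR, hRs⟩ := Metric.isOpen_iff.1 hso ξ₀ hξs
  -- The bump is 1 up to radius `R/4` and its support lies within radius `R/2`. Points within `R/8`
  -- of the centre are thus at distance at least `R/8` from every `ξ` at which `1 - g` does not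
  -- vanish.
  let b : ContDiffBump ξ₀ := ⟨R / 4, R / 2, by positivity, by linarith⟩
  let g : RSpace n → ℂ := fun ξ => (b ξ : ℂ)
  have hg : ContDiff ℝ ∞ g := Complex.ofRealCLM.contDiff.comp b.contDiff
  have hgc : HasCompactSupport g :=
    b.hasCompactSupport.comp_left (g := fun x : ℝ => (x : ℂ)) Complex.ofReal_zero
  have hχ : IsSymbol (fun _ => 1) fun ξ => 1 + -g ξ :=
    isSymbol_one.add (IsSymbol.of_hasCompactSupport hg.neg hgc.neg)
  have hsep : ∀ z ∈ Metric.ball (toC ξ₀) (R / 8), ∀ ξ,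
      1 + -g ξ = 0 ∨ min 1 (R / 8) ≤ ‖z - toC ξ‖ := by
    intro z hz ξ
    by_cases hξ : dist ξ ξ₀ ≤ R / 4
    · left
      have : b ξ = 1 := b.one_of_mem_closedBall hξ
      simp [g, this]
    · right
      push Not at hξ
      have h1 : ‖toC ξ - toC ξ₀‖ ≤ ‖z - toC ξ‖ + ‖z - toC ξ₀‖ := by
        have : toC ξ - toC ξ₀ = (z - toC ξ₀) - (z - toC ξ) := by abel
        rw [this, add_comm]
        exact norm_sub_le _ _
      rw [dist_toC, ← dist_eq_norm] at h1
      have h2 : ‖z - toC ξ₀‖ < R / 8 := by simpa [dist_eq_norm] using hz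
      exact (min_le_right _ _).trans (by linarith)
  have h0 : 0 < min 1 (R / 8) := lt_min one_pos (by positivity)
  refine ⟨fun ξ => 1 + -g ξ, min 1 (R / 8), R / 8, hχ, h0, min_le_left _ _, by positivity,
    hsep, fun z hz hzr => ?_⟩
  rw [opForm, opCutForm]
  congr 1
  funext j
  rw [opKer, opCutKer, ← sub_eq_zero, ← smul_sub, ← map_sub]
  have hd := decays_modKer hn hm j hzr
  have hd2 := (jointDecays_cutKer hχ hm h0 (min_le_left _ _) j).decays z
  -- The two kernels differ by `g` times the singular one, which for non-real `z` is a test function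
  -- supported where `A` vanishes.
  let φ : Test n :=
    { toFun := fun ξ => g ξ * modKer m j z ξ
      contDiff' := hg.mul hd.contDiff
      hasCompactSupport' := hgc.mul_right
      tsupport_subset' := fun _ _ => trivial }
  have hφ : A.toCLM φ = 0 := by
    refine hs φ ?_
    refine (tsupport_mul_subset_left (f := g) (g := modKer m j z)).trans ?_
    have h1 : tsupport g ⊆ tsupport b := closure_mono fun x hx => by
      intro h
      exact hx (by simp [g, h])
    refine h1.trans ?_
    rw [b.tsupport_eq]
    exact (Metric.closedBall_subset_ball (by simp only [b]; linarith)).trans hRs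
  have hj : jetOf M (modKer m j z) - jetOf M (fun ξ => cutKer (fun ξ => 1 + -g ξ) m
      (min 1 (R / 8)) j (z, ξ)) = jetOf M (φ.hasCompactSupport.toSchwartzMap φ.contDiff) := by
    refine jet_ext fun ξ => ?_
    rw [map_sub, evalJet_jetOf hd, evalJet_jetOf hd2, evalJet_jetOf (schwartz_decays M _),
      cutKer_eq hn h0 j (hsep z hz ξ)]
    change _ = g ξ * modKer m j z ξ
    ring
  rw [hj, extJet_schwartz hB, hA φ, hφ, smul_zero]

/-- The extension of the form across the complement of the spectrum. -/
theorem exists_extension (hn : 1 ≤ n) {A : Hyperoperator n X} (hA : A.ExtendsTo B)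
    (hB : HasOrder B M) (hm : M + 1 ≤ m) :
    ∃ Ω' : CSpace n → Covec n (1 + 2 * (n - 1)) (X →L[ℂ] X),
      EqOn Ω' (opForm M B m) (realSet n)ᶜ ∧ ContDiffOn ℝ ∞ Ω' (toC '' A.spectrum)ᶜ ∧
        IsDbarClosedOn Ω' (toC '' A.spectrum)ᶜ := by
  -- The real space has dense complement, so the extension is defined at once by limits from the
  -- complement, and the local smooth forms need no gluing.
  have hcl : ∀ ζ : CSpace n, ζ ∈ closure (realSet n)ᶜ := fun ζ => dense_compl_realSet hn ζ
  have heq : EqOn (extendFrom (realSet n)ᶜ (opForm M B m)) (opForm M B m) (realSet n)ᶜ :=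
    fun ζ hζ => extendFrom_eq (hcl ζ)
      ((contDiffAt_opForm hn B hm hζ).continuousAt.tendsto.mono_left nhdsWithin_le_nhds)
  have hloc : ∀ ζ ∈ (toC '' A.spectrum)ᶜ, ∃ θ : CSpace n → Covec n (1 + 2 * (n - 1)) (X →L[ℂ] X),
      ContDiffAt ℝ ∞ θ ζ ∧ dbar θ ζ = 0 ∧
        extendFrom (realSet n)ᶜ (opForm M B m) =ᶠ[𝓝 ζ] θ := by
    intro ζ hζ
    by_cases hr : ζ ∈ realSet n
    · obtain ⟨ξ₀, rfl⟩ := hr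
      have hξ : ξ₀ ∉ A.spectrum := fun h => hζ ⟨ξ₀, h, rfl⟩
      obtain ⟨χ, δ, r, hχ, hδ, hδ1, hr, h1, h2⟩ := exists_opCutForm_eq hn hA hB hm hξ
      have hmem := Metric.ball_mem_nhds (toC ξ₀) hr
      have hs := contDiff_opCutForm B hχ hm hδ hδ1
      refine ⟨opCutForm M B χ m δ, hs.contDiffAt, ?_, ?_⟩
      · exact dbar_opCutForm hn B hχ hm hδ hδ1 (Filter.mem_of_superset hmem h1)
      · filter_upwards [hmem] with z hz
        refine extendFrom_eq (hcl z) ?_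
        refine ((hs.continuous.tendsto z).mono_left nhdsWithin_le_nhds).congr' ?_
        filter_upwards [self_mem_nhdsWithin,
          mem_nhdsWithin_of_mem_nhds (Metric.isOpen_ball.mem_nhds hz)] with w hw hw'
        exact (h2 w hw' hw).symm
    · refine ⟨opForm M B m, contDiffAt_opForm hn B hm hr, dbar_opForm hn B hm hr, ?_⟩
      filter_upwards [isClosed_realSet.isOpen_compl.mem_nhds hr] with z hz
      exact heq hz
  refine ⟨_, heq, fun ζ hζ => ?_, fun ζ hζ => ?_, fun ζ hζ => ?_⟩
  · obtain ⟨θ, h1, -, h3⟩ := hloc ζ hζ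
    exact (h1.congr_of_eventuallyEq h3).contDiffWithinAt
  · obtain ⟨θ, h1, -, h3⟩ := hloc ζ hζ
    exact ((h1.congr_of_eventuallyEq h3).differentiableAt (by simp)).differentiableWithinAt
  · obtain ⟨θ, -, h2, h3⟩ := hloc ζ hζ
    rw [dbar_congr h3, h2]

end OperatorForm

/-! ### The integral representation -/

section Representation

variable {n : ℕ}

theorem exists_norm_peak_le (n : ℕ) : ∃ C : ℝ, 0 ≤ C ∧ ∀ (ξ : RSpace n) (ζ : CSpace n),
    ‖peak ξ ζ‖ ≤ C * (1 + ‖ζ‖) := by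
  obtain ⟨C, hC, h⟩ := isSymbol_peak (n := n) 0
  refine ⟨C, hC, fun ξ ζ => (h.norm_le (ζ, ξ)).trans ?_⟩
  have h1 : (1 + ‖ξ‖)⁻¹ ≤ 1 := inv_le_one_of_one_le₀ (by linarith [norm_nonneg ξ])
  have h2 : (1 + ‖ζ‖) * (1 + ‖ξ‖)⁻¹ ≤ 1 + ‖ζ‖ := mul_le_of_le_one_right (by positivity) h1
  exact mul_le_mul_of_nonneg_left h2 hC

theorem one_add_norm_le_mul {E : Type*} [SeminormedAddCommGroup E] (z a : E) :
    1 + ‖z‖ ≤ (1 + ‖a‖) * (1 + ‖z + a‖) := by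
  have h := norm_sub_le (z + a) a
  rw [add_sub_cancel_right] at h
  nlinarith [norm_nonneg a, norm_nonneg (z + a)]

/-- Of the `m + 2` powers of decay, `m` absorb the growth of `peak ^ m` and two remain for
integrability against the kernel; moving the centre to `ξ` costs only a constant. -/
theorem peak_pow_mul_le (m : ℕ) (ξ : RSpace n) {C : ℝ} (hC : 0 ≤ C) : ∃ C' : ℝ, ∀ (w : ℂ)
    (z : CSpace n), ‖w‖ ≤ C * ((1 + ‖z + toC ξ‖) ^ (m + 2))⁻¹ →
    ‖peak ξ (z + toC ξ) ^ m * w‖ ≤ C' * ((1 + ‖z‖) ^ 2)⁻¹ := by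
  obtain ⟨K, hK, h⟩ := exists_norm_peak_le n
  refine ⟨K ^ m * C * (1 + ‖toC ξ‖) ^ 2, fun w z hw => ?_⟩
  set a := 1 + ‖z + toC ξ‖ with ha
  have ha1 : 0 < a := by positivity
  have h1 : ((1 + ‖z‖) ^ 2)⁻¹ * (1 + ‖toC ξ‖) ^ 2 ≥ (a ^ 2)⁻¹ := by
    have h2 := one_add_norm_le_mul z (toC ξ)
    rw [ge_iff_le, inv_mul_eq_div, le_div_iff₀ (by positivity), inv_mul_le_iff₀ (by positivity),
      ← mul_pow, mul_comm a]
    gcongr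
  rw [norm_mul, norm_pow]
  calc ‖peak ξ (z + toC ξ)‖ ^ m * ‖w‖ ≤ (K * a) ^ m * (C * (a ^ (m + 2))⁻¹) := by
        gcongr
        exact h _ _
    _ = K ^ m * C * (a ^ 2)⁻¹ := by
        rw [mul_pow, pow_add]
        field_simp
    _ ≤ K ^ m * C * (((1 + ‖z‖) ^ 2)⁻¹ * (1 + ‖toC ξ‖) ^ 2) := by gcongr
    _ = _ := by ring

theorem integrable_modKer (hn : 1 ≤ n) (m : ℕ) (j : Fin n) (ξ : RSpace n) {w : CSpace n → ℂ}
    (hw : Continuous w) {C : ℝ} (hC : ∀ z, ‖w z‖ ≤ C * ((1 + ‖z‖) ^ (m + 2))⁻¹) :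
    Integrable fun ζ => modKer m j ζ ξ * w ζ := by
  have hC0 : 0 ≤ C := by simpa using (norm_nonneg _).trans (hC 0)
  obtain ⟨C', h⟩ := peak_pow_mul_le m ξ hC0
  have h1 : Integrable fun z => bmKer j z * (peak ξ (z + toC ξ) ^ m * w (z + toC ξ)) := by
    refine integrable_bmKer_mul hn j (Continuous.aestronglyMeasurable ?_)
      (C := C') fun z => h _ _ (hC _)
    have := (contDiff_peak ξ).continuous
    fun_prop
  refine (h1.comp_sub_right (toC ξ)).congr (Eventually.of_forall fun ζ => ?_)
  simp only [sub_add_cancel, modKer]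
  ring

/-- The Bochner–Martinelli formula with the modified kernel. -/
theorem sum_integral_modKer (hn : 1 ≤ n) (m : ℕ) (ξ : RSpace n) {u : CSpace n → ℂ}
    (hu : ContDiff ℝ 1 u) {C : ℝ} (hC : ∀ z, ‖u z‖ ≤ C * ((1 + ‖z‖) ^ (m + 2))⁻¹)
    (hC' : ∀ j z, ‖wirt u j z‖ ≤ C * ((1 + ‖z‖) ^ (m + 2))⁻¹) :
    ∑ j, ∫ ζ, modKer m j ζ ξ * wirt u j ζ =
      -((Real.pi ^ n / (n - 1).factorial : ℝ) : ℂ) * u (toC ξ) := by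
  have hC0 : 0 ≤ C := by simpa using (norm_nonneg _).trans (hC 0)
  obtain ⟨C', h⟩ := peak_pow_mul_le m ξ hC0
  have hp : ContDiff ℝ 1 (peak ξ) := (contDiff_peak ξ).of_le (by exact_mod_cast le_top)
  let v : CSpace n → ℂ := fun ζ => peak ξ ζ ^ m * u ζ
  have hv : ContDiff ℝ 1 v := (hp.pow m).mul hu
  have hvw : ∀ j ζ, wirt v j ζ = peak ξ ζ ^ m * wirt u j ζ := by
    intro j ζ
    have hpd := hp.differentiable one_ne_zero ζ
    have h2 := wirt_mul (hpd.fun_pow m) (hu.differentiable one_ne_zero ζ) j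
    refine h2.trans ?_
    rw [wirt_pow hpd, wirt_peak, mul_zero, mul_zero, add_zero]
  have hvt : ∀ j z, wirt (fun z => v (z + toC ξ)) j z = wirt v j (z + toC ξ) := by
    intro j z
    have h2 := wirt_comp_sub v (-toC ξ) j z
    simpa using h2
  have key := bochnerMartinelli hn (u := fun z => v (z + toC ξ))
    (hv.comp (contDiff_id.add contDiff_const)) (C := C') (fun z => h _ z (hC _)) (fun j z => by
      rw [hvt, hvw]
      exact h _ z (hC' j _))
  have h0 : v (0 + toC ξ) = u (toC ξ) := by
    simp [v, peak_self]
  rw [h0] at key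
  rw [← key]
  refine Finset.sum_congr rfl fun j _ => ?_
  rw [← integral_sub_right_eq_self (fun z => bmKer j z * wirt (fun z => v (z + toC ξ)) j z)
    (toC ξ)]
  congr 1
  funext ζ
  rw [hvt, hvw, sub_add_cancel, modKer]
  ring

variable {X : Type*} [NormedAddCommGroup X] [NormedSpace ℂ X] [CompleteSpace X]
  {M m : ℕ} {B : 𝓢(RSpace n, ℂ) →L[ℂ] (X →L[ℂ] X)}

theorem contDiffAt_jetOf_modKer (hn : 1 ≤ n) (hm : M + 1 ≤ m) (j : Fin n) {ζ : CSpace n}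
    (h : ζ ∉ realSet n) : ContDiffAt ℝ ∞ (fun ζ => jetOf M (modKer m j ζ)) ζ := by
  have h0 : 0 < min 1 (‖imPart ζ‖ / 2) := lt_min one_pos (half_pos (imPart_pos h))
  refine (contDiff_jetOf (jointDecays_cutKer isSymbol_one hm h0
    (min_le_left _ _) j)).contDiffAt.congr_of_eventuallyEq ?_
  filter_upwards [eventually_le_imPart h] with z hz
  rw [cutKer_one_eq hn h0 j hz]

theorem aestronglyMeasurable_jetOf (hn : 1 ≤ n) (hm : M + 1 ≤ m) (j : Fin n) :
    AEStronglyMeasurable (fun ζ : CSpace n => jetOf M (modKer m j ζ)) := by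
  have h1 : ContinuousOn (fun ζ : CSpace n => jetOf M (modKer m j ζ)) (realSet n)ᶜ :=
    fun ζ hζ => (contDiffAt_jetOf_modKer hn hm j hζ).continuousAt.continuousWithinAt
  have h2 := h1.aestronglyMeasurable (μ := volume) isClosed_realSet.isOpen_compl.measurableSet
  rwa [Measure.restrict_eq_self_of_ae_mem (s := (realSet n)ᶜ) (ae_notMem_realSet hn)] at h2

/-- The products of the jets of the kernels with `∂̄u` are integrable. -/
theorem integrable_wirt_smul_jetOf (hn : 1 ≤ n) (hm : M + 1 ≤ m) {u : CSpace n → ℂ}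
    (hu : ContDiff ℝ ∞ u)
    (hd : ∀ M₁ M₂ : ℕ, ∃ C : ℝ, ∀ ζ, (1 + ‖ζ‖) ^ M₂ * ‖dbarFun u ζ‖ ≤ C * ‖imPart ζ‖ ^ M₁)
    (j : Fin n) :
    Integrable fun ζ => wirt u j ζ • jetOf M (modKer m j ζ) := by
  obtain ⟨K, hK, hb⟩ := norm_jetOf_cutKer_le (isSymbol_one (n := n)) hm j
  -- Flatness of order `k` cancels the blow-up `δ^{-k}` of the jets. Of the `m + (2n + 1)` powers of
  -- decay, `m` cancel their growth and `2n + 1` exceeds the real dimension. Order 0 serves where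
  -- `|Im ζ| ≥ 1`.
  obtain ⟨k, hk⟩ : ∃ k, k = 2 * n - 1 + M := ⟨_, rfl⟩
  rw [← hk] at hb
  obtain ⟨C₁, h₁⟩ := hd 0 (m + (2 * n + 1))
  obtain ⟨C₂, h₂⟩ := hd k (m + (2 * n + 1))
  have hint : Integrable fun ζ : CSpace n => K * (|C₁| + |C₂|) * ((1 + ‖ζ‖) ^ (2 * n + 1))⁻¹ := by
    refine Integrable.const_mul ?_ _
    have h := integrable_one_add_norm (E := CSpace n) (μ := volume) (r := ((2 * n + 1 : ℕ) : ℝ))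
      (by
        rw [finrank_CSpace]
        push_cast
        linarith)
    refine h.congr (Eventually.of_forall fun ζ => ?_)
    simp only
    rw [Real.rpow_neg (by positivity), Real.rpow_natCast]
  refine hint.mono' ((continuous_wirt (hu.of_le (by exact_mod_cast le_top)) j).aestronglyMeasurable.smul
    (aestronglyMeasurable_jetOf hn hm j)) ?_
  filter_upwards [ae_notMem_realSet hn] with ζ hζ
  have hy := imPart_pos hζ
  set δ := min 1 ‖imPart ζ‖ with hδ
  have h0 : 0 < δ := lt_min one_pos hy
  have hj : ‖jetOf M (modKer m j ζ)‖ ≤ K * δ⁻¹ ^ k * (1 + ‖ζ‖) ^ m := by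
    rw [← cutKer_one_eq hn h0 j (min_le_right _ _)]
    exact hb δ h0 (min_le_left _ _) ζ
  have hw : (1 + ‖ζ‖) ^ (m + (2 * n + 1)) * ‖wirt u j ζ‖ ≤ (|C₁| + |C₂|) * δ ^ k := by
    have h3 : (1 + ‖ζ‖) ^ (m + (2 * n + 1)) * ‖wirt u j ζ‖ ≤
        (1 + ‖ζ‖) ^ (m + (2 * n + 1)) * ‖dbarFun u ζ‖ := by
      gcongr
      exact norm_wirt_le_dbarFun (hu.differentiable (by simp) ζ) j
    rcases le_total 1 ‖imPart ζ‖ with h | h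
    · rw [hδ, min_eq_left h, one_pow, mul_one]
      refine h3.trans ((h₁ ζ).trans ?_)
      rw [pow_zero, mul_one]
      linarith [le_abs_self C₁, abs_nonneg C₂]
    · rw [hδ, min_eq_right h]
      refine h3.trans ((h₂ ζ).trans ?_)
      gcongr
      linarith [le_abs_self C₂, abs_nonneg C₁]
  have hw' : ‖wirt u j ζ‖ ≤ (|C₁| + |C₂|) * δ ^ k * ((1 + ‖ζ‖) ^ (m + (2 * n + 1)))⁻¹ := by
    rw [← div_eq_mul_inv, le_div_iff₀ (by positivity), mul_comm]
    exact hw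
  rw [norm_smul]
  calc ‖wirt u j ζ‖ * ‖jetOf M (modKer m j ζ)‖ ≤
      ((|C₁| + |C₂|) * δ ^ k * ((1 + ‖ζ‖) ^ (m + (2 * n + 1)))⁻¹) *
        (K * δ⁻¹ ^ k * (1 + ‖ζ‖) ^ m) := by gcongr
    _ = _ := by
      rw [pow_add, inv_pow]
      field_simp

theorem density_wedge_opForm {u : CSpace n → ℂ} {ζ : CSpace n} (hu : DifferentiableAt ℝ u ζ) :
    density (fun ζ => wedge (opForm M B m ζ) (dbarFun u ζ)) ζ =
      (-bmScale n * bmNorm n) •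
        extJet M B (∑ j, wirt u j ζ • jetOf M (modKer m j ζ)) := by
  have h1 := wedge_bmComb (fun j => opKer M B m j ζ) (dbarFun u ζ)
  refine h1.trans ?_
  rw [map_sum, Finset.smul_sum]
  refine Finset.sum_congr rfl fun j _ => ?_
  rw [bmPair_dbarFun hu, opKer, map_smul, smul_smul, smul_smul]
  congr 1
  ring

/-- The integral representation, for functions with small `∂̄`. -/
theorem integral_representation (hn : 1 ≤ n) (hB : HasOrder B M) (hm : M + 1 ≤ m)
    {φ : 𝓢(RSpace n, ℂ)} {u : CSpace n → ℂ} (hu : IsAlmostHolExt φ u) :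
    Integrable (density (fun ζ => wedge (opForm M B m ζ) (dbarFun u ζ))) ∧
      B φ = formIntegral (fun ζ => wedge (opForm M B m ζ) (dbarFun u ζ)) := by
  have hd : Differentiable ℝ u := hu.smooth.differentiable (by simp)
  have hi := fun j => integrable_wirt_smul_jetOf (M := M) hn hm hu.smooth hu.dbar_decay j
  have hI : Integrable fun ζ => ∑ j, wirt u j ζ • jetOf M (modKer m j ζ) :=
    integrable_finsetSum _ fun j _ => hi j
  have hdens : density (fun ζ => wedge (opForm M B m ζ) (dbarFun u ζ)) = fun ζ =>
      (-bmScale n * bmNorm n) • extJet M B (∑ j, wirt u j ζ • jetOf M (modKer m j ζ)) :=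
    funext fun ζ => density_wedge_opForm (hd ζ)
  refine ⟨?_, ?_⟩
  · rw [hdens]
    exact ((extJet M B).integrable_comp hI).smul (-bmScale n * bmNorm n : ℂ)
  · rw [formIntegral, hdens, integral_smul, (extJet M B).integral_comp_comm hI, ← map_smul,
      ← extJet_schwartz hB]
    congr 1
    -- `extJet` has been taken out of the integral, which leaves an identity of jets. At a fixed `ξ`
    -- it is the scalar formula with the modified kernel.
    refine jet_ext fun ξ => ?_
    rw [evalJet_jetOf (schwartz_decays M φ), map_smul, ← (evalJet M ξ).integral_comp_comm hI]
    have h1 : ∫ ζ, evalJet M ξ (∑ j, wirt u j ζ • jetOf M (modKer m j ζ)) =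
        ∑ j, ∫ ζ, modKer m j ζ ξ * wirt u j ζ := by
      have h2 : ∀ᵐ ζ : CSpace n, evalJet M ξ (∑ j, wirt u j ζ • jetOf M (modKer m j ζ)) =
          ∑ j, evalJet M ξ (wirt u j ζ • jetOf M (modKer m j ζ)) :=
        Eventually.of_forall fun ζ => map_sum _ _ _
      rw [integral_congr_ae h2, integral_finsetSum _ fun j _ => (evalJet M ξ).integrable_comp (hi j)]
      refine Finset.sum_congr rfl fun j _ => integral_congr_ae ?_
      filter_upwards [ae_notMem_realSet hn] with ζ hζ
      rw [map_smul, evalJet_jetOf (decays_modKer hn hm j hζ), smul_eq_mul, mul_comm]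
    obtain ⟨C₁, h₁⟩ := hu.decay (m + 2)
    obtain ⟨C₂, h₂⟩ := hu.dbar_decay 0 (m + 2)
    have h3 : ∀ z, ‖u z‖ ≤ max C₁ C₂ * ((1 + ‖z‖) ^ (m + 2))⁻¹ := fun z => by
      rw [← div_eq_mul_inv, le_div_iff₀ (by positivity), mul_comm]
      exact (h₁ z).trans (le_max_left _ _)
    have h4 : ∀ j z, ‖wirt u j z‖ ≤ max C₁ C₂ * ((1 + ‖z‖) ^ (m + 2))⁻¹ := fun j z => by
      rw [← div_eq_mul_inv, le_div_iff₀ (by positivity), mul_comm]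
      have h5 := h₂ z
      rw [pow_zero, mul_one] at h5
      refine le_trans ?_ (h5.trans (le_max_right _ _))
      gcongr
      exact norm_wirt_le_dbarFun (hd z) j
    rw [h1, sum_integral_modKer hn m ξ (hu.smooth.of_le (by exact_mod_cast le_top)) h3 h4,
      hu.extends_real, smul_eq_mul, ← mul_assoc, bmConst_eq, one_mul]

end Representation

/-! ### Currents -/

section Currents

variable {n : ℕ}

theorem locallyIntegrable_bmKer (hn : 1 ≤ n) (j : Fin n) :
    LocallyIntegrable (bmKer j : CSpace n → ℂ) := by
  have hpos : ∀ z : CSpace n, (1 + ‖z‖) ^ 2 ≠ 0 := fun z => by positivity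
  have hc : Continuous fun z : CSpace n => ((((1 + ‖z‖) ^ 2)⁻¹ : ℝ) : ℂ) :=
    Complex.continuous_ofReal.comp (((continuous_const.add continuous_norm).pow 2).inv₀ hpos)
  have h1 := integrable_bmKer_mul hn j hc.aestronglyMeasurable (C := 1) fun z => by
    rw [Complex.norm_real, Real.norm_of_nonneg (by positivity), one_mul]
  have hc2 : Continuous fun z : CSpace n => (((1 + ‖z‖) ^ 2 : ℝ) : ℂ) :=
    Complex.continuous_ofReal.comp ((continuous_const.add continuous_norm).pow 2)
  have h2 := (h1.locallyIntegrable.locallyIntegrableOn univ).mul_continuousOn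
    hc2.continuousOn isOpen_univ.isLocallyClosed
  rw [locallyIntegrableOn_univ] at h2
  refine h2.congr (Eventually.of_forall fun z => ?_)
  simp only
  rw [mul_assoc, ← Complex.ofReal_mul, inv_mul_cancel₀ (hpos z), Complex.ofReal_one, mul_one]

theorem radKer_le_one (hn : 1 ≤ n) {z : CSpace n} (hz : 1 ≤ ‖z‖) : radKer n z ≤ 1 := by
  have h1 : 1 ≤ ‖z‖ ^ 2 := one_le_pow₀ hz
  have h2 : ((‖z‖ ^ 2)⁻¹) ^ n ≤ ((‖z‖ ^ 2)⁻¹) ^ 1 :=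
    pow_le_pow_of_le_one (by positivity) (inv_le_one_of_one_le₀ h1) hn
  rw [pow_one] at h2
  calc radKer n z ≤ ‖z‖ * (‖z‖ ^ 2)⁻¹ := by
        unfold radKer
        gcongr
    _ = ‖z‖⁻¹ := by
        have : ‖z‖ ≠ 0 := by positivity
        field_simp
    _ ≤ 1 := inv_le_one_of_one_le₀ hz

/-- The convolution with the Bochner–Martinelli kernel. -/
def bmConv {F : Type} [NormedAddCommGroup F] [NormedSpace ℂ F] (j : Fin n) (w : CSpace n → F) :
    CSpace n → F :=
  convolution (bmKer j) w (ContinuousLinearMap.lsmul ℝ ℂ) volume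

/-- For `|t| ≤ 1` the kernel is integrable and `w` is bounded; the factor 4 offsets `(1 + |t|)^{-2}
≥ 1/4`. For `|t| ≥ 1` the kernel is at most 1 and `w` is integrable. -/
theorem norm_bmConv_le (hn : 1 ≤ n) {F : Type} [NormedAddCommGroup F] [NormedSpace ℂ F] (j : Fin n)
    {w : CSpace n → F} (hw : Continuous w) (hc : HasCompactSupport w) :
    ∃ C : ℝ, ∀ a, ‖bmConv j w a‖ ≤ C := by
  obtain ⟨S, hS⟩ := hc.exists_bound_of_continuous hw
  have hS0 : 0 ≤ S := (norm_nonneg _).trans (hS 0)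
  have hi : Integrable fun z => ‖w z‖ := (hw.integrable_of_hasCompactSupport hc).norm
  refine ⟨(∫ z : CSpace n, 4 * S * (radKer n z * ((1 + ‖z‖) ^ 2)⁻¹)) + ∫ z, ‖w z‖, fun a => ?_⟩
  have hi2 := hi.comp_sub_left a
  have hb := norm_integral_le_of_norm_le (μ := volume)
    (f := fun t => ContinuousLinearMap.lsmul ℝ ℂ (bmKer j t) (w (a - t)))
    (((integrable_radKer hn).const_mul (4 * S)).add hi2) (Eventually.of_forall fun t => by
      change ‖bmKer j t • w (a - t)‖ ≤
        4 * S * (radKer n t * ((1 + ‖t‖) ^ 2)⁻¹) + ‖w (a - t)‖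
      rw [norm_smul]
      have h1 := norm_bmKer_le j t
      have h0 := radKer_nonneg t
      rcases le_total ‖t‖ 1 with h | h
      · have h2 : (1 : ℝ) ≤ 4 * ((1 + ‖t‖) ^ 2)⁻¹ := by
          rw [← div_eq_mul_inv, le_div_iff₀ (by positivity)]
          nlinarith [norm_nonneg t]
        calc ‖bmKer j t‖ * ‖w (a - t)‖ ≤ radKer n t * S :=
              mul_le_mul h1 (hS _) (norm_nonneg _) h0
          _ ≤ radKer n t * S * (4 * ((1 + ‖t‖) ^ 2)⁻¹) := le_mul_of_one_le_right (by positivity) h2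
          _ = 4 * S * (radKer n t * ((1 + ‖t‖) ^ 2)⁻¹) := by ring
          _ ≤ _ := le_add_of_nonneg_right (norm_nonneg _)
      · calc ‖bmKer j t‖ * ‖w (a - t)‖ ≤ 1 * ‖w (a - t)‖ := by
              gcongr
              exact h1.trans (radKer_le_one hn h)
          _ = ‖w (a - t)‖ := one_mul _
          _ ≤ _ := le_add_of_nonneg_left (by positivity))
  refine hb.trans (le_of_eq ?_)
  rw [← integral_sub_left_eq_self (fun z => ‖w z‖) volume a]
  exact integral_add ((integrable_radKer hn).const_mul (4 * S)) hi2

/-- Derivatives of the convolution fall on `w`. The target space varies in the induction because the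
derivative of `w` takes values in linear maps. -/
theorem derivBound_bmConv (hn : 1 ≤ n) (j : Fin n) (N : ℕ) : ∀ {F : Type} [NormedAddCommGroup F]
    [NormedSpace ℂ F] {w : CSpace n → F}, ContDiff ℝ ∞ w → HasCompactSupport w →
    ∃ C : ℝ, DerivBound N (fun _ => C) (bmConv j w) := by
  have hsm : ∀ {F : Type} [NormedAddCommGroup F] [NormedSpace ℂ F] {w : CSpace n → F},
      ContDiff ℝ ∞ w → HasCompactSupport w → ContDiff ℝ ∞ (bmConv j w) := fun hw hc =>
    hc.contDiff_convolution_right _ (locallyIntegrable_bmKer hn j) hw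
  induction N with
  | zero =>
    intro F _ _ w hw hc
    obtain ⟨C, hC⟩ := norm_bmConv_le hn j hw.continuous hc
    refine ⟨C, hsm hw hc, fun x i hi => ?_⟩
    obtain rfl : i = 0 := by omega
    simpa using hC x
  | succ N ih =>
    intro F _ _ w hw hc
    obtain ⟨C, hC⟩ := norm_bmConv_le hn j hw.continuous hc
    obtain ⟨C', h'⟩ := ih (hw.fderiv_right (m := ∞) (by simp)) (hc.fderiv (𝕜 := ℝ))
    refine ⟨max C C', DerivBound.of_fderiv (hsm hw hc) (fun x => (hC x).trans (le_max_left _ _)) ?_⟩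
    have e : fderiv ℝ (bmConv j w) = bmConv j (fderiv ℝ w) := by
      funext x
      have h1 := hc.hasFDerivAt_convolution_right (ContinuousLinearMap.lsmul ℝ ℂ)
        (locallyIntegrable_bmKer hn j) (hw.of_le (by exact_mod_cast le_top)) x
      rw [bmConv, h1.fderiv, bmConv, convolution_def, convolution_def]
      congr 1
    rw [e]
    exact h'.mono fun _ => le_max_right _ _

/-- The integrals of a test function against the modified kernels. -/
def kerIntegral (m : ℕ) (j : Fin n) (w : CSpace n → ℂ) (ξ : RSpace n) : ℂ :=
  ∫ ζ, modKer m j ζ ξ * w ζ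

theorem bound_of_hasCompactSupport {w : CSpace n → ℂ} (hw : Continuous w) (hc : HasCompactSupport w)
    (k : ℕ) : ∃ C : ℝ, ∀ z, ‖w z‖ ≤ C * ((1 + ‖z‖) ^ k)⁻¹ := by
  have h1 : Continuous fun z => ((1 + ‖z‖ : ℝ) : ℂ) ^ k * w z :=
    ((Complex.continuous_ofReal.comp (continuous_const.add continuous_norm)).pow k).mul hw
  obtain ⟨C, hC⟩ := (HasCompactSupport.mul_left hc
    (f := fun z => ((1 + ‖z‖ : ℝ) : ℂ) ^ k)).exists_bound_of_continuous h1
  refine ⟨C, fun z => ?_⟩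
  have h2 := hC z
  simp only [Pi.mul_apply] at h2
  rw [norm_mul, norm_pow, Complex.norm_real, Real.norm_of_nonneg (by positivity)] at h2
  rw [← div_eq_mul_inv, le_div_iff₀ (by positivity), mul_comm]
  exact h2

/-- For `m = 0` the integral is, up to sign, a convolution restricted to `ℝⁿ`. Each further factor
`peak` is affine in `ζ` with coefficients of decay 1 in `ξ`, and the coordinates `ζₖ` are absorbed
into the test function. -/
theorem isSymbol_kerIntegral (hn : 1 ≤ n) (m : ℕ) (j : Fin n) {w : CSpace n → ℂ}
    (hw : ContDiff ℝ ∞ w) (hc : HasCompactSupport w) :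
    IsSymbol (fun ξ => (1 + ‖ξ‖)⁻¹ ^ m) (kerIntegral m j w) := by
  induction m generalizing w with
  | zero =>
    have e : kerIntegral 0 j w = fun ξ => -ContinuousLinearMap.id ℝ ℂ (bmConv j w (toCL n ξ)) := by
      funext ξ
      rw [kerIntegral, ContinuousLinearMap.id_apply, bmConv, convolution_def, ← integral_neg,
        ← integral_neg_eq_self, ← integral_add_right_eq_self _ (-toC ξ)]
      congr 1
      funext t
      have h1 : bmKer j (-(t + -toC ξ) - toC ξ) = -bmKer j t := by
        have e1 : -(t + -toC ξ) - toC ξ = -t := by abel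
        have e2 : nsq (-t) = nsq t := by rw [nsq_eq, nsq_eq, norm_neg]
        rw [e1, bmKer, bmKer, e2, map_neg, neg_mul]
      have h2 : -(t + -toC ξ) = toCL n ξ - t := by
        rw [toCL_apply]
        abel
      rw [modKer, pow_zero, one_mul, h1, h2]
      change -bmKer j t * w (toCL n ξ - t) = -(bmKer j t * w (toCL n ξ - t))
      ring
    rw [e]
    simp only [pow_zero]
    have h1 : IsSymbol (fun _ => 1) (bmConv j w) := fun N => by
      obtain ⟨C, h⟩ := derivBound_bmConv hn j N hw hc
      exact ⟨C, h.nonneg 0, by simpa using h⟩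
    exact (h1.comp_clm (toCL n)).clm_comp (-ContinuousLinearMap.id ℝ ℂ)
  | succ m ih =>
    have hi : ∀ {v : CSpace n → ℂ}, ContDiff ℝ ∞ v → HasCompactSupport v → ∀ ξ,
        Integrable fun ζ => modKer m j ζ ξ * v ζ := fun hv hvc ξ => by
      obtain ⟨C, hC⟩ := bound_of_hasCompactSupport hv.continuous hvc (m + 2)
      exact integrable_modKer hn m j ξ hv.continuous hC
    have hs : ∀ k : Fin n, ContDiff ℝ ∞ fun ζ => dz k ζ * w ζ := fun k =>
      (dz k).contDiff.mul hw
    have hsc : ∀ k : Fin n, HasCompactSupport fun ζ => dz k ζ * w ζ := fun k =>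
      hc.mul_left (f := fun ζ => dz k ζ)
    have e : kerIntegral (m + 1) j w = fun ξ => Complex.ofRealCLM (invSq ξ) * kerIntegral m j w ξ +
        ∑ k, Complex.ofRealCLM ((invSq ξ • ξ) k) *
          kerIntegral m j (fun ζ => dz k ζ * w ζ) ξ := by
      funext ξ
      simp only [kerIntegral]
      simp only [← integral_const_mul]
      rw [← integral_finsetSum _ fun k _ => (hi (hs k) (hsc k) ξ).const_mul _,
        ← integral_add ((hi hw hc ξ).const_mul _)
          (integrable_finsetSum _ fun k _ => (hi (hs k) (hsc k) ξ).const_mul _)]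
      congr 1
      funext ζ
      have h1 : modKer (m + 1) j ζ ξ = peak ξ ζ * modKer m j ζ ξ := by
        rw [modKer, modKer, pow_succ]
        ring
      rw [h1, peak_eq, add_mul, add_mul, Finset.sum_mul, Finset.sum_mul]
      congr 1
      · ring
      · exact Finset.sum_congr rfl fun k _ => by ring
    rw [e]
    simp only [pow_succ']
    refine IsSymbol.add ((isSymbol_invSq.clm_comp Complex.ofRealCLM).mul (ih hw hc))
      (IsSymbol.sum _ fun k _ => ?_)
    exact ((isSymbol_invSq_smul.clm_comp (EuclideanSpace.proj (𝕜 := ℝ) k)).clm_comp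
      Complex.ofRealCLM).mul (ih (hs k) (hsc k))

theorem density_wedge_omegaM (hn : 1 ≤ n) (m : ℕ) (ξ : RSpace n)
    (ψ : CSpace n → Covec n (0 + 1) ℂ) :
    density (fun ζ => wedge (omegaM m ξ ζ) (ψ ζ)) =
      fun ζ => ∑ j, bmNorm n * (modKer m j ζ ξ * bmPair j (ψ ζ)) := by
  funext ζ
  have h1 := wedge_bmComb (fun j => bmNorm n * (peak ξ ζ ^ m * bmKer j (ζ - toC ξ))) (ψ ζ)
  rw [← omegaM_eq hn] at h1
  refine h1.trans (Finset.sum_congr rfl fun j _ => ?_)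
  rw [smul_eq_mul, modKer]
  ring

theorem integrable_and_integral_omegaM (hn : 1 ≤ n) (m : ℕ) {ψ : CSpace n → Covec n (0 + 1) ℂ}
    (hψ : ∀ j, Continuous fun ζ => bmPair j (ψ ζ))
    (hc : ∀ j, HasCompactSupport fun ζ => bmPair j (ψ ζ)) (ξ : RSpace n) :
    Integrable (density (fun ζ => wedge (omegaM m ξ ζ) (ψ ζ))) ∧
      formIntegral (fun ζ => wedge (omegaM m ξ ζ) (ψ ζ)) =
        ∑ j, bmNorm n * kerIntegral m j (fun ζ => bmPair j (ψ ζ)) ξ := by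
  have hi : ∀ j, Integrable fun ζ => bmNorm n * (modKer m j ζ ξ * bmPair j (ψ ζ)) := fun j => by
    obtain ⟨C, hC⟩ := bound_of_hasCompactSupport (hψ j) (hc j) (m + 2)
    exact (integrable_modKer hn m j ξ (hψ j) hC).const_mul _
  refine ⟨?_, ?_⟩
  · rw [density_wedge_omegaM hn]
    exact integrable_finsetSum _ fun j _ => hi j
  · rw [formIntegral, density_wedge_omegaM hn, integral_finsetSum _ fun j _ => hi j]
    exact Finset.sum_congr rfl fun j _ => integral_const_mul _ _

variable {X : Type*} [NormedAddCommGroup X] [NormedSpace ℂ X]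
  {M m : ℕ} {B : 𝓢(RSpace n, ℂ) →L[ℂ] (X →L[ℂ] X)}

/-- The current is defined on all test forms. -/
theorem exists_isCurrentValue [CompleteSpace X] (hn : 1 ≤ n) (hB : HasOrder B M) (hm : M + 1 ≤ m)
    {ψ : CSpace n → Covec n (0 + 1) ℂ} (hψ : ContDiff ℝ ∞ ψ) (hc : HasCompactSupport ψ) :
    ∃ T : X →L[ℂ] X, IsCurrentValue B m ψ T := by
  have h := integrable_and_integral_omegaM hn m (fun j => (contDiff_bmPair hψ j).continuous)
    (fun j => hasCompactSupport_bmPair hc j)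
  have hd : Decays M fun ξ => ∑ j, bmNorm n * kerIntegral m j (fun ζ => bmPair j (ψ ζ)) ξ :=
    Decays.sum _ fun j _ => ((isSymbol_kerIntegral hn m j (contDiff_bmPair hψ j)
      (hasCompactSupport_bmPair hc j)).decays hm).const_mul _
  refine ⟨extJet M B (jetOf M fun ξ =>
    ∑ j, bmNorm n * kerIntegral m j (fun ζ => bmPair j (ψ ζ)) ξ), fun ξ => (h ξ).1, ?_⟩
  rw [show (fun ξ => formIntegral fun ζ => wedge (omegaM m ξ ζ) (ψ ζ)) =
    fun ξ => ∑ j, bmNorm n * kerIntegral m j (fun ζ => bmPair j (ψ ζ)) ξ from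
      funext fun ξ => (h ξ).2]
  exact isValueAt_extJet hB hd

/-- The image of the current under the Cauchy–Riemann operator. -/
theorem isCurrentValue_dbarFun (hn : 1 ≤ n) (hB : HasOrder B M) {A : Hyperoperator n X}
    (hA : A.ExtendsTo B) {u : CSpace n → ℂ} (hu : ContDiff ℝ ∞ u) (hc : HasCompactSupport u)
    {φ : Test n} (hφ : ∀ ξ, φ ξ = u (toC ξ)) : IsCurrentValue B m (dbarFun u) (A.toCLM φ) := by
  have hd : Differentiable ℝ u := hu.differentiable (by simp)
  have hu1 : ContDiff ℝ 1 u := hu.of_le (by exact_mod_cast le_top)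
  have hcw : ∀ j, HasCompactSupport (wirt u j) := fun j => by
    refine (hc.fderiv (𝕜 := ℝ)).comp_left (g := fun L => conjPart L (eC j)) ?_
    rw [conjPart_zero]
    rfl
  have e : ∀ j, (fun ζ => bmPair j (dbarFun u ζ)) = fun ζ => -bmScale n * wirt u j ζ := fun j =>
    funext fun ζ => bmPair_dbarFun (hd ζ) j
  have h := integrable_and_integral_omegaM hn m (ψ := dbarFun u)
    (fun j => by
      rw [e]
      exact continuous_const.mul (continuous_wirt hu1 j))
    (fun j => by
      rw [e]
      exact (hcw j).mul_left (f := fun _ => -bmScale n))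
  refine ⟨fun ξ => (h ξ).1, ?_⟩
  have hval : (fun ξ => formIntegral fun ζ => wedge (omegaM m ξ ζ) (dbarFun u ζ)) = φ := by
    funext ξ
    obtain ⟨C₀, h₀⟩ := bound_of_hasCompactSupport hu.continuous hc (m + 2)
    choose C hC using fun j => bound_of_hasCompactSupport (continuous_wirt hu1 j) (hcw j) (m + 2)
    have hle : ∀ j, C j ≤ |C₀| + ∑ j, |C j| := fun j => by
      have := Finset.single_le_sum (f := fun j => |C j|) (fun j _ => abs_nonneg _)
        (Finset.mem_univ j)
      have h2 := le_abs_self (C j)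
      have h3 := abs_nonneg C₀
      linarith
    have hle0 : C₀ ≤ |C₀| + ∑ j, |C j| := by
      have h2 := le_abs_self C₀
      have h3 : 0 ≤ ∑ j, |C j| := Finset.sum_nonneg fun j _ => abs_nonneg _
      linarith
    have key := sum_integral_modKer hn m ξ hu1 (C := |C₀| + ∑ j, |C j|)
      (fun z => (h₀ z).trans (by gcongr)) (fun j z => (hC j z).trans (by gcongr; exact hle j))
    rw [(h ξ).2, hφ]
    calc ∑ j, bmNorm n * kerIntegral m j (fun ζ => bmPair j (dbarFun u ζ)) ξ =
        -bmScale n * bmNorm n * ∑ j, ∫ ζ, modKer m j ζ ξ * wirt u j ζ := by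
          rw [Finset.mul_sum]
          refine Finset.sum_congr rfl fun j _ => ?_
          rw [e, kerIntegral, ← integral_const_mul, ← integral_const_mul]
          congr 1
          funext ζ
          ring
      _ = _ := by rw [key, ← mul_assoc, bmConst_eq, one_mul]
  rw [hval]
  -- The scalar integral equals the test function `φ` exactly, so the constant sequence is an
  -- admissible approximation.
  refine ⟨φ.contDiff, M, hB, fun _ => φ.hasCompactSupport.toSchwartzMap φ.contDiff,
    fun ε hε => Eventually.of_forall fun _ k _ l _ ξ => ?_, ?_⟩
  · have e0 : (fun x => φ x - φ.hasCompactSupport.toSchwartzMap φ.contDiff x) = fun _ => 0 := by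
      funext x
      exact sub_self _
    rw [e0, iteratedFDeriv_fun_zero]
    simpa using hε.le
  · change Tendsto (fun _ : ℕ => B (φ.hasCompactSupport.toSchwartzMap φ.contDiff)) atTop _
    rw [hA φ]
    exact tendsto_const_nhds

end Currents

/-! ### Almost holomorphic extensions -/

section Averages

variable {n : ℕ}

/-- The real part of a vector. -/
def reL (n : ℕ) : CSpace n →L[ℝ] RSpace n :=
  (EuclideanSpace.equiv (Fin n) ℝ).symm.toContinuousLinearMap ∘L
    ContinuousLinearMap.pi fun j => Complex.reCLM ∘L
      (EuclideanSpace.proj (𝕜 := ℂ) j : CSpace n →L[ℂ] ℂ).restrictScalars ℝ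

theorem reL_coord (ζ : CSpace n) (j : Fin n) : reL n ζ j = (ζ j).re := rfl

theorem reL_toC (ξ : RSpace n) : reL n (toC ξ) = ξ := by
  ext j
  rw [reL_coord]
  exact Complex.ofReal_re _

theorem eq_toC_add (ζ : CSpace n) : ζ = toC (reL n ζ) + Complex.I • toC (imPart ζ) := by
  ext j
  change ζ j = ((ζ j).re : ℂ) + Complex.I * ((ζ j).im : ℂ)
  rw [mul_comm, Complex.re_add_im]

theorem norm_le_re_add_im (ζ : CSpace n) : ‖ζ‖ ≤ ‖reL n ζ‖ + ‖imPart ζ‖ := by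
  conv_lhs => rw [eq_toC_add ζ]
  refine (norm_add_le _ _).trans ?_
  rw [norm_smul, Complex.norm_I, one_mul, norm_toC, norm_toC]

theorem reL_eC (j : Fin n) : reL n (eC j) = EuclideanSpace.single j 1 := by
  ext k
  rw [reL_coord, eC]
  by_cases h : k = j <;> simp [h]

theorem imPart_eC (j : Fin n) : imPart (eC j : CSpace n) = 0 := by
  ext k
  change ((eC j : CSpace n) k).im = 0
  rw [eC]
  by_cases h : k = j <;> simp [h]

theorem reL_I_smul (ζ : CSpace n) : reL n (Complex.I • ζ) = -imPart ζ := by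
  ext k
  change (Complex.I * ζ k).re = -(ζ k).im
  simp

theorem imPart_I_smul (ζ : CSpace n) : imPart (Complex.I • ζ) = reL n ζ := by
  ext k
  change (Complex.I * ζ k).im = (ζ k).re
  simp

/-- The real line through the real part of a vector in the direction of its imaginary part. -/
def ray (ζ : CSpace n) (s : ℝ) : RSpace n := reL n ζ + s • imPart ζ

theorem continuous_ray (ζ : CSpace n) : Continuous (ray ζ) :=
  continuous_const.add (continuous_id.smul continuous_const)

theorem integrable_one_add_pow_mul (H : 𝓢(ℝ, ℂ)) (K : ℕ) :
    Integrable fun s : ℝ => (1 + |s|) ^ K * ‖H s‖ := by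
  have h := ((H.integrable_pow_mul volume 0).add (H.integrable_pow_mul volume K)).const_mul
    ((2 : ℝ) ^ (K - 1))
  refine h.mono' ?_ (Eventually.of_forall fun s => ?_)
  · exact (((continuous_const.add continuous_abs).pow K).mul
      H.continuous.norm).aestronglyMeasurable
  · rw [Real.norm_of_nonneg (by positivity)]
    have h1 := add_pow_le (zero_le_one' ℝ) (abs_nonneg s) K
    rw [one_pow] at h1
    calc (1 + |s|) ^ K * ‖H s‖ ≤ (2 ^ (K - 1) * (1 + |s| ^ K)) * ‖H s‖ := by gcongr
      _ = _ := by
        simp only [Pi.add_apply, pow_zero, one_mul, Real.norm_eq_abs]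
        ring

variable {F : Type} [NormedAddCommGroup F] [NormedSpace ℂ F]

theorem integrable_smul_ray (H : 𝓢(ℝ, ℂ)) {f : RSpace n → F} (hf : Continuous f) {C : ℝ}
    (hC : ∀ x, ‖f x‖ ≤ C) (ζ : CSpace n) : Integrable fun s => H s • f (ray ζ s) := by
  refine (H.integrable.norm.mul_const C).mono'
    (H.continuous.smul (hf.comp (continuous_ray ζ))).aestronglyMeasurable
    (Eventually.of_forall fun s => ?_)
  rw [norm_smul]
  gcongr
  exact hC _

/-- The average of a function along the rays of a vector. -/
def rayAvg (H : ℝ → ℂ) (f : RSpace n → F) (ζ : CSpace n) : F := ∫ s, H s • f (ray ζ s)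

/-- From `Re ζ = ray ζ s - s Im ζ`. Decay of a function at the points of the ray thereby becomes
decay in `Re ζ`, at the price of `1 + |s|`, which a Schwartz kernel absorbs, and of `1 + |Im ζ|`. -/
theorem one_add_norm_le_ray (ζ : CSpace n) (s : ℝ) :
    1 + ‖reL n ζ‖ ≤ (1 + ‖ray ζ s‖) * ((1 + |s|) * (1 + ‖imPart ζ‖)) := by
  have h1 : ‖reL n ζ‖ ≤ ‖ray ζ s‖ + |s| * ‖imPart ζ‖ := by
    have : reL n ζ = ray ζ s - s • imPart ζ := by rw [ray, add_sub_cancel_right]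
    rw [this]
    refine (norm_sub_le _ _).trans ?_
    rw [norm_smul, Real.norm_eq_abs]
  have := norm_nonneg (ray ζ s)
  have := norm_nonneg (imPart ζ)
  have := abs_nonneg s
  have h2 : 0 ≤ |s| * ‖imPart ζ‖ := by positivity
  have h3 : 0 ≤ ‖ray ζ s‖ * (|s| + ‖imPart ζ‖ + |s| * ‖imPart ζ‖) := by positivity
  nlinarith

theorem norm_rayAvg_le (H : 𝓢(ℝ, ℂ)) (K : ℕ) {f : RSpace n → F} {C : ℝ}
    (hC : ∀ x, (1 + ‖x‖) ^ K * ‖f x‖ ≤ C) (ζ : CSpace n) :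
    (1 + ‖reL n ζ‖) ^ K * ‖rayAvg H f ζ‖ ≤
      (1 + ‖imPart ζ‖) ^ K * (C * ∫ s, (1 + |s|) ^ K * ‖H s‖) := by
  have hb := norm_integral_le_of_norm_le (μ := volume)
    (f := fun s => (((1 + ‖reL n ζ‖) ^ K : ℝ) : ℂ) • (H s • f (ray ζ s)))
    ((integrable_one_add_pow_mul H K).const_mul ((1 + ‖imPart ζ‖) ^ K * C))
    (Eventually.of_forall fun s => by
      rw [norm_smul, norm_smul, Complex.norm_real, Real.norm_of_nonneg (by positivity)]
      calc (1 + ‖reL n ζ‖) ^ K * (‖H s‖ * ‖f (ray ζ s)‖) ≤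
          ((1 + ‖ray ζ s‖) * ((1 + |s|) * (1 + ‖imPart ζ‖))) ^ K * (‖H s‖ * ‖f (ray ζ s)‖) := by
            gcongr
            exact one_add_norm_le_ray ζ s
        _ = (1 + ‖imPart ζ‖) ^ K * ((1 + ‖ray ζ s‖) ^ K * ‖f (ray ζ s)‖) *
            ((1 + |s|) ^ K * ‖H s‖) := by rw [mul_pow, mul_pow]; ring
        _ ≤ _ := by
            gcongr
            exact hC _)
  rw [integral_smul, norm_smul, Complex.norm_real, Real.norm_of_nonneg (by positivity),
    integral_const_mul, mul_assoc] at hb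
  exact hb

/-- The product of a Schwartz function on the line with the coordinate. -/
def mulId (H : 𝓢(ℝ, ℂ)) : 𝓢(ℝ, ℂ) := SchwartzMap.smulLeftCLM ℂ (fun s : ℝ => (s : ℂ)) H

theorem mulId_apply (H : 𝓢(ℝ, ℂ)) (s : ℝ) : mulId H s = s * H s := by
  rw [mulId, SchwartzMap.smulLeftCLM_apply_apply, smul_eq_mul]
  exact Complex.ofRealCLM.hasTemperateGrowth

theorem schwartz_bound (φ : 𝓢(RSpace n, F)) (K : ℕ) :
    ∃ C : ℝ, 0 ≤ C ∧ ∀ x, (1 + ‖x‖) ^ K * ‖φ x‖ ≤ C := by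
  refine ⟨2 ^ K * ((Finset.Iic (K, 0)).sup fun m => SchwartzMap.seminorm ℝ m.1 m.2) φ,
    by positivity, fun x => ?_⟩
  have := SchwartzMap.one_add_le_sup_seminorm_apply (𝕜 := ℝ) (m := (K, 0)) le_rfl le_rfl φ x
  simpa using this

theorem schwartz_bound_zero (φ : 𝓢(RSpace n, F)) : ∃ C : ℝ, 0 ≤ C ∧ ∀ x, ‖φ x‖ ≤ C := by
  obtain ⟨C, h0, hC⟩ := schwartz_bound φ 0
  exact ⟨C, h0, fun x => by simpa using hC x⟩

/-- Differentiation under the integral: real directions keep the kernel, imaginary ones multiply it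
by `s`. Both terms are averages of Schwartz functions again, so smoothness follows by induction. -/
theorem hasFDerivAt_rayAvg [CompleteSpace F] (H : 𝓢(ℝ, ℂ)) (φ : 𝓢(RSpace n, F)) (ζ : CSpace n) :
    HasFDerivAt (rayAvg H φ)
      ((rayAvg H (SchwartzMap.fderivCLM ℝ (RSpace n) F φ) ζ).comp (reL n) +
        (rayAvg (mulId H) (SchwartzMap.fderivCLM ℝ (RSpace n) F φ) ζ).comp (imL n)) ζ := by
  set φ' := SchwartzMap.fderivCLM ℝ (RSpace n) F φ with hφ'
  obtain ⟨C₀, -, h₀⟩ := schwartz_bound_zero φ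
  obtain ⟨C, hC0, hC⟩ := schwartz_bound_zero φ'
  have hi := integrable_smul_ray H φ'.continuous hC ζ
  have hi2 := integrable_smul_ray (mulId H) φ'.continuous hC ζ
  let R : (RSpace n →L[ℝ] F) →L[ℝ] (CSpace n →L[ℝ] F) :=
    (ContinuousLinearMap.compL ℝ (CSpace n) (RSpace n) F).flip (reL n)
  let I : (RSpace n →L[ℝ] F) →L[ℝ] (CSpace n →L[ℝ] F) :=
    (ContinuousLinearMap.compL ℝ (CSpace n) (RSpace n) F).flip (imL n)
  let D : CSpace n → ℝ → (CSpace n →L[ℝ] F) := fun z s =>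
    H s • ((φ' (ray z s)).comp (reL n + s • imL n))
  have hD : ∀ z s, D z s = R (H s • φ' (ray z s)) + I (mulId H s • φ' (ray z s)) := fun z s => by
    ext v
    change H s • (φ' (ray z s)) (reL n v + s • imL n v) =
      H s • (φ' (ray z s)) (reL n v) + mulId H s • (φ' (ray z s)) (imL n v)
    rw [map_add, smul_add, map_smul, mulId_apply, mul_comm, mul_smul, Complex.coe_smul]
  have hval : (∫ s, D ζ s) = (rayAvg H φ' ζ).comp (reL n) +
      (rayAvg (mulId H) φ' ζ).comp (imL n) := by
    simp only [hD]
    rw [integral_add (R.integrable_comp hi) (I.integrable_comp hi2), R.integral_comp_comm hi,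
      I.integral_comp_comm hi2]
    rfl
  rw [← hval]
  refine (hasFDerivAt_integral_of_dominated_of_fderiv_le (μ := volume)
    (F := fun z s => H s • φ (ray z s)) (F' := D) (s := univ)
    (bound := fun s => C * (‖reL n‖ + ‖imL n‖) * ((1 + |s|) ^ 1 * ‖H s‖)) univ_mem
    (Eventually.of_forall fun z => (integrable_smul_ray H φ.continuous h₀ z).aestronglyMeasurable)
    (integrable_smul_ray H φ.continuous h₀ ζ) ?_ ?_ ?_ ?_)
  · rw [show D ζ = _ from funext (hD ζ)]
    exact ((R.integrable_comp hi).add (I.integrable_comp hi2)).aestronglyMeasurable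
  · refine Eventually.of_forall fun s z _ => ?_
    rw [norm_smul]
    have h1 : ‖reL n + s • imL n‖ ≤ (‖reL n‖ + ‖imL n‖) * (1 + |s|) := by
      refine (norm_add_le _ _).trans ?_
      rw [norm_smul, Real.norm_eq_abs]
      nlinarith [norm_nonneg (reL n), norm_nonneg (imL n), abs_nonneg s,
        mul_nonneg (abs_nonneg s) (norm_nonneg (reL n))]
    calc ‖H s‖ * ‖(φ' (ray z s)).comp (reL n + s • imL n)‖ ≤
        ‖H s‖ * (C * ((‖reL n‖ + ‖imL n‖) * (1 + |s|))) := by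
          gcongr
          refine (ContinuousLinearMap.opNorm_comp_le _ _).trans ?_
          gcongr
          exact hC _
      _ = _ := by ring
  · exact (integrable_one_add_pow_mul H 1).const_mul _
  · refine Eventually.of_forall fun s z _ => ?_
    have h1 : HasFDerivAt (fun z : CSpace n => ray z s) (reL n + s • imL n) z :=
      (reL n + s • imL n).hasFDerivAt
    have h2 : HasFDerivAt (fun z : CSpace n => φ (ray z s))
        ((φ' (ray z s)).comp (reL n + s • imL n)) z := by
      have h3 : HasFDerivAt φ (φ' (ray z s)) (ray z s) := φ.differentiableAt.hasFDerivAt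
      exact h3.comp z h1
    exact h2.const_smul (H s)

theorem contDiff_rayAvg (N : ℕ) : ∀ {F : Type} [NormedAddCommGroup F] [NormedSpace ℂ F]
    [CompleteSpace F] (H : 𝓢(ℝ, ℂ)) (φ : 𝓢(RSpace n, F)), ContDiff ℝ N (rayAvg H φ) := by
  induction N with
  | zero =>
    intro F _ _ _ H φ
    exact contDiff_zero.2 (continuous_iff_continuousAt.2 fun ζ =>
      (hasFDerivAt_rayAvg H φ ζ).continuousAt)
  | succ N ih =>
    intro F _ _ _ H φ
    refine contDiff_succ_iff_hasFDerivAt.2 ⟨_, ?_, hasFDerivAt_rayAvg H φ⟩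
    exact ((ih H _).clm_comp contDiff_const).add ((ih (mulId H) _).clm_comp contDiff_const)

end Averages

/-! ### Averaging kernels whose averages vanish to infinite order at the real space -/

section FlatKernels

variable {n : ℕ}

/-- `H` is the Fourier transform of a test function that vanishes near the origin. -/
def IsFlatKernel (H : 𝓢(ℝ, ℂ)) : Prop :=
  ∃ h : ℝ → ℂ, ContDiff ℝ ∞ h ∧ HasCompactSupport h ∧ h =ᶠ[𝓝 0] 0 ∧
    ∀ s, H s = FourierTransform.fourier h s

/-- An antiderivative on the line corresponds to division by `-2πi t` on the Fourier side, which is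
harmless because `h` vanishes near the origin and leaves a kernel of the same kind. -/
theorem IsFlatKernel.antideriv {H : 𝓢(ℝ, ℂ)} (hH : IsFlatKernel H) :
    ∃ K : 𝓢(ℝ, ℂ), IsFlatKernel K ∧ ∀ s, HasDerivAt K (H s) s := by
  obtain ⟨h, h1, h2, h3, h4⟩ := hH
  let k : ℝ → ℂ := fun t => (-2 * Real.pi * Complex.I * t)⁻¹ * h t
  have hne : ∀ t : ℝ, t ≠ 0 → (-2 * Real.pi * Complex.I * t : ℂ) ≠ 0 := fun t ht => by
    simp [ht, Real.pi_ne_zero]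
  have k0 : k =ᶠ[𝓝 0] 0 := by
    filter_upwards [h3] with t ht
    simp [k, ht]
  have kc : HasCompactSupport k := h2.mul_left
  have kd : ContDiff ℝ ∞ k := contDiff_iff_contDiffAt.2 fun t => by
    by_cases ht : t = 0
    · subst ht
      exact contDiffAt_const.congr_of_eventuallyEq k0
    · exact ((contDiffAt_const.mul Complex.ofRealCLM.contDiff.contDiffAt).inv (hne t ht)).mul
        h1.contDiffAt
  let k' : 𝓢(ℝ, ℂ) := kc.toSchwartzMap kd
  have hki : Integrable k := k'.integrable
  have hki2 : Integrable fun t : ℝ => t • k t :=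
    (continuous_id.smul kd.continuous).integrable_of_hasCompactSupport
      (kc.smul_left (f := fun t : ℝ => t))
  refine ⟨FourierTransform.fourier k', ⟨k, kd, kc, k0, fun s => rfl⟩, fun s => ?_⟩
  have := Real.hasDerivAt_fourier hki hki2 s
  rw [h4]
  have e : h = fun t : ℝ => (-2 * Real.pi * Complex.I * t) • k t := by
    funext t
    by_cases ht : t = 0
    · subst ht
      simp [h3.eq_of_nhds]
    · rw [smul_eq_mul, mul_inv_cancel_left₀ (hne t ht)]
  rw [e]
  exact this

/-- Integration by parts in `s`: the derivative of `φ` along the ray is taken in the direction `Im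
ζ`. Each antiderivative of the kernel gains one factor `|Im ζ|`. -/
theorem rayAvg_eq_of_hasDerivAt {F : Type} [NormedAddCommGroup F] [NormedSpace ℂ F]
    [CompleteSpace F] {H K : 𝓢(ℝ, ℂ)} (hK : ∀ s, HasDerivAt K (H s) s) (φ : 𝓢(RSpace n, F))
    (ζ : CSpace n) :
    rayAvg H φ ζ = -rayAvg K (SchwartzMap.fderivCLM ℝ (RSpace n) F φ) ζ (imPart ζ) := by
  set φ' := SchwartzMap.fderivCLM ℝ (RSpace n) F φ with hφ'
  obtain ⟨C₀, -, h₀⟩ := schwartz_bound_zero φ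
  obtain ⟨C, hC0, hC⟩ := schwartz_bound_zero φ'
  have hi := integrable_smul_ray K φ'.continuous hC ζ
  have hi2 : Integrable fun s => K s • φ' (ray ζ s) (imPart ζ) :=
    (ContinuousLinearMap.apply ℝ F (imPart ζ)).integrable_comp hi
  have hu : ∀ s, HasDerivAt (fun s => φ (ray ζ s)) (φ' (ray ζ s) (imPart ζ)) s := fun s => by
    have h3 : HasFDerivAt φ (φ' (ray ζ s)) (ray ζ s) := φ.differentiableAt.hasFDerivAt
    have h4 : HasDerivAt (ray ζ) (imPart ζ) s := by
      have := ((hasDerivAt_id s).smul_const (imPart ζ)).const_add (reL n ζ)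
      rw [one_smul] at this
      exact this
    exact h3.comp_hasDerivAt s h4
  have key := integral_bilinear_hasDerivAt_right_eq_neg_left_of_integrable
    (L := (ContinuousLinearMap.lsmul ℝ ℂ : ℂ →L[ℝ] F →L[ℝ] F).flip)
    (u := fun s => φ (ray ζ s)) (v := K) (u' := fun s => φ' (ray ζ s) (imPart ζ)) (v' := H)
    (fun s _ => hu s) (fun s _ => hK s) (integrable_smul_ray H φ.continuous h₀ ζ) hi2
    (integrable_smul_ray K φ.continuous h₀ ζ)
  refine key.trans ?_
  rw [rayAvg, ContinuousLinearMap.integral_apply hi]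
  rfl

/-- The averages against flat kernels vanish to infinite order at the real space. -/
theorem IsFlatKernel.norm_rayAvg_le (K M : ℕ) : ∀ {F : Type} [NormedAddCommGroup F]
    [NormedSpace ℂ F] [CompleteSpace F] {H : 𝓢(ℝ, ℂ)}, IsFlatKernel H → ∀ φ : 𝓢(RSpace n, F),
    ∃ C : ℝ, 0 ≤ C ∧ ∀ ζ : CSpace n, (1 + ‖reL n ζ‖) ^ K * ‖rayAvg H φ ζ‖ ≤
      (1 + ‖imPart ζ‖) ^ K * (C * ‖imPart ζ‖ ^ M) := by
  induction M with
  | zero =>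
    intro F _ _ _ H hH φ
    obtain ⟨C, hC0, hC⟩ := schwartz_bound φ K
    refine ⟨C * ∫ s, (1 + |s|) ^ K * ‖H s‖,
      mul_nonneg hC0 (integral_nonneg fun s => by positivity), fun ζ => ?_⟩
    rw [pow_zero, mul_one]
    exact HyperOp.norm_rayAvg_le H K hC ζ
  | succ M ih =>
    intro F _ _ _ H hH φ
    obtain ⟨L, hL, hd⟩ := hH.antideriv
    obtain ⟨C, hC0, hC⟩ := ih hL (SchwartzMap.fderivCLM ℝ (RSpace n) F φ)
    refine ⟨C, hC0, fun ζ => ?_⟩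
    rw [rayAvg_eq_of_hasDerivAt hd, norm_neg]
    calc _ ≤ (1 + ‖reL n ζ‖) ^ K *
        (‖rayAvg L (SchwartzMap.fderivCLM ℝ (RSpace n) F φ) ζ‖ * ‖imPart ζ‖) := by
          gcongr
          exact ContinuousLinearMap.le_opNorm _ _
      _ = (1 + ‖reL n ζ‖) ^ K *
        ‖rayAvg L (SchwartzMap.fderivCLM ℝ (RSpace n) F φ) ζ‖ * ‖imPart ζ‖ := by ring
      _ ≤ (1 + ‖imPart ζ‖) ^ K * (C * ‖imPart ζ‖ ^ M) * ‖imPart ζ‖ := by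
          gcongr ?_ * _
          exact hC ζ
      _ = _ := by ring

/-- A kernel of mass one whose averages are almost holomorphic. -/
theorem exists_avgKernel : ∃ G : 𝓢(ℝ, ℂ), ∫ s, G s = 1 ∧
    IsFlatKernel (G + Complex.I • mulId G) := by
  let b : ContDiffBump (0 : ℝ) := ⟨1, 2, one_pos, one_lt_two⟩
  -- By Fourier inversion, averaging against `ĝ` turns `e^{2πi x·η}` into `e^{2πi x·η} g(y·η)`. The
  -- holomorphic continuation would have `g(t) = e^{-2πt}`; this is kept only near 0 and cut off.
  -- The kernel `G + i s G` of `∂̄` then has inverse transform `g + g'/(2π)`, which vanishes near 0.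
  let e : ℝ → ℂ := fun t => Complex.exp ((-2 * Real.pi : ℂ) * t)
  have he : ∀ t : ℝ, HasDerivAt e ((-2 * Real.pi : ℂ) * e t) t := fun t => by
    have h1 : HasDerivAt (fun t : ℝ => (-2 * Real.pi : ℂ) * (t : ℂ)) (-2 * Real.pi : ℂ) t := by
      have := (Complex.ofRealCLM.hasDerivAt (x := t)).const_mul (-2 * Real.pi : ℂ)
      simpa using this
    exact h1.cexp.congr_deriv (mul_comm _ _)
  have hec : ContDiff ℝ ∞ e := (contDiff_const.mul Complex.ofRealCLM.contDiff).cexp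
  have hbc : ContDiff ℝ ∞ fun t => (b t : ℂ) := Complex.ofRealCLM.contDiff.comp b.contDiff
  have hbs : HasCompactSupport fun t => (b t : ℂ) :=
    b.hasCompactSupport.comp_left (g := fun r : ℝ => (r : ℂ)) Complex.ofReal_zero
  let g : ℝ → ℂ := fun t => (b t : ℂ) * e t
  have gd : ContDiff ℝ ∞ g := hbc.mul hec
  have gc : HasCompactSupport g := hbs.mul_right
  have gdd : ContDiff ℝ ∞ (deriv g) := (contDiff_infty_iff_deriv.1 gd).2
  have gdc : HasCompactSupport (deriv g) := gc.deriv
  let g' : 𝓢(ℝ, ℂ) := gc.toSchwartzMap gd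
  have hgi : Integrable g := g'.integrable
  have hgdi : Integrable (deriv g) := gdd.continuous.integrable_of_hasCompactSupport gdc
  have hg0 : g =ᶠ[𝓝 0] e := by
    filter_upwards [b.eventuallyEq_one] with t ht
    simp [g, ht]
  refine ⟨FourierTransform.fourier g', ?_, fun t => g t + (2 * Real.pi : ℂ)⁻¹ * deriv g t,
    gd.add (contDiff_const.mul gdd), gc.add (gdc.mul_left (f := fun _ => (2 * Real.pi : ℂ)⁻¹)),
    ?_, fun s => ?_⟩
  · have h1 : FourierTransformInv.fourierInv (FourierTransform.fourier g') = g' :=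
      FourierTransform.fourierInv_fourier_eq g'
    have h2 := congrArg (fun f : 𝓢(ℝ, ℂ) => f 0) h1
    rw [SchwartzMap.fourierInv_coe, Real.fourierInv_eq] at h2
    have h3 : g' 0 = 1 := by
      change g 0 = 1
      rw [hg0.eq_of_nhds]
      simp [e]
    rw [h3] at h2
    simpa using h2
  · filter_upwards [hg0.eventuallyEq_nhds] with t ht
    rw [ht.eq_of_nhds, ht.deriv_eq, (he t).deriv, ← mul_assoc]
    have : (2 * Real.pi : ℂ)⁻¹ * (-2 * Real.pi) = -1 := by
      have : (Real.pi : ℂ) ≠ 0 := by simp [Real.pi_ne_zero]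
      field_simp
    rw [this]
    simp
  · have h1 : FourierTransform.fourier (fun t => g t + (2 * Real.pi : ℂ)⁻¹ * deriv g t) =
        FourierTransform.fourier g + (2 * Real.pi : ℂ)⁻¹ • FourierTransform.fourier (deriv g) := by
      have h2 := FourierTransform.fourier_add g' ((2 * Real.pi : ℂ)⁻¹ • gdc.toSchwartzMap gdd)
      rw [FourierTransform.fourier_smul] at h2
      exact congrArg (fun f : 𝓢(ℝ, ℂ) => (f : ℝ → ℂ)) h2
    rw [h1, Real.fourier_deriv hgi (gd.differentiable (by simp)) hgdi]
    change FourierTransform.fourier g s +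
      Complex.I * mulId (FourierTransform.fourier g') s =
      FourierTransform.fourier g s + (2 * Real.pi : ℂ)⁻¹ *
        ((2 * Real.pi * Complex.I * s) * FourierTransform.fourier g s)
    rw [mulId_apply]
    have e1 : (FourierTransform.fourier g' : 𝓢(ℝ, ℂ)) s = FourierTransform.fourier g s := rfl
    rw [e1]
    have : (Real.pi : ℂ) ≠ 0 := by simp [Real.pi_ne_zero]
    field_simp

/-- Away from the support the averages vanish to infinite order at the real space. -/
theorem norm_rayAvg_le_of_support (G : 𝓢(ℝ, ℂ)) (φ : 𝓢(RSpace n, ℂ)) {δ : ℝ} (hδ : 0 < δ) (M : ℕ) :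
    ∃ C : ℝ, 0 ≤ C ∧ ∀ ζ : CSpace n, (∀ x, φ x ≠ 0 → δ ≤ ‖x - reL n ζ‖) →
      ‖rayAvg G φ ζ‖ ≤ C * ‖imPart ζ‖ ^ M := by
  obtain ⟨S, hS0, hS⟩ := schwartz_bound_zero φ
  refine ⟨S * δ⁻¹ ^ M * ∫ s, (1 + |s|) ^ M * ‖G s‖,
    mul_nonneg (by positivity) (integral_nonneg fun s => by positivity), fun ζ hζ => ?_⟩
  have hb := norm_integral_le_of_norm_le (μ := volume) (f := fun s => G s • φ (ray ζ s))
    ((integrable_one_add_pow_mul G M).const_mul (S * δ⁻¹ ^ M * ‖imPart ζ‖ ^ M))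
    (Eventually.of_forall fun s => by
      rw [norm_smul]
      by_cases h : φ (ray ζ s) = 0
      · rw [h, norm_zero, mul_zero]
        positivity
      · have h1 := hζ _ h
        rw [ray, add_sub_cancel_left, norm_smul, Real.norm_eq_abs] at h1
        -- The ray meets the support only where `|s| |Im ζ| ≥ δ`, so `M` powers of a quantity at
        -- least 1 may be inserted.
        have h2 : 1 ≤ δ⁻¹ * ((1 + |s|) * ‖imPart ζ‖) := by
          rw [← div_eq_inv_mul, one_le_div hδ]
          refine h1.trans ?_
          gcongr
          linarith
        calc ‖G s‖ * ‖φ (ray ζ s)‖ ≤ ‖G s‖ * S := by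
              gcongr
              exact hS _
          _ ≤ ‖G s‖ * S * (δ⁻¹ * ((1 + |s|) * ‖imPart ζ‖)) ^ M :=
              le_mul_of_one_le_right (by positivity) (one_le_pow₀ h2)
          _ = _ := by
              rw [mul_pow, mul_pow]
              ring)
  rw [integral_const_mul] at hb
  refine hb.trans (le_of_eq ?_)
  ring

end FlatKernels

/-! ### Cut-off averages as almost holomorphic extensions -/

section AlmostHolomorphic

variable {n : ℕ}

/-- Leibniz rule for cutting off: the term `θ ∂̄v` needs flatness of `∂̄v` only where `θ ≠ 0`, while
`v ∂̄θ` needs flatness of `v` itself where `θ` has a non-zero derivative. -/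
theorem isAlmostHolExt_mul {φ : RSpace n → ℂ} {θ v : CSpace n → ℂ} (hθ : ContDiff ℝ ∞ θ)
    (hv : ContDiff ℝ ∞ v) (hφ : ∀ ξ, θ (toC ξ) * v (toC ξ) = φ ξ) (h1 : ∀ ζ, ‖θ ζ‖ ≤ 1)
    {P : ℝ} (hP : ∀ ζ, ‖fderiv ℝ θ ζ‖ ≤ P)
    (hd : ∀ K : ℕ, ∃ C : ℝ, ∀ ζ, θ ζ ≠ 0 → (1 + ‖ζ‖) ^ K * ‖v ζ‖ ≤ C)
    (hw : ∀ K M : ℕ, ∃ C : ℝ, ∀ ζ, θ ζ ≠ 0 → ∀ j,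
      (1 + ‖ζ‖) ^ K * ‖wirt v j ζ‖ ≤ C * ‖imPart ζ‖ ^ M)
    (hf : ∀ K M : ℕ, ∃ C : ℝ, ∀ ζ, fderiv ℝ θ ζ ≠ 0 →
      (1 + ‖ζ‖) ^ K * ‖v ζ‖ ≤ C * ‖imPart ζ‖ ^ M) :
    IsAlmostHolExt φ fun ζ => θ ζ * v ζ where
  smooth := hθ.mul hv
  extends_real := hφ
  decay K := by
    obtain ⟨C, hC⟩ := hd K
    refine ⟨max C 0, fun ζ => ?_⟩
    by_cases h : θ ζ = 0
    · simp [h]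
    · refine le_trans ?_ ((hC ζ h).trans (le_max_left _ _))
      rw [norm_mul]
      gcongr
      exact mul_le_of_le_one_left (norm_nonneg _) (h1 ζ)
  dbar_decay M K := by
    obtain ⟨C, hC⟩ := hw K M
    obtain ⟨C', hC'⟩ := hf K M
    have hP0 : 0 ≤ P := (norm_nonneg _).trans (hP 0)
    refine ⟨n * (max C 0 + P * max C' 0), fun ζ => ?_⟩
    have dθ : DifferentiableAt ℝ θ ζ := hθ.differentiable (by simp) ζ
    have dv : DifferentiableAt ℝ v ζ := hv.differentiable (by simp) ζ
    have key : ∀ j, (1 + ‖ζ‖) ^ K * ‖wirt (fun ζ => θ ζ * v ζ) j ζ‖ ≤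
        (max C 0 + P * max C' 0) * ‖imPart ζ‖ ^ M := fun j => by
      rw [wirt_mul dθ dv]
      have a1 : (1 + ‖ζ‖) ^ K * ‖θ ζ * wirt v j ζ‖ ≤ max C 0 * ‖imPart ζ‖ ^ M := by
        by_cases h : θ ζ = 0
        · rw [h, zero_mul, norm_zero, mul_zero]
          positivity
        · calc (1 + ‖ζ‖) ^ K * ‖θ ζ * wirt v j ζ‖ ≤ (1 + ‖ζ‖) ^ K * ‖wirt v j ζ‖ := by
                rw [norm_mul]
                gcongr
                exact mul_le_of_le_one_left (norm_nonneg _) (h1 ζ)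
            _ ≤ C * ‖imPart ζ‖ ^ M := hC ζ h j
            _ ≤ _ := by
                gcongr
                exact le_max_left _ _
      have a2 : (1 + ‖ζ‖) ^ K * ‖v ζ * wirt θ j ζ‖ ≤ P * max C' 0 * ‖imPart ζ‖ ^ M := by
        have hwn := norm_wirt_le θ j ζ
        by_cases h : fderiv ℝ θ ζ = 0
        · rw [h, norm_zero] at hwn
          rw [norm_le_zero_iff.1 hwn, mul_zero, norm_zero, mul_zero]
          positivity
        · calc (1 + ‖ζ‖) ^ K * ‖v ζ * wirt θ j ζ‖ = ((1 + ‖ζ‖) ^ K * ‖v ζ‖) * ‖wirt θ j ζ‖ := by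
                rw [norm_mul, mul_assoc]
            _ ≤ (max C' 0 * ‖imPart ζ‖ ^ M) * P := by
                refine mul_le_mul ((hC' ζ h).trans ?_) (hwn.trans (hP ζ)) (norm_nonneg _)
                  (by positivity)
                gcongr
                exact le_max_left _ _
            _ = _ := by ring
      calc _ ≤ (1 + ‖ζ‖) ^ K * (‖θ ζ * wirt v j ζ‖ + ‖v ζ * wirt θ j ζ‖) := by
            gcongr
            exact norm_add_le _ _
        _ ≤ _ := by
            rw [mul_add, add_mul]
            exact add_le_add a1 a2
    calc (1 + ‖ζ‖) ^ K * ‖dbarFun (fun ζ => θ ζ * v ζ) ζ‖ ≤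
        (1 + ‖ζ‖) ^ K * ∑ j, ‖wirt (fun ζ => θ ζ * v ζ) j ζ‖ := by
          gcongr
          exact norm_dbarFun_le (dθ.mul dv)
      _ = ∑ j, (1 + ‖ζ‖) ^ K * ‖wirt (fun ζ => θ ζ * v ζ) j ζ‖ := Finset.mul_sum _ _ _
      _ ≤ ∑ _j : Fin n, (max C 0 + P * max C' 0) * ‖imPart ζ‖ ^ M :=
          Finset.sum_le_sum fun j _ => key j
      _ = _ := by
          rw [Finset.sum_const, Finset.card_univ, Fintype.card_fin, nsmul_eq_mul, mul_assoc]

/-- The derivative in `xⱼ` keeps the kernel and that in `yⱼ` multiplies it by `s`, so `∂/∂z̄ⱼ`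
averages `∂φ/∂xⱼ` against `(G + i s G)/2`. -/
theorem wirt_rayAvg (G : 𝓢(ℝ, ℂ)) (φ : 𝓢(RSpace n, ℂ)) (j : Fin n) (ζ : CSpace n) :
    wirt (rayAvg G φ) j ζ = (1 / 2 : ℂ) * rayAvg (G + Complex.I • mulId G : 𝓢(ℝ, ℂ))
      (SchwartzMap.fderivCLM ℝ (RSpace n) ℂ φ) ζ (EuclideanSpace.single j 1) := by
  set φ' := SchwartzMap.fderivCLM ℝ (RSpace n) ℂ φ with hφ'
  obtain ⟨C, hC0, hC⟩ := schwartz_bound_zero φ'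
  have hi := integrable_smul_ray G φ'.continuous hC ζ
  have hi2 := integrable_smul_ray (mulId G) φ'.continuous hC ζ
  have e : rayAvg (G + Complex.I • mulId G : 𝓢(ℝ, ℂ)) φ' ζ =
      rayAvg G φ' ζ + Complex.I • rayAvg (mulId G) φ' ζ := by
    simp only [rayAvg]
    have hi3 : Integrable fun s => Complex.I • mulId G s • φ' (ray ζ s) := hi2.smul Complex.I
    rw [← integral_smul, ← integral_add hi hi3]
    congr 1
    funext s
    change (G s + Complex.I * mulId G s) • φ' (ray ζ s) = _
    rw [add_smul, mul_smul]
  rw [wirt_of_hasFDerivAt (hasFDerivAt_rayAvg G φ ζ), e]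
  change (1 / 2 : ℂ) * (rayAvg G φ' ζ (reL n (eC j)) + rayAvg (mulId G) φ' ζ (imPart (eC j)) +
    Complex.I * (rayAvg G φ' ζ (reL n (Complex.I • eC j)) +
      rayAvg (mulId G) φ' ζ (imPart (Complex.I • eC j)))) = (1 / 2 : ℂ) *
    (rayAvg G φ' ζ (EuclideanSpace.single j 1) +
      Complex.I * rayAvg (mulId G) φ' ζ (EuclideanSpace.single j 1))
  rw [reL_I_smul, imPart_I_smul, imPart_eC, reL_eC, neg_zero, map_zero, map_zero, add_zero,
    zero_add]

/-- Schwartz functions have almost holomorphic extensions, which vanish to infinite order at the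
real space away from the support. -/
theorem exists_isAlmostHolExt (φ : 𝓢(RSpace n, ℂ)) : ∃ u : CSpace n → ℂ, IsAlmostHolExt φ u ∧
    ∀ δ : ℝ, 0 < δ → ∀ M : ℕ, ∃ C : ℝ, 0 ≤ C ∧ ∀ ζ : CSpace n,
      (∀ x, φ x ≠ 0 → δ ≤ ‖x - reL n ζ‖) → ‖u ζ‖ ≤ C * ‖imPart ζ‖ ^ M := by
  obtain ⟨G, hG1, hG⟩ := exists_avgKernel
  let b : ContDiffBump (0 : RSpace n) := ⟨1, 2, one_pos, one_lt_two⟩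
  let ψ : RSpace n → ℂ := fun y => (b y : ℂ)
  have ψd : ContDiff ℝ ∞ ψ := Complex.ofRealCLM.contDiff.comp b.contDiff
  have ψc : HasCompactSupport ψ :=
    b.hasCompactSupport.comp_left (g := fun r : ℝ => (r : ℂ)) Complex.ofReal_zero
  have ψ1 : ∀ y, ‖ψ y‖ ≤ 1 := fun y => by
    rw [Complex.norm_real, Real.norm_of_nonneg b.nonneg]
    exact b.le_one
  have ψ2 : ∀ y, y ∈ tsupport ψ → ‖y‖ ≤ 2 := fun y hy => by
    have h1 : tsupport ψ ⊆ tsupport b := closure_mono fun z hz => by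
      intro h
      exact hz (by simp only [ψ, h, Complex.ofReal_zero])
    have := h1 hy
    rwa [b.tsupport_eq, mem_closedBall_zero_iff] at this
  -- Within `|Im ζ| ≤ 2` the weights in `ζ` and in `Re ζ` are comparable. The cutoff varies only
  -- where `|Im ζ| ≥ 1`, and there powers of `|Im ζ|` in the bounds are free.
  let θ : CSpace n → ℂ := fun ζ => ψ (imPart ζ)
  have θd : ContDiff ℝ ∞ θ := ψd.comp (imL n).contDiff
  have θf : ∀ ζ, fderiv ℝ θ ζ = (fderiv ℝ ψ (imPart ζ)).comp (imL n) := fun ζ =>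
    ((ψd.differentiable (by simp) (imPart ζ)).hasFDerivAt.comp ζ (imL n).hasFDerivAt).fderiv
  obtain ⟨P, hP⟩ := (ψc.fderiv (𝕜 := ℝ)).exists_bound_of_continuous
    (ψd.continuous_fderiv (by simp))
  have hn2 : ∀ ζ : CSpace n, ‖imPart ζ‖ ≤ 2 → 1 + ‖ζ‖ ≤ 3 * (1 + ‖reL n ζ‖) := fun ζ h => by
    have := norm_le_re_add_im ζ
    have := norm_nonneg (reL n ζ)
    linarith
  have hv : ContDiff ℝ ∞ (rayAvg G φ) := contDiff_infty.2 fun N => contDiff_rayAvg N G φ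
  have hdec : ∀ K : ℕ, ∃ C : ℝ, 0 ≤ C ∧ ∀ ζ : CSpace n, ‖imPart ζ‖ ≤ 2 →
      (1 + ‖ζ‖) ^ K * ‖rayAvg G φ ζ‖ ≤ C := fun K => by
    obtain ⟨C, hC0, hC⟩ := schwartz_bound φ K
    have hI : 0 ≤ ∫ s, (1 + |s|) ^ K * ‖G s‖ := integral_nonneg fun s => by positivity
    refine ⟨3 ^ K * (3 ^ K * (C * ∫ s, (1 + |s|) ^ K * ‖G s‖)), by positivity, fun ζ h => ?_⟩
    calc (1 + ‖ζ‖) ^ K * ‖rayAvg G φ ζ‖ ≤ (3 * (1 + ‖reL n ζ‖)) ^ K * ‖rayAvg G φ ζ‖ := by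
          gcongr
          exact hn2 ζ h
      _ = 3 ^ K * ((1 + ‖reL n ζ‖) ^ K * ‖rayAvg G φ ζ‖) := by rw [mul_pow, mul_assoc]
      _ ≤ 3 ^ K * ((1 + ‖imPart ζ‖) ^ K * (C * ∫ s, (1 + |s|) ^ K * ‖G s‖)) := by
          gcongr ?_ * ?_
          exact norm_rayAvg_le G K hC ζ
      _ ≤ _ := by
          gcongr
          linarith
  refine ⟨fun ζ => θ ζ * rayAvg G φ ζ, ?_, fun δ hδ M => ?_⟩
  · refine isAlmostHolExt_mul θd hv (fun ξ => ?_) (fun ζ => ψ1 _) (P := P * ‖imL n‖) (fun ζ => ?_)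
      (fun K => ?_) (fun K M => ?_) fun K M => ?_
    · have h1 : θ (toC ξ) = 1 := by
        simp only [θ, imPart_toC, ψ]
        rw [b.one_of_mem_closedBall (by simp [b]), Complex.ofReal_one]
      have h2 : ∀ s, ray (toC ξ) s = ξ := fun s => by
        rw [ray, imPart_toC, smul_zero, add_zero, reL_toC]
      rw [h1, one_mul, rayAvg]
      simp only [h2]
      rw [integral_smul_const, hG1, one_smul]
    · rw [θf]
      refine (ContinuousLinearMap.opNorm_comp_le _ _).trans ?_
      gcongr
      exact hP _
    · obtain ⟨C, -, hC⟩ := hdec K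
      exact ⟨C, fun ζ h => hC ζ (ψ2 _ (subset_tsupport _ h))⟩
    · obtain ⟨C, hC0, hC⟩ := hG.norm_rayAvg_le K M (SchwartzMap.fderivCLM ℝ (RSpace n) ℂ φ)
      refine ⟨3 ^ K * (3 ^ K * C), fun ζ h j => ?_⟩
      have h2 := ψ2 _ (subset_tsupport _ h)
      have hw : ‖wirt (rayAvg G φ) j ζ‖ ≤ ‖rayAvg (G + Complex.I • mulId G : 𝓢(ℝ, ℂ))
          (SchwartzMap.fderivCLM ℝ (RSpace n) ℂ φ) ζ‖ := by
        rw [wirt_rayAvg, norm_mul]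
        have h3 := (rayAvg (G + Complex.I • mulId G : 𝓢(ℝ, ℂ))
          (SchwartzMap.fderivCLM ℝ (RSpace n) ℂ φ) ζ).le_opNorm (EuclideanSpace.single j 1)
        rw [PiLp.norm_single, norm_one, mul_one] at h3
        have h4 : ‖(1 / 2 : ℂ)‖ ≤ 1 := by norm_num
        exact (mul_le_of_le_one_left (norm_nonneg _) h4).trans h3
      calc (1 + ‖ζ‖) ^ K * ‖wirt (rayAvg G φ) j ζ‖ ≤ (3 * (1 + ‖reL n ζ‖)) ^ K *
            ‖rayAvg (G + Complex.I • mulId G : 𝓢(ℝ, ℂ))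
              (SchwartzMap.fderivCLM ℝ (RSpace n) ℂ φ) ζ‖ := by
            gcongr
            exact hn2 ζ h2
        _ = 3 ^ K * ((1 + ‖reL n ζ‖) ^ K * ‖rayAvg (G + Complex.I • mulId G : 𝓢(ℝ, ℂ))
              (SchwartzMap.fderivCLM ℝ (RSpace n) ℂ φ) ζ‖) := by rw [mul_pow, mul_assoc]
        _ ≤ 3 ^ K * ((1 + ‖imPart ζ‖) ^ K * (C * ‖imPart ζ‖ ^ M)) := by
            gcongr ?_ * ?_
            exact hC ζ
        _ ≤ 3 ^ K * (3 ^ K * (C * ‖imPart ζ‖ ^ M)) := by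
            gcongr
            linarith
        _ = _ := by ring
    · obtain ⟨C, hC0, hC⟩ := hdec K
      refine ⟨C, fun ζ h => ?_⟩
      have h0 : fderiv ℝ ψ (imPart ζ) ≠ 0 := fun h0 => h (by rw [θf, h0, ContinuousLinearMap.zero_comp])
      have h2 : ‖imPart ζ‖ ≤ 2 := ψ2 _ (support_fderiv_subset ℝ h0)
      have h1 : 1 ≤ ‖imPart ζ‖ := by
        by_contra! h1
        refine h0 ?_
        have : ψ =ᶠ[𝓝 (imPart ζ)] fun _ => 1 := by
          filter_upwards [b.eventuallyEq_one_of_mem_ball (by simpa [b] using h1)] with y hy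
          simp [ψ, hy]
        rw [this.fderiv_eq, fderiv_fun_const]
        rfl
      exact (hC ζ h2).trans (le_mul_of_one_le_right hC0 (one_le_pow₀ h1))
  · obtain ⟨C, hC0, hC⟩ := norm_rayAvg_le_of_support G φ hδ M
    refine ⟨C, hC0, fun ζ hζ => ?_⟩
    rw [norm_mul]
    exact (mul_le_of_le_one_left (norm_nonneg _) (ψ1 _)).trans (hC ζ hζ)

/-- A Schwartz function supported near a point has an almost holomorphic extension supported
near that point. -/
theorem exists_isAlmostHolExt_support (φ : 𝓢(RSpace n, ℂ)) {ξ₀ : RSpace n} {ε : ℝ} (hε : 0 < ε)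
    (hφ : ∀ x, φ x ≠ 0 → ‖x - ξ₀‖ ≤ ε / 4) : ∃ u : CSpace n → ℂ, IsAlmostHolExt φ u ∧
    tsupport u ⊆ Metric.closedBall (toC ξ₀) ε := by
  obtain ⟨v, hv, hflat⟩ := exists_isAlmostHolExt φ
  let b : ContDiffBump (toC ξ₀ : CSpace n) := ⟨ε / 2, ε, half_pos hε, half_lt_self hε⟩
  let θ : CSpace n → ℂ := fun y => (b y : ℂ)
  have θd : ContDiff ℝ ∞ θ := Complex.ofRealCLM.contDiff.comp b.contDiff
  have θc : HasCompactSupport θ :=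
    b.hasCompactSupport.comp_left (g := fun r : ℝ => (r : ℂ)) Complex.ofReal_zero
  have θ1 : ∀ y, ‖θ y‖ ≤ 1 := fun y => by
    rw [Complex.norm_real, Real.norm_of_nonneg b.nonneg]
    exact b.le_one
  have θ2 : tsupport θ ⊆ Metric.closedBall (toC ξ₀) ε := by
    have h1 : tsupport θ ⊆ tsupport b := closure_mono fun z hz => by
      intro h
      exact hz (by simp only [θ, h, Complex.ofReal_zero])
    rwa [b.tsupport_eq] at h1
  obtain ⟨P, hP⟩ := (θc.fderiv (𝕜 := ℝ)).exists_bound_of_continuous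
    (θd.continuous_fderiv (by simp))
  refine ⟨fun ζ => θ ζ * v ζ, isAlmostHolExt_mul θd hv.smooth (fun ξ => ?_) θ1 hP (fun K => ?_)
    (fun K M => ?_) fun K M => ?_, (tsupport_mul_subset_left (f := θ) (g := v)).trans θ2⟩
  · rw [hv.extends_real]
    by_cases h : φ ξ = 0
    · rw [h, mul_zero]
    · have h1 : θ (toC ξ) = 1 := by
        have : toC ξ ∈ Metric.closedBall (toC ξ₀ : CSpace n) (ε / 2) := by
          rw [Metric.mem_closedBall, dist_eq_norm, dist_toC]
          linarith [hφ ξ h]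
        change ((b (toC ξ) : ℝ) : ℂ) = 1
        rw [b.one_of_mem_closedBall this, Complex.ofReal_one]
      rw [h1, one_mul]
  · obtain ⟨C, hC⟩ := hv.decay K
    exact ⟨C, fun ζ _ => hC ζ⟩
  · obtain ⟨C, hC⟩ := hv.dbar_decay M K
    refine ⟨C, fun ζ _ j => le_trans ?_ (hC ζ)⟩
    gcongr
    exact norm_wirt_le_dbarFun (hv.smooth.differentiable (by simp) ζ) j
  · obtain ⟨C, hC0, hC⟩ := hflat (ε / 8) (by positivity) M
    obtain ⟨S, hS⟩ := hv.decay 0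
    have hS0 : 0 ≤ S := le_trans (by positivity) (hS 0)
    refine ⟨(1 + (‖ξ₀‖ + ε)) ^ K * (C + S * (8 / ε) ^ M), fun ζ h => ?_⟩
    have h2 : ‖ζ - toC ξ₀‖ ≤ ε := by
      rw [← dist_eq_norm, ← Metric.mem_closedBall]
      exact θ2 (support_fderiv_subset ℝ h)
    have h1 : ε / 2 ≤ ‖ζ - toC ξ₀‖ := by
      by_contra! h1
      refine h ?_
      have : θ =ᶠ[𝓝 ζ] fun _ => 1 := by
        filter_upwards [b.eventuallyEq_one_of_mem_ball
          (by rwa [Metric.mem_ball, dist_eq_norm])] with y hy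
        simp [θ, hy]
      rw [this.fderiv_eq, fderiv_fun_const]
      rfl
    have h3 : 1 + ‖ζ‖ ≤ 1 + (‖ξ₀‖ + ε) := by
      have : ‖ζ‖ ≤ ‖toC ξ₀‖ + ‖ζ - toC ξ₀‖ := by
        simpa using norm_add_le (toC ξ₀) (ζ - toC ξ₀)
      rw [norm_toC] at this
      linarith
    have h4 : ‖v ζ‖ ≤ (C + S * (8 / ε) ^ M) * ‖imPart ζ‖ ^ M := by
      rw [add_mul]
      -- On the shell where the cutoff varies, either `|Im ζ| ≥ ε/8` and flatness is free, or `Re ζ`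
      -- is at least `ε/2 - ε/8` from `ξ₀`. In the latter case it is at least `ε/8` from the support
      -- of `φ`, and the average is flat there.
      rcases le_total (ε / 8) ‖imPart ζ‖ with hy | hy
      · refine le_add_of_nonneg_of_le (by positivity) ?_
        rw [mul_assoc, ← mul_pow]
        have h5 : 1 ≤ 8 / ε * ‖imPart ζ‖ := by
          calc (1 : ℝ) = 8 / ε * (ε / 8) := by field_simp
            _ ≤ _ := by gcongr
        have := hS ζ
        rw [pow_zero, one_mul] at this
        exact this.trans (le_mul_of_one_le_right hS0 (one_le_pow₀ h5))
      · refine le_add_of_le_of_nonneg (hC ζ fun x hx => ?_) (by positivity)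
        have h5 := norm_le_re_add_im (ζ - toC ξ₀)
        have h6 : imPart (ζ - toC ξ₀) = imPart ζ := by
          rw [← imL_apply, map_sub, imL_apply, imL_apply, imPart_toC, sub_zero]
        rw [map_sub, reL_toC, h6] at h5
        have h7 : ‖reL n ζ - ξ₀‖ ≤ ‖x - reL n ζ‖ + ‖x - ξ₀‖ := by
          have : reL n ζ - ξ₀ = -(x - reL n ζ) + (x - ξ₀) := by abel
          rw [this]
          exact (norm_add_le _ _).trans (by rw [norm_neg])
        linarith [hφ x hx]
    calc (1 + ‖ζ‖) ^ K * ‖v ζ‖ ≤ (1 + (‖ξ₀‖ + ε)) ^ K *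
        ((C + S * (8 / ε) ^ M) * ‖imPart ζ‖ ^ M) := by gcongr
      _ = _ := by ring

end AlmostHolomorphic

/-! ### Obstruction to closed extensions -/

section Divergence

variable {E : Type*} [NormedAddCommGroup E] [NormedSpace ℝ E]

/-- The divergence theorem on a cube that contains all supports, so that every face term vanishes.
Only differentiability and integrability of the divergence enter, so continuity of the derivatives
of a closed extension need not be assumed. -/
theorem integral_divergence_pi_eq_zero {k : ℕ} (f : Fin (k + 1) → (Fin (k + 1) → ℝ) → E)
    (hf : ∀ i, Differentiable ℝ (f i)) (hc : ∀ i, HasCompactSupport (f i))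
    (hi : Integrable fun x => ∑ i, fderiv ℝ (f i) x (Pi.single i 1)) :
    ∫ x, ∑ i, fderiv ℝ (f i) x (Pi.single i 1) = 0 := by
  have hb : Bornology.IsBounded (⋃ i, tsupport (f i)) :=
    Bornology.isBounded_iUnion.2 fun i => (hc i).isBounded
  obtain ⟨R, hR0, hR⟩ := hb.exists_pos_norm_lt
  have hout : ∀ i x, R ≤ ‖x‖ → f i x = 0 := fun i x hx => by
    by_contra h
    exact (hR x (mem_iUnion.2 ⟨i, subset_tsupport _ h⟩)).not_ge hx
  have hface : ∀ (i : Fin (k + 1)) (x : Fin k → ℝ) (r : ℝ), |r| = R → f i (i.insertNth r x) = 0 :=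
    fun i x r hr => hout i _ (by
      have := norm_le_pi_norm (i.insertNth r x : Fin (k + 1) → ℝ) i
      rwa [Fin.insertNth_apply_same, Real.norm_eq_abs, hr] at this)
  have key := integral_divergence_of_hasFDerivAt_off_countable' (E := E)
    (fun _ => -R : Fin (k + 1) → ℝ) (fun _ => R) (fun _ => by linarith) f
    (fun i => fderiv ℝ (f i)) ∅ countable_empty (fun i => (hf i).continuous.continuousOn)
    (fun x _ i => (hf i x).hasFDerivAt) hi.integrableOn
  have h0 : ∀ x ∉ Icc (fun _ => -R : Fin (k + 1) → ℝ) (fun _ => R),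
      ∑ i, fderiv ℝ (f i) x (Pi.single i 1) = 0 := fun x hx => by
    refine Finset.sum_eq_zero fun i _ => ?_
    have h1 : x ∉ tsupport (f i) := fun h => hx <| by
      have h2 := hR x (mem_iUnion.2 ⟨i, h⟩)
      have h3 : ∀ j, |x j| ≤ R := fun j => (norm_le_pi_norm x j).trans h2.le
      exact ⟨fun j => (abs_le.1 (h3 j)).1, fun j => (abs_le.1 (h3 j)).2⟩
    rw [fderiv_of_notMem_tsupport ℝ h1]
    rfl
  rw [← setIntegral_eq_integral_of_forall_compl_eq_zero h0, key]
  refine Finset.sum_eq_zero fun i _ => ?_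
  rw [setIntegral_eq_zero_of_forall_eq_zero, setIntegral_eq_zero_of_forall_eq_zero, sub_zero]
  · exact fun x _ => hface i x _ (by rw [abs_neg, abs_of_pos hR0])
  · exact fun x _ => hface i x _ (abs_of_pos hR0)

variable {V : Type*} [NormedAddCommGroup V] [NormedSpace ℝ V] [MeasurableSpace V] [BorelSpace V]

/-- Linear coordinates turn the basis into the standard one and the Haar measure into a positive
multiple of Lebesgue measure. -/
theorem integral_divergence_basis_eq_zero (μ : Measure V) [μ.IsAddHaarMeasure] {ι : Type*}
    [Fintype ι] [Nonempty ι] (b : Module.Basis ι ℝ V) (f : ι → V → E)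
    (hf : ∀ i, Differentiable ℝ (f i)) (hc : ∀ i, HasCompactSupport (f i))
    (hi : Integrable (fun x => ∑ i, fderiv ℝ (f i) x (b i)) μ) :
    ∫ x, ∑ i, fderiv ℝ (f i) x (b i) ∂μ = 0 := by
  obtain ⟨k, hk⟩ : ∃ k, Fintype.card ι = k + 1 := Nat.exists_eq_succ_of_ne_zero Fintype.card_ne_zero
  let r : ι ≃ Fin (k + 1) := Fintype.equivFinOfCardEq hk
  have : FiniteDimensional ℝ V := b.finiteDimensional_of_finite
  let e : V ≃L[ℝ] (Fin (k + 1) → ℝ) := (b.reindex r).equivFun.toContinuousLinearEquiv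
  have he : ∀ i, e.symm (Pi.single (r i) 1) = b i := fun i => by
    change (b.reindex r).equivFun.symm (Pi.single (r i) 1) = b i
    simp [Module.Basis.equivFun_symm_apply, Pi.single_apply]
  let g : Fin (k + 1) → (Fin (k + 1) → ℝ) → E := fun i y => f (r.symm i) (e.symm y)
  have hg : ∀ y, ∑ i, fderiv ℝ (g i) y (Pi.single i 1) =
      ∑ i, fderiv ℝ (f i) (e.symm y) (b i) := fun y => by
    rw [← Equiv.sum_comp r]
    refine Finset.sum_congr rfl fun i _ => ?_
    have h1 : HasFDerivAt (g (r i)) ((fderiv ℝ (f i) (e.symm y)).comp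
        (e.symm : (Fin (k + 1) → ℝ) →L[ℝ] V)) y := by
      have h2 := (hf (r.symm (r i)) (e.symm y)).hasFDerivAt.comp y e.symm.hasFDerivAt
      rw [Equiv.symm_apply_apply] at h2
      have h3 : g (r i) = f i ∘ e.symm := by
        funext y
        simp only [g, Equiv.symm_apply_apply, Function.comp_apply]
      rw [h3]
      exact h2
    rw [h1.fderiv]
    change fderiv ℝ (f i) (e.symm y) (e.symm (Pi.single (r i) 1)) = _
    rw [he]
  have hm : MeasurableEmbedding e := e.toHomeomorph.measurableEmbedding
  have hmap : μ.map e = (μ.map e).addHaarScalarFactor volume • volume :=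
    Measure.isAddLeftInvariant_eq_smul _ _
  have hc0 : (μ.map e).addHaarScalarFactor volume ≠ 0 :=
    (Measure.addHaarScalarFactor_pos_of_isAddHaarMeasure _ _).ne'
  have hI : Integrable (fun y => ∑ i, fderiv ℝ (f i) (e.symm y) (b i)) (μ.map e) := by
    rw [hm.integrable_map_iff]
    refine hi.congr (Eventually.of_forall fun x => ?_)
    simp
  rw [hmap] at hI
  have hI2 : Integrable fun y => ∑ i, fderiv ℝ (f i) (e.symm y) (b i) := by
    refine (integrable_smul_measure (c := (μ.map e).addHaarScalarFactor volume)
      (by exact_mod_cast hc0) (by simp)).1 hI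
  simp only [← hg] at hI2
  have key := integral_divergence_pi_eq_zero g (fun i => (hf _).comp e.symm.differentiable)
    (fun i => (hc _).comp_homeomorph e.symm.toHomeomorph) hI2
  simp only [hg] at key
  have h4 : ∫ x, ∑ i, fderiv ℝ (f i) x (b i) ∂μ =
      ∫ y, ∑ i, fderiv ℝ (f i) (e.symm y) (b i) ∂(μ.map e) := by
    rw [hm.integral_map]
    simp
  rw [h4, hmap, integral_smul_nnreal_measure, key, smul_zero]

end Divergence

/-! ### Stokes' theorem for closed extensions of the operator-valued form -/

section Obstruction

variable {n : ℕ} {F : Type*} [NormedAddCommGroup F] [NormedSpace ℂ F]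

/-- The sum is the real divergence, in the directions `eⱼ` and `i eⱼ`, of the fields `hⱼ/2` and `i
hⱼ/2`. -/
theorem integral_sum_wirt_eq_zero (hn : 1 ≤ n) {h : Fin n → CSpace n → F}
    (hd : ∀ j, Differentiable ℝ (h j)) (hc : ∀ j, HasCompactSupport (h j))
    (hi : Integrable fun ζ => ∑ j, wirt (h j) j ζ) : ∫ ζ, ∑ j, wirt (h j) j ζ = 0 := by
  let b : Module.Basis (Fin 2 × Fin n) ℝ (CSpace n) :=
    Complex.basisOneI.smulTower (EuclideanSpace.basisFun (Fin n) ℂ).toBasis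
  have : Nonempty (Fin n) := ⟨⟨0, hn⟩⟩
  let f : Fin 2 × Fin n → CSpace n → F := fun p ζ =>
    (if p.1 = 0 then (1 / 2 : ℂ) else (1 / 2 : ℂ) * Complex.I) • h p.2 ζ
  have hb0 : ∀ j, b (0, j) = eC j := fun j => by
    rw [Module.Basis.smulTower_apply]
    simp [eC]
  have hb1 : ∀ j, b (1, j) = Complex.I • eC j := fun j => by
    rw [Module.Basis.smulTower_apply]
    simp [eC]
  have e : ∀ ζ, ∑ p, fderiv ℝ (f p) ζ (b p) = ∑ j, wirt (h j) j ζ := fun ζ => by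
    rw [Fintype.sum_prod_type, Fin.sum_univ_two, ← Finset.sum_add_distrib]
    refine Finset.sum_congr rfl fun j _ => ?_
    have h0 : fderiv ℝ (f (0, j)) ζ = (1 / 2 : ℂ) • fderiv ℝ (h j) ζ :=
      ((hd j ζ).hasFDerivAt.const_smul (1 / 2 : ℂ)).fderiv
    have h1 : fderiv ℝ (f (1, j)) ζ = ((1 / 2 : ℂ) * Complex.I) • fderiv ℝ (h j) ζ :=
      ((hd j ζ).hasFDerivAt.const_smul ((1 / 2 : ℂ) * Complex.I)).fderiv
    rw [h0, h1, hb0, hb1, wirt_apply, smul_add, smul_smul]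
    rfl
  have key := integral_divergence_basis_eq_zero (volume : Measure (CSpace n)) b f
    (fun p => (hd p.2).const_smul _) (fun p => (hc p.2).smul_left (f := fun _ : CSpace n =>
      (if p.1 = 0 then (1 / 2 : ℂ) else (1 / 2 : ℂ) * Complex.I)))
    (by simpa only [e] using hi)
  simpa only [e] using key

variable {X : Type*} [NormedAddCommGroup X] [NormedSpace ℂ X] [CompleteSpace X]
  {M m : ℕ} {B : 𝓢(RSpace n, ℂ) →L[ℂ] (X →L[ℂ] X)}

/-- A closed extension of the form annihilates the functions with almost holomorphic extensions
supported in its domain. -/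
theorem eq_zero_of_closed_extension (hn : 1 ≤ n) (hB : HasOrder B M) (hm : M + 1 ≤ m)
    {K : Set (CSpace n)} (hK : IsClosed K)
    {Ω' : CSpace n → Covec n (1 + 2 * (n - 1)) (X →L[ℂ] X)}
    (heq : EqOn Ω' (opForm M B m) (realSet n ∪ K)ᶜ) (hΩ : IsDbarClosedOn Ω' Kᶜ)
    {φ : 𝓢(RSpace n, ℂ)} {u : CSpace n → ℂ} (hu : IsAlmostHolExt φ u) (hc : HasCompactSupport u)
    (hs : tsupport u ⊆ Kᶜ) : B φ = 0 := by
  let g : Fin n → CSpace n → (X →L[ℂ] X) := fun j ζ => bmCoord j (Ω' ζ)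
  have hΩd : ∀ ζ ∈ Kᶜ, DifferentiableAt ℝ Ω' ζ := fun ζ hζ =>
    (hΩ.1 ζ hζ).differentiableAt (hK.isOpen_compl.mem_nhds hζ)
  have hgd : ∀ j, ∀ ζ ∈ Kᶜ, DifferentiableAt ℝ (g j) ζ := fun j ζ hζ =>
    (bmCoord (F := X →L[ℂ] X) j).differentiableAt.comp ζ (hΩd ζ hζ)
  have hg : ∀ ζ ∈ Kᶜ, ζ ∉ realSet n → ∀ j, g j ζ = opKer M B m j ζ := fun ζ h1 h2 j => by
    simp only [g]
    rw [heq (by simp [h2] at h1 ⊢; exact h1), opForm, bmCoord_bmComb]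
  -- A form of this degree could have components outside the span of the `Eⱼ`. By continuity and
  -- density of the non-real points, `Ω'` has none on its domain.
  have hcomb : ∀ ζ ∈ Kᶜ, Ω' ζ = bmComb fun j => g j ζ := by
    have hcont : ContinuousOn (fun ζ => bmComb fun j => g j ζ) Kᶜ := fun ζ hζ =>
      (hasFDerivAt_bmComb fun j => (hgd j ζ hζ).hasFDerivAt).continuousAt.continuousWithinAt
    have hE : EqOn Ω' (fun ζ => bmComb fun j => g j ζ) ((realSet n)ᶜ ∩ Kᶜ) := fun ζ hζ => by
      have h1 : Ω' ζ = bmComb fun j => opKer M B m j ζ := heq (by rw [compl_union]; exact hζ)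
      simp only [hg ζ hζ.2 hζ.1]
      exact h1
    refine hE.of_subset_closure hΩ.1.continuousOn hcont inter_subset_right ?_
    rw [inter_comm]
    exact (dense_compl_realSet hn).open_subset_closure_inter hK.isOpen_compl
  have hsum : ∀ ζ ∈ Kᶜ, ∑ j, wirt (g j) j ζ = 0 := fun ζ hζ => by
    have h1 : dbar Ω' ζ = dbar (fun ζ => bmComb fun j => g j ζ) ζ := dbar_congr <| by
      filter_upwards [hK.isOpen_compl.mem_nhds hζ] with z hz using hcomb z hz
    rw [hΩ.2 ζ hζ] at h1
    have h2 := dbar_bmComb_frame fun j => hgd j ζ hζ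
    rw [← h1] at h2
    exact (smul_eq_zero.1 h2.symm).resolve_left (bmScale_ne_zero n)
  have hud : Differentiable ℝ u := hu.smooth.differentiable (by simp)
  let h : Fin n → CSpace n → (X →L[ℂ] X) := fun j ζ => u ζ • g j ζ
  have hzero : ∀ ζ ∉ tsupport u, ∀ j, h j =ᶠ[𝓝 ζ] 0 := fun ζ hζ j => by
    filter_upwards [notMem_tsupport_iff_eventuallyEq.1 hζ] with z hz
    simp [h, hz]
  have hhd : ∀ j, Differentiable ℝ (h j) := fun j ζ => by
    by_cases hζ : ζ ∈ tsupport u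
    · exact (hud ζ).smul (hgd j ζ (hs hζ))
    · exact (differentiableAt_const 0).congr_of_eventuallyEq (hzero ζ hζ j)
  have hwz : ∀ ζ ∉ tsupport u, ∀ j, wirt u j ζ = 0 := fun ζ hζ j => by
    rw [wirt, fderiv_of_notMem_tsupport ℝ hζ, conjPart_zero]
    rfl
  -- Closedness removes the terms in which the derivative falls on `gⱼ`, so the integrand of the
  -- representation is, up to a constant, the divergence of the compactly supported fields `u gⱼ`.
  have hhw : ∀ ζ, ∑ j, wirt (h j) j ζ = ∑ j, wirt u j ζ • g j ζ := fun ζ => by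
    by_cases hζ : ζ ∈ tsupport u
    · have h1 : ∀ j, wirt (h j) j ζ = u ζ • wirt (g j) j ζ + wirt u j ζ • g j ζ := fun j =>
        wirt_smul (hud ζ) (hgd j ζ (hs hζ)) j
      simp only [h1]
      rw [Finset.sum_add_distrib, ← Finset.smul_sum, hsum ζ (hs hζ), smul_zero, zero_add]
    · refine Finset.sum_congr rfl fun j _ => ?_
      rw [wirt_congr (hzero ζ hζ j), hwz ζ hζ, zero_smul]
      rw [wirt, fderiv_zero, Pi.zero_apply, conjPart_zero]
      rfl
  obtain ⟨hI, hval⟩ := integral_representation hn hB hm hu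
  have hae : density (fun ζ => wedge (opForm M B m ζ) (dbarFun u ζ)) =ᵐ[volume]
      fun ζ => (-bmScale n) • ∑ j, wirt (h j) j ζ := by
    filter_upwards [ae_notMem_realSet hn] with ζ hr
    have h1 := wedge_bmComb (fun j => opKer M B m j ζ) (dbarFun u ζ)
    refine h1.trans ?_
    rw [hhw, Finset.smul_sum]
    refine Finset.sum_congr rfl fun j _ => ?_
    rw [bmPair_dbarFun (hud ζ), smul_smul]
    by_cases hζ : ζ ∈ tsupport u
    · rw [hg ζ (hs hζ) hr]
    · rw [hwz ζ hζ, mul_zero, zero_smul, zero_smul]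
  have hI2 : Integrable fun ζ => ∑ j, wirt (h j) j ζ :=
    (integrable_smul_iff (neg_ne_zero.2 (bmScale_ne_zero n)) _).1 (hI.congr hae)
  rw [hval, formIntegral, integral_congr_ae hae, integral_smul,
    integral_sum_wirt_eq_zero hn hhd (fun j => hc.smul_right) hI2, smul_zero]

/-- The spectrum obstructs closed extensions of the form. -/
theorem spectrum_subset_of_closed_extension (hn : 1 ≤ n) {A : Hyperoperator n X}
    (hA : A.ExtendsTo B) (hB : HasOrder B M) (hm : M + 1 ≤ m) {K : Set (CSpace n)}
    (hK : IsClosed K) {Ω' : CSpace n → Covec n (1 + 2 * (n - 1)) (X →L[ℂ] X)}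
    (heq : EqOn Ω' (opForm M B m) (realSet n ∪ K)ᶜ) (hΩ : IsDbarClosedOn Ω' Kᶜ) :
    toC '' A.spectrum ⊆ K := by
  rintro _ ⟨ξ₀, hξ, rfl⟩
  by_contra hmem
  obtain ⟨ε, hε, hball⟩ := Metric.nhds_basis_closedBall.mem_iff.1 (hK.isOpen_compl.mem_nhds hmem)
  -- Support radius `ε/4` allows an almost holomorphic extension supported in the ball of radius
  -- `ε`, which avoids `K`; hence `A` vanishes near `ξ₀`.
  have key : Distribution.IsVanishingOn (fun φ : Test n => A.toCLM φ) (Metric.ball ξ₀ (ε / 4)) := by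
    intro φ hφ
    obtain ⟨u, hu, hus⟩ := exists_isAlmostHolExt_support
      (φ.hasCompactSupport.toSchwartzMap φ.contDiff) hε (ξ₀ := ξ₀) fun x hx => by
        have := hφ (subset_tsupport _ hx)
        rw [Metric.mem_ball, dist_eq_norm] at this
        exact this.le
    change A.toCLM φ = 0
    rw [← hA φ]
    exact eq_zero_of_closed_extension hn hB hm hK heq hΩ hu
      ((isCompact_closedBall _ _).of_isClosed_subset (isClosed_tsupport _) hus) (hus.trans hball)
  exact Distribution.notMem_dsupport_iff ξ₀ |>.2
    ⟨_, key, Metric.isOpen_ball, Metric.mem_ball_self (by positivity)⟩ hξ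

end Obstruction

end HyperOp

end

theorem proposition7p1 {n : ℕ} (hn : 1 ≤ n) {X : Type*} [NormedAddCommGroup X] [NormedSpace ℂ X]
    [CompleteSpace X] (A : Hyperoperator n X) (B : 𝓢(RSpace n, ℂ) →L[ℂ] (X →L[ℂ] X))
    (hB : A.ExtendsTo B) :
    ∃ m₀ : ℕ, ∀ m : ℕ, m₀ ≤ m →
      ∃ Ω : CSpace n → Covec n (1 + 2 * (n - 1)) (X →L[ℂ] X),
        -- the form is well defined off the real space, smooth and closed there
        IsOmegaAt B m Ω ∧
        ContDiffOn ℝ ∞ Ω (realSet n)ᶜ ∧ IsDbarClosedOn Ω (realSet n)ᶜ ∧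
        -- it has a smooth closed extension to the complement of the spectrum
        (∃ Ω' : CSpace n → Covec n (1 + 2 * (n - 1)) (X →L[ℂ] X),
          EqOn Ω' Ω (realSet n)ᶜ ∧ ContDiffOn ℝ ∞ Ω' (toC '' A.spectrum)ᶜ ∧
            IsDbarClosedOn Ω' (toC '' A.spectrum)ᶜ) ∧
        -- the integral representation
        (∀ φ : 𝓢(RSpace n, ℂ),
          (∃ u : CSpace n → ℂ, IsAlmostHolExt φ u) ∧
          ∀ u : CSpace n → ℂ, IsAlmostHolExt φ u →
            Integrable (density (fun ζ => wedge (Ω ζ) (dbarFun u ζ))) ∧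
              B φ = formIntegral (fun ζ => wedge (Ω ζ) (dbarFun u ζ))) ∧
        -- the form defines a current whose image under the Cauchy-Riemann operator is `[a]`
        (∀ ψ : CSpace n → Covec n (0 + 1) ℂ, ContDiff ℝ ∞ ψ → HasCompactSupport ψ →
          ∃ T : X →L[ℂ] X, IsCurrentValue B m ψ T) ∧
        (∀ u : CSpace n → ℂ, ContDiff ℝ ∞ u → HasCompactSupport u →
          ∀ φ : Test n, (∀ ξ, φ ξ = u (toC ξ)) → IsCurrentValue B m (dbarFun u) (A.toCLM φ)) ∧
        -- any closed extension is obstructed by the spectrum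
        (∀ F : Set (CSpace n), IsClosed F →
          ∀ Ω' : CSpace n → Covec n (1 + 2 * (n - 1)) (X →L[ℂ] X),
            EqOn Ω' Ω (realSet n ∪ F)ᶜ → IsDbarClosedOn Ω' Fᶜ →
              toC '' A.spectrum ⊆ F) := by
  obtain ⟨M, hM⟩ := exists_hasOrder B
  -- The threshold is the order of `B` plus one: the extra power of decay is what makes truncations
  -- converge in the weighted norm.
  refine ⟨M + 1, fun m hm => ⟨opForm M B m, isOmegaAt_opForm hn hM hm, fun ζ hζ =>
    (contDiffAt_opForm hn B hm hζ).contDiffWithinAt, ⟨fun ζ hζ =>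
      ((contDiffAt_opForm hn B hm hζ).differentiableAt (by simp)).differentiableWithinAt,
      fun ζ hζ => dbar_opForm hn B hm hζ⟩, exists_extension hn hB hM hm, fun φ => ⟨?_, fun u hu =>
      integral_representation hn hM hm hu⟩, fun ψ hψ hc => exists_isCurrentValue hn hM hm hψ hc,
    fun u hu hc φ hφ => isCurrentValue_dbarFun hn hM hB hu hc hφ, fun K hK Ω' heq hΩ =>
      spectrum_subset_of_closed_extension hn hB hM hm hK heq hΩ⟩⟩
  obtain ⟨u, hu, -⟩ := exists_isAlmostHolExt φ
  exact ⟨u, hu⟩
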